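/- Let $\sigma>0$, let $m>1$ be an integer, $\mathbb T=\mathbb R/2\pi\mathbb Z$ and $\Pi=\mathbb T\times[0,1]$. Let $Y_\sigma^m(\Pi)$ be the complex Banach space of all functions $a(x,\psi)=\sum_{k\in\mathbb Z}\hat a_k(\psi)e^{ikx}$ in $L^2(\Pi)$ whose partial Fourier coefficients $\hat a_k$ have weak derivatives $D^p\hat a_k\in L^2[0,1]$ for $0\le p\le m$ and for which $$\|a\|_{Y_\sigma^m}^2=\sum_{p+q\le m}\ \sum_{k\in\mathbb Z}k^{2q}e^{2\sigma|k|}\,\|D^p\hat a_k\|_{L^2[0,1]}^2<\infty\qquad(\text{with }0^0=1).$$ Every $a\in Y_\sigma^m(\Pi)$ has a unique continuation $a(z,\psi)$ which is $2\pi$-periodic in $z$, continuous on $\{|\operatorname{Im} z|\le\sigma\}\times[0,1]$, holomorphic in $z$ on $\{|\operatorname{Im} z|<\sigma\}$ for each $\psi\in[0,1]$, and equal to $a(x,\psi)$ for almost every real $(x,\psi)$. The image of $a$ is the set of values $a(z,\psi)$, $|\operatorname{Im} z|\le\sigma$, $\psi\in[0,1]$. Let $U\subset\mathbb C$ be open and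 let $f$ be complex analytic on $U$. Then the set $\mathcal U$ of all $a\in Y_\sigma^m(\Pi)$ whose image is contained in $U$ is open in $Y_\sigma^m(\Pi)$; for each $a\in\mathcal U$ the function $f(a(z,\psi))$ is the continuation of an element $f(a)$ of $Y_\sigma^m(\Pi)$; and the map $a\mapsto f(a)$, $\mathcal U\to Y_\sigma^m(\Pi)$, is (complex) analytic with respect to the norm of $Y_\sigma^m(\Pi)$. -/

import Mathlib

open MeasureTheory Set
open scoped ENNReal ContDiff

noncomputable section

namespace PartialAnalytic

instance fact_two_pi_pos : Fact (0 < 2 * Real.pi) := ⟨Real.two_pi_pos⟩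

/-- The circle of length `2 * π`. -/
abbrev Circ : Type := AddCircle (2 * Real.pi)

/-- Lebesgue measure on `[0,1]`, as a measure on the line. -/
abbrev intervalMeasure : Measure ℝ := volume.restrict (Icc (0 : ℝ) 1)

/-- The measure of the periodic strip `Π = 𝕋 × [0,1]`: normalized Lebesgue measure of the circle
times Lebesgue measure of `[0,1]`. -/
abbrev stripMeasure : Measure (Circ × ℝ) :=
  (AddCircle.haarAddCircle : Measure Circ).prod intervalMeasure

/-- `L²[0,1]`, complex valued. -/
abbrev L2Interval : Type := Lp ℂ 2 intervalMeasure

/-- `L²(Π)`, complex valued. -/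
abbrev L2Strip : Type := Lp ℂ 2 stripMeasure

/-- The partial Fourier coefficient `â_k(ψ) = (1/2π) ∫ a(x,ψ) e^{-ikx} dx`. -/
def partialCoeff (a : Circ × ℝ → ℂ) (k : ℤ) (t : ℝ) : ℂ :=
  fourierCoeff (fun x : Circ => a (x, t)) k

/-- `g ∈ L²[0,1]` is the weak derivative of order `p` of `u` on `(0,1)`; `u` is meant to be
integrable on `[0,1]`. -/
def IsWeakDeriv (p : ℕ) (u : ℝ → ℂ) (g : L2Interval) : Prop :=
  ∀ φ : ℝ → ℝ, ContDiff ℝ ∞ φ → HasCompactSupport φ → tsupport φ ⊆ Ioo (0 : ℝ) 1 →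
    ∫ t, iteratedDeriv p φ t • u t ∂intervalMeasure
      = (-1 : ℂ) ^ p * ∫ t, φ t • g t ∂intervalMeasure

open Classical in
/-- The weak derivative of order `p` as an element of `L²[0,1]` (and `0` when there is none). -/
def weakDeriv (p : ℕ) (u : ℝ → ℂ) : L2Interval :=
  if h : ∃ g, IsWeakDeriv p u g then h.choose else 0

/-- The pairs `(p, q)` with `p + q ≤ m`. -/
abbrev OrderIndex (m : ℕ) : Type := {pq : ℕ × ℕ // pq.1 + pq.2 ≤ m}

/-- The family `k^q e^{σ|k|} D^p â_k`, indexed by `k ∈ ℤ` and `p + q ≤ m`. -/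
def weightedDerivs (σ : ℝ) (m : ℕ) (a : Circ × ℝ → ℂ) (i : ℤ × OrderIndex m) : L2Interval :=
  ((i.1 : ℝ) ^ i.2.1.2 * Real.exp (σ * |(i.1 : ℝ)|)) • weakDeriv i.2.1.1 (partialCoeff a i.1)

/-- The target of the norm-defining embedding. -/
abbrev SeqSpace (m : ℕ) : Type := lp (fun _ : ℤ × OrderIndex m => L2Interval) 2

/-- The condition `∑_{p+q≤m} ∑_k k^{2q} e^{2σ|k|} ‖D^p â_k‖² < ∞`, where all the derivatives
`D^p â_k`, `p ≤ m`, exist weakly in `L²[0,1]`. -/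
def MemY (σ : ℝ) (m : ℕ) (a : Circ × ℝ → ℂ) : Prop :=
  (∀ k : ℤ, ∀ p ≤ m, ∃ g, IsWeakDeriv p (partialCoeff a k) g) ∧
    Memℓp (weightedDerivs σ m a) 2

/-! ### Basic facts about coefficients and weak derivatives -/

lemma integrable_strip (a : L2Strip) : Integrable a stripMeasure :=
  (Lp.memLp a).integrable (by norm_num)

lemma integrable_fourier_mul {a : Circ × ℝ → ℂ} (ha : Integrable a stripMeasure) (k : ℤ) :
    Integrable (fun y : Circ × ℝ => fourier (-k) y.1 • a y) stripMeasure := by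
  refine Integrable.bdd_smul (𝕜 := ℂ) (φ := fun y : Circ × ℝ => fourier (-k) y.1) ha 1 ?_ ?_
  · exact ((fourier (-k)).continuous.comp continuous_fst).aestronglyMeasurable
  · filter_upwards with y
    exact (fourier (-k)).norm_coe_le_norm y.1 |>.trans (by rw [fourier_norm])

lemma integrable_partialCoeff {a : Circ × ℝ → ℂ} (ha : Integrable a stripMeasure) (k : ℤ) :
    Integrable (partialCoeff a k) intervalMeasure :=
  (integrable_fourier_mul ha k).integral_prod_right

lemma partialCoeff_congr {a b : Circ × ℝ → ℂ} (h : a =ᵐ[stripMeasure] b) (k : ℤ) :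
    partialCoeff a k =ᵐ[intervalMeasure] partialCoeff b k := by
  have h' : ∀ᵐ y ∂(intervalMeasure.prod (AddCircle.haarAddCircle : Measure Circ)),
      a y.swap = b y.swap :=
    Measure.measurePreserving_swap.quasiMeasurePreserving.ae h
  filter_upwards [Measure.ae_ae_of_ae_prod h'] with t ht
  exact congrFun (fourierCoeff_congr_ae ht) k

lemma partialCoeff_add {a b : Circ × ℝ → ℂ} (ha : Integrable a stripMeasure)
    (hb : Integrable b stripMeasure) (k : ℤ) :
    partialCoeff (a + b) k =ᵐ[intervalMeasure] partialCoeff a k + partialCoeff b k := by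
  filter_upwards [ha.prod_left_ae, hb.prod_left_ae] with t h1 h2
  have := fourierCoeff.add h1 h2
  exact congrFun this k

lemma partialCoeff_smul (c : ℂ) (a : Circ × ℝ → ℂ) (k : ℤ) :
    partialCoeff (c • a) k = c • partialCoeff a k := by
  funext t
  exact fourierCoeff.const_smul (fun x : Circ => a (x, t)) c k

lemma integrable_test_smul {φ : ℝ → ℝ} (h1 : Continuous φ) (h2 : HasCompactSupport φ)
    {u : ℝ → ℂ} (hu : Integrable u intervalMeasure) :
    Integrable (fun t => φ t • u t) intervalMeasure := by
  obtain ⟨C, hC⟩ := h1.bounded_above_of_compact_support h2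
  exact hu.bdd_smul C h1.aestronglyMeasurable (Filter.Eventually.of_forall hC)

lemma integrable_iteratedDeriv_smul {φ : ℝ → ℝ} (h1 : ContDiff ℝ ∞ φ) (h2 : HasCompactSupport φ)
    {u : ℝ → ℂ} (hu : Integrable u intervalMeasure) (p : ℕ) :
    Integrable (fun t => iteratedDeriv p φ t • u t) intervalMeasure := by
  refine integrable_test_smul (h1.continuous_iteratedDeriv p (by exact_mod_cast le_top)) ?_ hu
  rw [iteratedDeriv_eq_equiv_comp]
  exact (h2.iteratedFDeriv p).comp_left (map_zero _)

lemma integrable_L2 (g : L2Interval) : Integrable g intervalMeasure :=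
  (Lp.memLp g).integrable (by norm_num)

lemma IsWeakDeriv.congr {p : ℕ} {u v : ℝ → ℂ} {g : L2Interval} (h : IsWeakDeriv p u g)
    (huv : u =ᵐ[intervalMeasure] v) : IsWeakDeriv p v g := by
  intro φ h1 h2 h3
  rw [← h φ h1 h2 h3]
  refine integral_congr_ae ?_
  filter_upwards [huv] with t ht
  rw [ht]

lemma IsWeakDeriv.add {p : ℕ} {u v : ℝ → ℂ} {g h : L2Interval}
    (hu : Integrable u intervalMeasure) (hv : Integrable v intervalMeasure)
    (hg : IsWeakDeriv p u g) (hh : IsWeakDeriv p v h) : IsWeakDeriv p (u + v) (g + h) := by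
  intro φ h1 h2 h3
  have e1 : ∫ t, φ t • (g + h : L2Interval) t ∂intervalMeasure
      = ∫ t, (φ t • g t + φ t • h t) ∂intervalMeasure := by
    refine integral_congr_ae ?_
    filter_upwards [Lp.coeFn_add g h] with t ht
    rw [ht, Pi.add_apply, smul_add]
  rw [e1, integral_add (integrable_test_smul h1.continuous h2 (integrable_L2 g))
    (integrable_test_smul h1.continuous h2 (integrable_L2 h)), mul_add, ← hg φ h1 h2 h3,
    ← hh φ h1 h2 h3, ← integral_add (integrable_iteratedDeriv_smul h1 h2 hu p)
    (integrable_iteratedDeriv_smul h1 h2 hv p)]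
  simp only [Pi.add_apply, smul_add]

lemma IsWeakDeriv.smul {p : ℕ} {u : ℝ → ℂ} {g : L2Interval} (c : ℂ)
    (hg : IsWeakDeriv p u g) : IsWeakDeriv p (c • u) (c • g) := by
  intro φ h1 h2 h3
  have e1 : ∫ t, φ t • (c • g : L2Interval) t ∂intervalMeasure
      = ∫ t, c • (φ t • g t) ∂intervalMeasure := by
    refine integral_congr_ae ?_
    filter_upwards [Lp.coeFn_smul c g] with t ht
    rw [ht, Pi.smul_apply, smul_comm]
  have e2 : ∫ t, iteratedDeriv p φ t • (c • u) t ∂intervalMeasure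
      = ∫ t, c • (iteratedDeriv p φ t • u t) ∂intervalMeasure := by
    refine integral_congr_ae (Filter.Eventually.of_forall fun t => ?_)
    exact smul_comm (iteratedDeriv p φ t) c (u t)
  rw [e1, e2, integral_smul, integral_smul, hg φ h1 h2 h3, smul_eq_mul, smul_eq_mul]
  ring

lemma IsWeakDeriv.unique {p : ℕ} {u : ℝ → ℂ} {g h : L2Interval}
    (hg : IsWeakDeriv p u g) (hh : IsWeakDeriv p u h) : g = h := by
  have key : ∀ᵐ t ∂intervalMeasure, t ∈ Ioo (0 : ℝ) 1 → (g t - h t) = 0 := by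
    refine isOpen_Ioo.ae_eq_zero_of_integral_contDiff_smul_eq_zero
      (((integrable_L2 g).sub (integrable_L2 h)).integrableOn.locallyIntegrableOn) ?_
    intro φ h1 h2 h3
    have e := (hg φ h1 h2 h3).symm.trans (hh φ h1 h2 h3)
    have e' := mul_left_cancel₀ (pow_ne_zero p (by norm_num : (-1 : ℂ) ≠ 0)) e
    simp only [smul_sub]
    rw [integral_sub (integrable_test_smul h1.continuous h2 (integrable_L2 g))
      (integrable_test_smul h1.continuous h2 (integrable_L2 h)), e', sub_self]
  have hI : ∀ᵐ t ∂intervalMeasure, t ∈ Ioo (0 : ℝ) 1 := by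
    have : intervalMeasure = volume.restrict (Ioo (0 : ℝ) 1) :=
      (Measure.restrict_congr_set Ioo_ae_eq_Icc).symm
    rw [this]
    exact ae_restrict_mem measurableSet_Ioo
  refine Lp.ext ?_
  filter_upwards [key, hI] with t h1 h2
  exact sub_eq_zero.1 (h1 h2)

lemma weakDeriv_spec {p : ℕ} {u : ℝ → ℂ} (h : ∃ g, IsWeakDeriv p u g) :
    IsWeakDeriv p u (weakDeriv p u) := by
  unfold weakDeriv
  rw [dif_pos h]
  exact h.choose_spec

lemma IsWeakDeriv.weakDeriv_eq {p : ℕ} {u : ℝ → ℂ} {g : L2Interval} (h : IsWeakDeriv p u g) :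
    weakDeriv p u = g :=
  (weakDeriv_spec ⟨g, h⟩).unique h

lemma isWeakDeriv_coeff_add {a b : L2Strip} {k : ℤ} {p : ℕ} {g h : L2Interval}
    (hg : IsWeakDeriv p (partialCoeff a k) g) (hh : IsWeakDeriv p (partialCoeff b k) h) :
    IsWeakDeriv p (partialCoeff (a + b : L2Strip) k) (g + h) := by
  have h0 := hg.add (integrable_partialCoeff (integrable_strip a) k)
    (integrable_partialCoeff (integrable_strip b) k) hh
  refine h0.congr ?_
  exact ((partialCoeff_congr (Lp.coeFn_add a b) k).trans
    (partialCoeff_add (integrable_strip a) (integrable_strip b) k)).symm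

lemma isWeakDeriv_coeff_smul (c : ℂ) {a : L2Strip} {k : ℤ} {p : ℕ} {g : L2Interval}
    (hg : IsWeakDeriv p (partialCoeff a k) g) :
    IsWeakDeriv p (partialCoeff (c • a : L2Strip) k) (c • g) := by
  refine (hg.smul c).congr ?_
  rw [← partialCoeff_smul]
  exact (partialCoeff_congr (Lp.coeFn_smul c a) k).symm

lemma weightedDerivs_add {σ : ℝ} {m : ℕ} {a b : L2Strip} (ha : MemY σ m a) (hb : MemY σ m b) :
    weightedDerivs σ m (a + b : L2Strip) = weightedDerivs σ m a + weightedDerivs σ m b := by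
  funext i
  have hp : i.2.1.1 ≤ m := le_trans (Nat.le_add_right _ _) i.2.2
  have h := isWeakDeriv_coeff_add (weakDeriv_spec (ha.1 i.1 _ hp))
    (weakDeriv_spec (hb.1 i.1 _ hp))
  simp only [weightedDerivs, Pi.add_apply]
  rw [h.weakDeriv_eq, smul_add]

lemma weightedDerivs_smul {σ : ℝ} {m : ℕ} (c : ℂ) {a : L2Strip} (ha : MemY σ m a) :
    weightedDerivs σ m (c • a : L2Strip) = c • weightedDerivs σ m a := by
  funext i
  have hp : i.2.1.1 ≤ m := le_trans (Nat.le_add_right _ _) i.2.2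
  have h := isWeakDeriv_coeff_smul c (weakDeriv_spec (ha.1 i.1 _ hp))
  simp only [weightedDerivs, Pi.smul_apply]
  rw [h.weakDeriv_eq, smul_comm]

lemma isWeakDeriv_coeff_zero (k : ℤ) (p : ℕ) :
    IsWeakDeriv p (partialCoeff (0 : L2Strip) k) 0 := by
  have h : IsWeakDeriv p (0 : ℝ → ℂ) 0 := by
    intro φ _ _ _
    have : ∫ t, φ t • (0 : L2Interval) t ∂intervalMeasure = 0 := by
      refine integral_eq_zero_of_ae ?_
      filter_upwards [Lp.coeFn_zero ℂ 2 intervalMeasure] with t ht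
      rw [ht]
      simp
    rw [this]
    simp
  refine h.congr ?_
  refine ((partialCoeff_congr (Lp.coeFn_zero ℂ 2 stripMeasure) k).trans ?_).symm
  refine Filter.Eventually.of_forall fun t => ?_
  simp [partialCoeff, fourierCoeff]

/-! ### The space `Y_σ^m(Π)` -/

/-- `Y_σ^m(Π)` as a linear subspace of `L²(Π)`. -/
def ySubmodule (σ : ℝ) (m : ℕ) : Submodule ℂ L2Strip where
  carrier := {a | MemY σ m a}
  zero_mem' := by
    refine ⟨fun k p _ => ⟨0, isWeakDeriv_coeff_zero k p⟩, ?_⟩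
    have : weightedDerivs σ m (0 : L2Strip) = 0 := by
      funext i
      simp only [weightedDerivs, Pi.zero_apply]
      rw [(isWeakDeriv_coeff_zero i.1 i.2.1.1).weakDeriv_eq, smul_zero]
    rw [this]
    exact zero_memℓp
  add_mem' := by
    intro a b ha hb
    refine ⟨fun k p hp => ?_, ?_⟩
    · obtain ⟨g, hg⟩ := ha.1 k p hp
      obtain ⟨h, hh⟩ := hb.1 k p hp
      exact ⟨g + h, isWeakDeriv_coeff_add hg hh⟩
    · rw [weightedDerivs_add ha hb]
      exact ha.2.add hb.2
  smul_mem' := by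
    intro c a ha
    refine ⟨fun k p hp => ?_, ?_⟩
    · obtain ⟨g, hg⟩ := ha.1 k p hp
      exact ⟨c • g, isWeakDeriv_coeff_smul c hg⟩
    · rw [weightedDerivs_smul c ha]
      exact ha.2.const_smul c

/-- The space `Y_σ^m(Π)`. It does not carry the norm of `L²(Π)` but its own norm,
`‖a‖² = ∑_{p+q≤m} ∑_k k^{2q} e^{2σ|k|} ‖D^p â_k‖²_{L²[0,1]}` (see `Y.norm_sq_eq`). -/
def Y (σ : ℝ) (m : ℕ) : Type := ySubmodule σ m

namespace Y

variable {σ : ℝ} {m : ℕ}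

instance instAddCommGroup : AddCommGroup (Y σ m) :=
  inferInstanceAs (AddCommGroup (ySubmodule σ m))

instance instModule : Module ℂ (Y σ m) :=
  inferInstanceAs (Module ℂ (ySubmodule σ m))

/-- The underlying square integrable function on `Π`. -/
def toL2 : Y σ m →ₗ[ℂ] L2Strip := (ySubmodule σ m).subtype

lemma toL2_injective : Function.Injective (toL2 : Y σ m → L2Strip) :=
  Subtype.val_injective

lemma memY (a : Y σ m) : MemY σ m (toL2 a) := a.2

/-- The linear map `a ↦ (k^q e^{σ|k|} D^p â_k)_{k, p+q≤m}`. -/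
def toSeq : Y σ m →ₗ[ℂ] SeqSpace m where
  toFun a := ⟨weightedDerivs σ m (toL2 a), (memY a).2⟩
  map_add' a b := by
    apply Subtype.ext
    exact weightedDerivs_add (memY a) (memY b)
  map_smul' c a := by
    apply Subtype.ext
    exact weightedDerivs_smul c (memY a)

lemma partialCoeff_eq_zero {a : Y σ m} (h : toSeq a = 0) (k : ℤ) :
    partialCoeff (toL2 a) k =ᵐ[intervalMeasure] 0 := by
  have h1 : weightedDerivs σ m (toL2 a) (k, ⟨(0, 0), Nat.zero_le m⟩) = 0 :=
    congrFun (congrArg Subtype.val h) (k, ⟨(0, 0), Nat.zero_le m⟩)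
  have h2 : weakDeriv 0 (partialCoeff (toL2 a) k) = 0 := by
    have := h1
    simp only [weightedDerivs, pow_zero, one_mul] at this
    exact (smul_eq_zero.1 this).resolve_left (Real.exp_pos _).ne'
  have h3 := weakDeriv_spec ((memY a).1 k 0 (Nat.zero_le m))
  rw [h2] at h3
  have hi := integrable_partialCoeff (integrable_strip (toL2 a)) k
  have key : ∀ᵐ t ∂intervalMeasure, t ∈ Ioo (0 : ℝ) 1 → partialCoeff (toL2 a) k t = 0 := by
    refine isOpen_Ioo.ae_eq_zero_of_integral_contDiff_smul_eq_zero
      hi.integrableOn.locallyIntegrableOn ?_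
    intro φ p1 p2 p3
    have e := h3 φ p1 p2 p3
    rw [iteratedDeriv_zero] at e
    rw [e]
    have : ∫ t, φ t • (0 : L2Interval) t ∂intervalMeasure = 0 := by
      refine integral_eq_zero_of_ae ?_
      filter_upwards [Lp.coeFn_zero ℂ 2 intervalMeasure] with t ht
      rw [ht]
      simp
    rw [this, mul_zero]
  have hI : ∀ᵐ t ∂intervalMeasure, t ∈ Ioo (0 : ℝ) 1 := by
    have : intervalMeasure = volume.restrict (Ioo (0 : ℝ) 1) :=
      (Measure.restrict_congr_set Ioo_ae_eq_Icc).symm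
    rw [this]
    exact ae_restrict_mem measurableSet_Ioo
  filter_upwards [key, hI] with t t1 t2
  exact t1 t2

lemma toSeq_injective : Function.Injective (toSeq : Y σ m → SeqSpace m) := by
  refine (injective_iff_map_eq_zero toSeq).2 fun a h => ?_
  apply toL2_injective
  rw [map_zero]
  set b : L2Strip := toL2 a with hb
  have hsq : Integrable (fun y => ‖b y‖ ^ 2) stripMeasure :=
    (Lp.memLp b).integrable_norm_pow (by norm_num)
  have hc : ∀ᵐ t ∂intervalMeasure, ∀ k : ℤ, partialCoeff b k t = 0 :=
    ae_all_iff.2 fun k => partialCoeff_eq_zero h k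
  have hsec : ∀ᵐ t ∂intervalMeasure,
      ∫ x, ‖b (x, t)‖ ^ 2 ∂(AddCircle.haarAddCircle : Measure Circ) = 0 := by
    filter_upwards [hc, (integrable_strip b).prod_left_ae, hsq.prod_left_ae] with t h1 h2 h3
    have hm : MemLp (fun x : Circ => b (x, t)) 2 AddCircle.haarAddCircle :=
      (memLp_two_iff_integrable_sq_norm h2.aestronglyMeasurable).2 h3
    have hz := tsum_sq_fourierCoeff (hm.toLp _)
    have hk : ∀ k : ℤ, fourierCoeff (hm.toLp _ : Circ → ℂ) k = 0 := by
      intro k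
      rw [fourierCoeff_congr_ae hm.coeFn_toLp]
      exact h1 k
    simp only [hk, norm_zero, ne_eq, OfNat.ofNat_ne_zero, not_false_eq_true, zero_pow,
      tsum_zero] at hz
    rw [hz]
    refine integral_congr_ae ?_
    filter_upwards [hm.coeFn_toLp] with x hx
    rw [hx]
  have hint : ∫ y, ‖b y‖ ^ 2 ∂stripMeasure = 0 := by
    rw [integral_prod_symm _ hsq]
    exact integral_eq_zero_of_ae hsec
  have hae := (integral_eq_zero_iff_of_nonneg (fun y => by positivity) hsq).1 hint
  refine Lp.ext ?_
  filter_upwards [hae, Lp.coeFn_zero ℂ 2 stripMeasure] with y h1 h2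
  rw [h2]
  simpa using h1

instance instNormedAddCommGroup : NormedAddCommGroup (Y σ m) :=
  NormedAddCommGroup.induced (Y σ m) (SeqSpace m) toSeq toSeq_injective

instance instNormedSpace : NormedSpace ℂ (Y σ m) :=
  NormedSpace.induced ℂ (Y σ m) (SeqSpace m) toSeq

/-- The norm of `Y_σ^m(Π)` is the one announced. -/
lemma norm_sq_eq (a : Y σ m) :
    ‖a‖ ^ 2 = ∑' i : ℤ × OrderIndex m,
      (i.1 : ℝ) ^ (2 * i.2.1.2) * Real.exp (2 * σ * |(i.1 : ℝ)|) *
        ‖weakDeriv i.2.1.1 (partialCoeff (toL2 a) i.1)‖ ^ 2 := by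
  have h : ‖a‖ = ‖toSeq a‖ := rfl
  have h2 := lp.norm_rpow_eq_tsum (p := 2) (by norm_num) (toSeq a)
  simp only [ENNReal.toReal_ofNat, Real.rpow_ofNat] at h2
  rw [h, h2]
  refine tsum_congr fun i => ?_
  have e : (toSeq a : ∀ _ : ℤ × OrderIndex m, L2Interval) i
      = weightedDerivs σ m (toL2 a) i := rfl
  rw [e, weightedDerivs, norm_smul, mul_pow, Real.norm_eq_abs, sq_abs, mul_pow, ← pow_mul,
    ← Real.exp_nat_mul, mul_comm i.2.1.2 2]
  push_cast
  rw [mul_assoc 2 σ]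

end Y

/-! ### Continuation to the complex strip and superposition -/

/-- The open strip `|Im z| < σ`. -/
def openStrip (σ : ℝ) : Set ℂ := {z | |z.im| < σ}

/-- The closed strip `|Im z| ≤ σ`. -/
def closedStrip (σ : ℝ) : Set ℂ := {z | |z.im| ≤ σ}

/-- `A(z,ψ)` is the continuation of `a ∈ L²(Π)` to the complex strip: it is `2π`-periodic in `z`,
continuous on the closed strip times `[0,1]`, holomorphic in `z` in the open strip, and it
coincides with `a` almost everywhere for real `z`. There is at most one such function on the
closed strip times `[0,1]`. -/
structure IsContinuation (σ : ℝ) (a : L2Strip) (A : ℂ → ℝ → ℂ) : Prop where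
  periodic : ∀ z ∈ closedStrip σ, ∀ t ∈ Icc (0 : ℝ) 1, A (z + 2 * Real.pi) t = A z t
  continuousOn : ContinuousOn (fun w : ℂ × ℝ => A w.1 w.2) (closedStrip σ ×ˢ Icc (0 : ℝ) 1)
  holomorphic : ∀ t ∈ Icc (0 : ℝ) 1, DifferentiableOn ℂ (fun z => A z t) (openStrip σ)
  ae_eq : ∀ᵐ y ∂((volume : Measure ℝ).prod intervalMeasure),
    a ((y.1 : Circ), y.2) = A (y.1 : ℂ) y.2

/-- The set of all `a ∈ Y_σ^m(Π)` whose image `{a(z,ψ) : |Im z| ≤ σ, ψ ∈ [0,1]}` is contained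
in `U`. -/
def imageIn (σ : ℝ) (m : ℕ) (U : Set ℂ) : Set (Y σ m) :=
  {a | ∃ A : ℂ → ℝ → ℂ, IsContinuation σ (Y.toL2 a) A ∧
    ∀ z ∈ closedStrip σ, ∀ t ∈ Icc (0 : ℝ) 1, A z t ∈ U}

end PartialAnalytic

end

open MeasureTheory Set
open scoped ENNReal ContDiff

noncomputable section

namespace PartialAnalytic

/-! ### Completeness of `Y_σ^m(Π)` -/

lemma continuous_integral_mul_L2 {α : Type*} [MeasurableSpace α] {μ : Measure α} {h : α → ℂ}
    (hh : MemLp h 2 μ) : Continuous (fun g : Lp ℂ 2 μ => ∫ y, h y * g y ∂μ) := by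
  have hs : MemLp (fun y => (starRingEnd ℂ) (h y)) 2 μ := hh.star
  have e : (fun g : Lp ℂ 2 μ => ∫ y, h y * g y ∂μ)
      = fun g : Lp ℂ 2 μ => inner ℂ (hs.toLp _) g := by
    funext g
    rw [L2.inner_def]
    refine integral_congr_ae ?_
    filter_upwards [hs.coeFn_toLp] with y hy
    rw [hy, RCLike.inner_apply, Complex.conj_conj, mul_comm]
  rw [e]
  exact continuous_const.inner continuous_id

lemma memLp_of_continuous_hasCompactSupport {ψ : ℝ → ℝ} (h1 : Continuous ψ)
    (h2 : HasCompactSupport ψ) :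
    MemLp (fun t => (ψ t : ℂ)) 2 intervalMeasure := by
  obtain ⟨C, hC⟩ := h1.bounded_above_of_compact_support h2
  refine MemLp.of_bound (Complex.continuous_ofReal.comp h1).aestronglyMeasurable C
    (Filter.Eventually.of_forall fun t => ?_)
  simpa using hC t

lemma integral_smul_partialCoeff {ψ : ℝ → ℝ} (h1 : Continuous ψ) (h2 : HasCompactSupport ψ)
    (a : L2Strip) (k : ℤ) :
    ∫ t, ψ t • partialCoeff a k t ∂intervalMeasure
      = ∫ y, ((ψ y.2 : ℂ) * fourier (-k) y.1) * a y ∂stripMeasure := by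
  obtain ⟨C, hC⟩ := h1.bounded_above_of_compact_support h2
  have hi : Integrable (fun y : Circ × ℝ => ((ψ y.2 : ℂ) * fourier (-k) y.1) * a y)
      stripMeasure := by
    refine Integrable.bdd_mul (c := C) (integrable_strip a) ?_ ?_
    · exact ((Complex.continuous_ofReal.comp (h1.comp continuous_snd)).mul
        ((fourier (-k)).continuous.comp continuous_fst)).aestronglyMeasurable
    · refine Filter.Eventually.of_forall fun y => ?_
      have := hC y.2
      rw [norm_mul, show ‖(fourier (-k) y.1 : ℂ)‖ = 1 from Circle.norm_coe _, mul_one]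
      simpa using this
  rw [integral_prod_symm _ hi]
  refine integral_congr_ae (Filter.Eventually.of_forall fun t => ?_)
  simp only [partialCoeff, fourierCoeff, mul_assoc, integral_const_mul, Complex.real_smul,
    smul_eq_mul]

lemma continuous_integral_smul_partialCoeff {ψ : ℝ → ℝ} (h1 : Continuous ψ)
    (h2 : HasCompactSupport ψ) (k : ℤ) :
    Continuous (fun a : L2Strip => ∫ t, ψ t • partialCoeff a k t ∂intervalMeasure) := by
  obtain ⟨C, hC⟩ := h1.bounded_above_of_compact_support h2
  simp only [integral_smul_partialCoeff h1 h2]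
  refine continuous_integral_mul_L2 (MemLp.of_bound (C := C) ?_ ?_)
  · exact ((Complex.continuous_ofReal.comp (h1.comp continuous_snd)).mul
        ((fourier (-k)).continuous.comp continuous_fst)).aestronglyMeasurable
  · refine Filter.Eventually.of_forall fun y => ?_
    have := hC y.2
    rw [norm_mul, show ‖(fourier (-k) y.1 : ℂ)‖ = 1 from Circle.norm_coe _, mul_one]
    simpa using this

lemma hasCompactSupport_iteratedDeriv {φ : ℝ → ℝ} (h2 : HasCompactSupport φ) (p : ℕ) :
    HasCompactSupport (iteratedDeriv p φ) := by
  rw [iteratedDeriv_eq_equiv_comp]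
  exact (h2.iteratedFDeriv p).comp_left (map_zero _)

/-- The graph of the weak derivative of partial Fourier coefficients is closed. -/
lemma IsWeakDeriv.of_tendsto {p : ℕ} {k : ℤ} {a : ℕ → L2Strip} {g : ℕ → L2Interval}
    {a' : L2Strip} {g' : L2Interval} (h : ∀ n, IsWeakDeriv p (partialCoeff (a n) k) (g n))
    (ha : Filter.Tendsto a Filter.atTop (nhds a')) (hg : Filter.Tendsto g Filter.atTop (nhds g')) :
    IsWeakDeriv p (partialCoeff a' k) g' := by
  intro φ h1 h2 h3
  have c1 := (continuous_integral_smul_partialCoeff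
    (h1.continuous_iteratedDeriv p (by exact_mod_cast le_top))
    (hasCompactSupport_iteratedDeriv h2 p) k).continuousAt.tendsto.comp ha
  have c2 := ((continuous_integral_mul_L2 (memLp_of_continuous_hasCompactSupport h1.continuous
    h2)).continuousAt.tendsto.comp hg).const_mul ((-1 : ℂ) ^ p)
  have c3 := tendsto_nhds_unique c1 (c2.congr fun n => by
    simp only [Function.comp_apply]
    rw [h n φ h1 h2 h3]
    simp only [Complex.real_smul])
  rw [c3]
  simp only [Complex.real_smul]

lemma ae_eq_of_integral_test_eq {u v : ℝ → ℂ} (hu : Integrable u intervalMeasure)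
    (hv : Integrable v intervalMeasure)
    (h : ∀ φ : ℝ → ℝ, ContDiff ℝ ∞ φ → HasCompactSupport φ → tsupport φ ⊆ Ioo (0 : ℝ) 1 →
      ∫ t, φ t • u t ∂intervalMeasure = ∫ t, φ t • v t ∂intervalMeasure) :
    u =ᵐ[intervalMeasure] v := by
  have key : ∀ᵐ t ∂intervalMeasure, t ∈ Ioo (0 : ℝ) 1 → u t - v t = 0 := by
    refine isOpen_Ioo.ae_eq_zero_of_integral_contDiff_smul_eq_zero
      (hu.sub hv).integrableOn.locallyIntegrableOn ?_
    intro φ h1 h2 h3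
    simp only [smul_sub]
    rw [integral_sub (integrable_test_smul h1.continuous h2 hu)
      (integrable_test_smul h1.continuous h2 hv), h φ h1 h2 h3, sub_self]
  have hI : ∀ᵐ t ∂intervalMeasure, t ∈ Ioo (0 : ℝ) 1 := by
    have : intervalMeasure = volume.restrict (Ioo (0 : ℝ) 1) :=
      (Measure.restrict_congr_set Ioo_ae_eq_Icc).symm
    rw [this]
    exact ae_restrict_mem measurableSet_Ioo
  filter_upwards [key, hI] with t h1 h2
  exact sub_eq_zero.1 (h1 h2)

lemma IsWeakDeriv.ae_eq_zero_order {u : ℝ → ℂ} {g : L2Interval}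
    (hu : Integrable u intervalMeasure) (h : IsWeakDeriv 0 u g) : u =ᵐ[intervalMeasure] g := by
  refine ae_eq_of_integral_test_eq hu (integrable_L2 g) fun φ h1 h2 h3 => ?_
  simpa using h φ h1 h2 h3

lemma L2_norm_sq_eq {α : Type*} [MeasurableSpace α] {μ : Measure α} (g : Lp ℂ 2 μ) :
    ‖g‖ ^ 2 = ∫ y, ‖g y‖ ^ 2 ∂μ := by
  have h := L2.inner_def (𝕜 := ℂ) g g
  have h2 : ((‖g‖ ^ 2 : ℝ) : ℂ) = ((∫ y, ‖g y‖ ^ 2 ∂μ : ℝ) : ℂ) := by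
    rw [← integral_complex_ofReal]
    have e := inner_self_eq_norm_sq_to_K (𝕜 := ℂ) g
    push_cast
    rw [show ((‖g‖ : ℂ)) ^ 2 = inner ℂ g g from e.symm, h]
    refine integral_congr_ae (Filter.Eventually.of_forall fun y => ?_)
    simp
  exact_mod_cast h2

/-- Parseval's identity in the first variable. -/
lemma norm_sq_eq_tsum_integral_partialCoeff (b : L2Strip)
    (hs : Summable fun k : ℤ => ∫ t, ‖partialCoeff b k t‖ ^ 2 ∂intervalMeasure)
    (hi : ∀ k, Integrable (fun t => ‖partialCoeff b k t‖ ^ 2) intervalMeasure) :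
    ‖b‖ ^ 2 = ∑' k : ℤ, ∫ t, ‖partialCoeff b k t‖ ^ 2 ∂intervalMeasure := by
  have hsq : Integrable (fun y => ‖b y‖ ^ 2) stripMeasure :=
    (Lp.memLp b).integrable_norm_pow (by norm_num)
  have hsec : ∀ᵐ t ∂intervalMeasure,
      ∫ x, ‖b (x, t)‖ ^ 2 ∂(AddCircle.haarAddCircle : Measure Circ)
        = ∑' k : ℤ, ‖partialCoeff b k t‖ ^ 2 := by
    filter_upwards [(integrable_strip b).prod_left_ae, hsq.prod_left_ae] with t h2 h3
    have hm : MemLp (fun x : Circ => b (x, t)) 2 AddCircle.haarAddCircle :=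
      (memLp_two_iff_integrable_sq_norm h2.aestronglyMeasurable).2 h3
    have hz := tsum_sq_fourierCoeff (hm.toLp _)
    rw [fourierCoeff_congr_ae hm.coeFn_toLp] at hz
    simp only [partialCoeff]
    rw [hz]
    refine integral_congr_ae ?_
    filter_upwards [hm.coeFn_toLp] with x hx
    rw [hx]
  rw [L2_norm_sq_eq, integral_prod_symm _ hsq, integral_congr_ae hsec]
  refine (hasSum_integral_of_summable_integral_norm hi ?_).tsum_eq.symm
  simpa only [norm_pow, norm_norm] using hs

namespace Y

variable {σ : ℝ} {m : ℕ}

lemma norm_toSeq (a : Y σ m) : ‖toSeq a‖ = ‖a‖ := rfl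

lemma toSeq_apply (a : Y σ m) (i : ℤ × OrderIndex m) :
    (toSeq a : ∀ _ : ℤ × OrderIndex m, L2Interval) i = weightedDerivs σ m (toL2 a) i := rfl

lemma hasSum_norm_sq (a : Y σ m) :
    HasSum (fun i : ℤ × OrderIndex m => ‖weightedDerivs σ m (toL2 a) i‖ ^ 2) (‖a‖ ^ 2) := by
  have h := lp.hasSum_norm (p := 2) (by norm_num) (toSeq a)
  simpa [toSeq_apply, norm_toSeq] using h

lemma norm_toL2_le (hσ : 0 ≤ σ) (a : Y σ m) : ‖toL2 a‖ ≤ ‖a‖ := by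
  have hA := hasSum_norm_sq a
  let e : ℤ → ℤ × OrderIndex m := fun k => (k, ⟨(0, 0), Nat.zero_le m⟩)
  have he : Function.Injective e := fun k l h => congrArg Prod.fst h
  have hc : ∀ k, partialCoeff (toL2 a) k =ᵐ[intervalMeasure]
      weakDeriv 0 (partialCoeff (toL2 a) k) := fun k =>
    (weakDeriv_spec ((memY a).1 k 0 (Nat.zero_le m))).ae_eq_zero_order
      (integrable_partialCoeff (integrable_strip _) k)
  have hi : ∀ k, Integrable (fun t => ‖partialCoeff (toL2 a) k t‖ ^ 2) intervalMeasure := by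
    intro k
    refine ((Lp.memLp (weakDeriv 0 (partialCoeff (toL2 a) k))).integrable_norm_pow
      (by norm_num)).congr ?_
    filter_upwards [hc k] with t ht
    rw [ht]
  have hv : ∀ k, ∫ t, ‖partialCoeff (toL2 a) k t‖ ^ 2 ∂intervalMeasure
      = ‖weakDeriv 0 (partialCoeff (toL2 a) k)‖ ^ 2 := by
    intro k
    rw [L2_norm_sq_eq]
    refine integral_congr_ae ?_
    filter_upwards [hc k] with t ht
    rw [ht]
  have hle : ∀ k, ∫ t, ‖partialCoeff (toL2 a) k t‖ ^ 2 ∂intervalMeasure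
      ≤ ‖weightedDerivs σ m (toL2 a) (e k)‖ ^ 2 := by
    intro k
    rw [hv k]
    simp only [weightedDerivs, e, pow_zero, one_mul, norm_smul, mul_pow]
    refine le_mul_of_one_le_left (by positivity) (one_le_pow₀ ?_)
    rw [Real.norm_eq_abs, abs_of_pos (Real.exp_pos _)]
    exact Real.one_le_exp (by positivity)
  have hs : Summable fun k : ℤ => ∫ t, ‖partialCoeff (toL2 a) k t‖ ^ 2 ∂intervalMeasure :=
    Summable.of_nonneg_of_le (fun k => by positivity) hle (hA.summable.comp_injective he)
  have h1 := norm_sq_eq_tsum_integral_partialCoeff (toL2 a) hs hi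
  have h2 : ‖toL2 a‖ ^ 2 ≤ ‖a‖ ^ 2 := by
    rw [h1, ← hA.tsum_eq]
    exact hs.tsum_le_tsum_of_inj e he (fun _ _ => by positivity) hle hA.summable
  exact le_of_sq_le_sq h2 (norm_nonneg _)

/-- A criterion for membership in `Y` with prescribed weighted derivatives. -/
lemma exists_toSeq_eq (b : L2Strip) (s : SeqSpace m) (g : ℤ → ℕ → L2Interval)
    (hg : ∀ k, ∀ p ≤ m, IsWeakDeriv p (partialCoeff b k) (g k p))
    (hs : ∀ i : ℤ × OrderIndex m, (s : ∀ _ : ℤ × OrderIndex m, L2Interval) i =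
      ((i.1 : ℝ) ^ i.2.1.2 * Real.exp (σ * |(i.1 : ℝ)|)) • g i.1 i.2.1.1) :
    ∃ a : Y σ m, toL2 a = b ∧ toSeq a = s := by
  have e : weightedDerivs σ m b = (s : ∀ _ : ℤ × OrderIndex m, L2Interval) := by
    funext i
    rw [hs i, weightedDerivs,
      (hg i.1 i.2.1.1 (le_trans (Nat.le_add_right _ _) i.2.2)).weakDeriv_eq]
  have hb : MemY σ m b := ⟨fun k p hp => ⟨g k p, hg k p hp⟩, by rw [e]; exact lp.memℓp s⟩
  exact ⟨⟨b, hb⟩, rfl, Subtype.ext e⟩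

lemma tendsto_of_toSeq {a : ℕ → Y σ m} {a' : Y σ m}
    (h : Filter.Tendsto (fun n => toSeq (a n)) Filter.atTop (nhds (toSeq a'))) :
    Filter.Tendsto a Filter.atTop (nhds a') := by
  rw [tendsto_iff_norm_sub_tendsto_zero] at h ⊢
  refine h.congr fun n => ?_
  rw [← map_sub, norm_toSeq]

lemma completeSpace (hσ : 0 ≤ σ) : CompleteSpace (Y σ m) := by
  refine Metric.complete_of_cauchySeq_tendsto fun a ha => ?_
  have h1 : CauchySeq (fun n => toSeq (a n)) := by
    rw [Metric.cauchySeq_iff] at ha ⊢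
    intro ε hε
    obtain ⟨N, hN⟩ := ha ε hε
    refine ⟨N, fun i hi j hj => ?_⟩
    rw [dist_eq_norm, ← map_sub, norm_toSeq, ← dist_eq_norm]
    exact hN i hi j hj
  have h2 : CauchySeq (fun n => toL2 (a n)) := by
    rw [Metric.cauchySeq_iff] at ha ⊢
    intro ε hε
    obtain ⟨N, hN⟩ := ha ε hε
    refine ⟨N, fun i hi j hj => ?_⟩
    rw [dist_eq_norm, ← map_sub]
    refine (norm_toL2_le hσ _).trans_lt ?_
    rw [← dist_eq_norm]
    exact hN i hi j hj
  obtain ⟨s, hs⟩ := cauchySeq_tendsto_of_complete h1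
  obtain ⟨b, hb⟩ := cauchySeq_tendsto_of_complete h2
  have hpt : ∀ i, Filter.Tendsto (fun n => weightedDerivs σ m (toL2 (a n)) i) Filter.atTop
      (nhds ((s : ∀ _ : ℤ × OrderIndex m, L2Interval) i)) := by
    intro i
    rw [tendsto_iff_norm_sub_tendsto_zero] at hs ⊢
    refine squeeze_zero (fun _ => norm_nonneg _) (fun n => ?_) hs
    exact lp.norm_apply_le_norm (p := 2) (by norm_num) (toSeq (a n) - s) i
  let g : ℤ → ℕ → L2Interval := fun k p => if hp : p ≤ m then
    (Real.exp (σ * |(k : ℝ)|))⁻¹ • (s : ∀ _ : ℤ × OrderIndex m, L2Interval) (k, ⟨(p, 0), hp⟩)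
    else 0
  have hlim : ∀ k, ∀ p ≤ m, Filter.Tendsto (fun n => weakDeriv p (partialCoeff (toL2 (a n)) k))
      Filter.atTop (nhds (g k p)) := by
    intro k p hp
    have := (hpt (k, ⟨(p, 0), hp⟩)).const_smul (Real.exp (σ * |(k : ℝ)|))⁻¹
    simp only [weightedDerivs, pow_zero, one_mul, g, dif_pos hp] at this ⊢
    refine this.congr fun n => ?_
    rw [inv_smul_smul₀ (Real.exp_pos _).ne']
  obtain ⟨c, -, hc⟩ := exists_toSeq_eq (σ := σ) b s g (fun k p hp => IsWeakDeriv.of_tendsto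
    (fun n => weakDeriv_spec ((memY (a n)).1 k p hp)) hb (hlim k p hp)) (fun i => by
      have hp : i.2.1.1 ≤ m := le_trans (Nat.le_add_right _ _) i.2.2
      exact tendsto_nhds_unique (hpt i) ((hlim i.1 i.2.1.1 hp).const_smul _))
  refine ⟨c, tendsto_of_toSeq ?_⟩
  rw [hc]
  exact hs

end Y

/-! ### Smooth functions as elements of `Y_σ^m(Π)` -/

lemma integral_intervalMeasure (f : ℝ → ℂ) :
    ∫ t, f t ∂intervalMeasure = ∫ t in (0 : ℝ)..1, f t := by
  rw [intervalIntegral.integral_of_le zero_le_one, integral_Icc_eq_integral_Ioc]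

lemma integral_deriv_smul {φ : ℝ → ℝ} (h1 : ContDiff ℝ ∞ φ)
    (h3 : tsupport φ ⊆ Ioo (0 : ℝ) 1) {v v' : ℝ → ℂ} (hv : ContinuousOn v (Icc 0 1))
    (hv' : ContinuousOn v' (Icc 0 1)) (hd : ∀ t ∈ Ioo (0 : ℝ) 1, HasDerivAt v (v' t) t) :
    ∫ t, deriv φ t • v t ∂intervalMeasure = - ∫ t, φ t • v' t ∂intervalMeasure := by
  have h01 : uIcc (0 : ℝ) 1 = Icc 0 1 := uIcc_of_le zero_le_one
  have hφ : ∀ t, t ∉ Ioo (0 : ℝ) 1 → φ t = 0 := fun t ht =>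
    image_eq_zero_of_notMem_tsupport fun h => ht (h3 h)
  have key := intervalIntegral.integral_mul_deriv_eq_deriv_mul_of_hasDerivAt (a := 0) (b := 1)
    (u := fun t => (φ t : ℂ)) (u' := fun t => ((deriv φ t : ℝ) : ℂ)) (v := v) (v' := v')
    (Complex.continuous_ofReal.comp h1.continuous).continuousOn (by rwa [h01])
    (fun x _ => ((h1.differentiable (by simp)) x).hasDerivAt.ofReal_comp)
    (by simpa using hd)
    ((Complex.continuous_ofReal.comp (h1.continuous_deriv (by simp))).intervalIntegrable 0 1)
    (ContinuousOn.intervalIntegrable (by rwa [h01]))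
  simp only [integral_intervalMeasure, Complex.real_smul]
  rw [key, hφ 0 (by simp), hφ 1 (by simp)]
  simp

lemma integral_iteratedDeriv_smul {v : ℕ → ℝ → ℂ} {p : ℕ}
    (hv : ∀ i ≤ p, ContinuousOn (v i) (Icc 0 1))
    (hd : ∀ i < p, ∀ t ∈ Ioo (0 : ℝ) 1, HasDerivAt (v i) (v (i + 1) t) t)
    {φ : ℝ → ℝ} (h1 : ContDiff ℝ ∞ φ) (h3 : tsupport φ ⊆ Ioo (0 : ℝ) 1) :
    ∫ t, iteratedDeriv p φ t • v 0 t ∂intervalMeasure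
      = (-1 : ℂ) ^ p * ∫ t, φ t • v p t ∂intervalMeasure := by
  induction p generalizing φ with
  | zero => simp
  | succ p ih =>
    rw [iteratedDeriv_succ', ih (fun i hi => hv i (by omega)) (fun i hi => hd i (by omega))
      (h1.deriv' (n := ∞)) (tsupport_deriv_subset.trans h3),
      integral_deriv_smul h1 h3 (hv p (by omega)) (hv (p + 1) le_rfl) (hd p (by omega)), pow_succ]
    ring

lemma memLp_of_continuousOn {v : ℝ → ℂ} (hv : ContinuousOn v (Icc 0 1)) :
    MemLp v 2 intervalMeasure := by
  obtain ⟨C, hC⟩ := isCompact_Icc.exists_bound_of_continuousOn hv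
  refine MemLp.of_bound (hv.aestronglyMeasurable measurableSet_Icc) C ?_
  filter_upwards [ae_restrict_mem measurableSet_Icc] with t ht
  exact hC t ht

lemma isWeakDeriv_of_hasDerivAt {v : ℕ → ℝ → ℂ} {p : ℕ}
    (hv : ∀ i ≤ p, ContinuousOn (v i) (Icc 0 1))
    (hd : ∀ i < p, ∀ t ∈ Ioo (0 : ℝ) 1, HasDerivAt (v i) (v (i + 1) t) t)
    {g : L2Interval} (hg : g =ᵐ[intervalMeasure] v p) : IsWeakDeriv p (v 0) g := by
  intro φ h1 h2 h3
  rw [integral_iteratedDeriv_smul hv hd h1 h3]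
  congr 1
  refine integral_congr_ae ?_
  filter_upwards [hg] with t ht
  rw [ht]

lemma quasiMeasurePreserving_coe :
    Measure.QuasiMeasurePreserving ((↑) : ℝ → Circ) volume
      (AddCircle.haarAddCircle : Measure Circ) := by
  refine ⟨AddCircle.measurable_mk', Measure.AbsolutelyContinuous.mk fun s hs h0 => ?_⟩
  rw [Measure.map_apply AddCircle.measurable_mk' hs]
  have hv : (volume : Measure Circ) s = 0 := by
    rw [AddCircle.volume_eq_smul_haarAddCircle, Measure.smul_apply, h0, smul_zero]
  have hu : ((↑) : ℝ → Circ) ⁻¹' s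
      ⊆ ⋃ n : ℤ, ((↑) : ℝ → Circ) ⁻¹' s ∩ Ioc (n • (2 * Real.pi)) (n • (2 * Real.pi)
        + 2 * Real.pi) := by
    intro x hx
    have := iUnion_Ioc_zsmul Real.two_pi_pos
    have hx' : x ∈ ⋃ n : ℤ, Ioc (n • (2 * Real.pi)) ((n + 1) • (2 * Real.pi)) := by
      rw [this]; trivial
    obtain ⟨n, hn⟩ := mem_iUnion.1 hx'
    refine mem_iUnion.2 ⟨n, hx, ?_⟩
    rwa [add_smul, one_smul] at hn
  refine measure_mono_null hu (measure_iUnion_null fun n => ?_)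
  have h := (AddCircle.measurePreserving_mk (2 * Real.pi) (n • (2 * Real.pi))).measure_preimage
    hs.nullMeasurableSet
  rw [hv, Measure.restrict_apply (AddCircle.measurable_mk' hs)] at h
  exact h

lemma ae_comp_coe {a b : Circ × ℝ → ℂ} (h : a =ᵐ[stripMeasure] b) :
    ∀ᵐ y ∂((volume : Measure ℝ).prod intervalMeasure),
      a ((y.1 : Circ), y.2) = b ((y.1 : Circ), y.2) :=
  (MeasureTheory.QuasiMeasurePreserving.prodMap quasiMeasurePreserving_coe
    (Measure.QuasiMeasurePreserving.id intervalMeasure)).ae h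

lemma L2Strip_ext_of_coe {a b : L2Strip}
    (h : ∀ᵐ y ∂((volume : Measure ℝ).prod intervalMeasure),
      a ((y.1 : Circ), y.2) = b ((y.1 : Circ), y.2)) : a = b := by
  have h1 : ∀ᵐ y ∂(((volume : Measure ℝ).restrict (Ioc 0 (0 + 2 * Real.pi))).prod
      intervalMeasure), a ((y.1 : Circ), y.2) = b ((y.1 : Circ), y.2) :=
    (Measure.restrict_le_self.absolutelyContinuous.prod Measure.AbsolutelyContinuous.rfl).ae_le h
  have hmp : MeasurePreserving (Prod.map ((↑) : ℝ → Circ) (id : ℝ → ℝ))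
      (((volume : Measure ℝ).restrict (Ioc 0 (0 + 2 * Real.pi))).prod intervalMeasure)
      ((volume : Measure Circ).prod intervalMeasure) :=
    (AddCircle.measurePreserving_mk (2 * Real.pi) 0).prod (MeasurePreserving.id _)
  have h2 : ∀ᵐ y ∂((volume : Measure Circ).prod intervalMeasure), a y = b y := by
    rw [← hmp.map_eq, ae_map_iff hmp.measurable.aemeasurable
      (measurableSet_eq_fun (Lp.stronglyMeasurable a).measurable
        (Lp.stronglyMeasurable b).measurable)]
    exact h1
  refine Lp.ext ?_
  have hac : (AddCircle.haarAddCircle : Measure Circ) ≪ (volume : Measure Circ) := by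
    rw [AddCircle.volume_eq_smul_haarAddCircle]
    refine Measure.absolutelyContinuous_smul ?_
    simpa using Real.pi_pos
  exact (hac.prod Measure.AbsolutelyContinuous.rfl).ae_le h2

lemma memLp_strip_of_continuous {g : Circ × ℝ → ℂ} (hg : Continuous g) :
    MemLp g 2 stripMeasure := by
  obtain ⟨C, hC⟩ := ((isCompact_univ (X := Circ)).prod
    (isCompact_Icc (a := (0 : ℝ)) (b := 1))).exists_bound_of_continuousOn hg.continuousOn
  refine MemLp.of_bound hg.aestronglyMeasurable C ?_
  have h : ∀ᵐ y ∂stripMeasure, y.2 ∈ Icc (0 : ℝ) 1 :=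
    Measure.quasiMeasurePreserving_snd.ae (ae_restrict_mem measurableSet_Icc)
  filter_upwards [h] with y hy
  exact hC y ⟨trivial, hy⟩

/-- `A` is periodic, continuous on the closed strip and holomorphic in the open strip. -/
structure IsStripFunction (σ : ℝ) (A : ℂ → ℝ → ℂ) : Prop where
  periodic : ∀ z ∈ closedStrip σ, ∀ t ∈ Icc (0 : ℝ) 1, A (z + 2 * Real.pi) t = A z t
  continuousOn : ContinuousOn (fun w : ℂ × ℝ => A w.1 w.2) (closedStrip σ ×ˢ Icc (0 : ℝ) 1)
  holomorphic : ∀ t ∈ Icc (0 : ℝ) 1, DifferentiableOn ℂ (fun z => A z t) (openStrip σ)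

lemma IsContinuation.isStripFunction {σ : ℝ} {a : L2Strip} {A : ℂ → ℝ → ℂ}
    (h : IsContinuation σ a A) : IsStripFunction σ A :=
  ⟨h.periodic, h.continuousOn, h.holomorphic⟩

lemma ofReal_mem_closedStrip {σ : ℝ} (hσ : 0 ≤ σ) (x : ℝ) : (x : ℂ) ∈ closedStrip σ := by
  simpa [closedStrip] using hσ

lemma openStrip_subset_closedStrip (σ : ℝ) : openStrip σ ⊆ closedStrip σ :=
  fun _ hz => le_of_lt (show |_| < σ from hz)

lemma add_two_pi_mem_closedStrip {σ : ℝ} {z : ℂ} (hz : z ∈ closedStrip σ) :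
    z + 2 * Real.pi ∈ closedStrip σ := by
  simpa [closedStrip] using hz

lemma ae_snd_mem_Icc : ∀ᵐ y ∂((volume : Measure ℝ).prod intervalMeasure), y.2 ∈ Icc (0 : ℝ) 1 :=
  Measure.quasiMeasurePreserving_snd.ae (ae_restrict_mem measurableSet_Icc)

lemma IsContinuation.congr {σ : ℝ} (hσ : 0 ≤ σ) {a : L2Strip} {A B : ℂ → ℝ → ℂ}
    (h : IsContinuation σ a A)
    (hAB : ∀ z ∈ closedStrip σ, ∀ t ∈ Icc (0 : ℝ) 1, B z t = A z t) : IsContinuation σ a B where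
  periodic z hz t ht := by
    rw [hAB z hz t ht, hAB _ (add_two_pi_mem_closedStrip hz) t ht, h.periodic z hz t ht]
  continuousOn := h.continuousOn.congr fun w hw => hAB w.1 hw.1 w.2 hw.2
  holomorphic t ht := (h.holomorphic t ht).congr fun z hz =>
    hAB z (openStrip_subset_closedStrip σ hz) t ht
  ae_eq := by
    filter_upwards [h.ae_eq, ae_snd_mem_Icc] with y h1 h2
    rw [h1, hAB _ (ofReal_mem_closedStrip hσ _) _ h2]

lemma closedStrip_subset_closure {σ : ℝ} (hσ : 0 < σ) :
    closedStrip σ ⊆ closure (openStrip σ) := by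
  have h1 : openStrip σ = Complex.im ⁻¹' Ioo (-σ) σ := by
    ext z
    simp [openStrip, abs_lt]
  have h2 : closedStrip σ = Complex.im ⁻¹' Icc (-σ) σ := by
    ext z
    simp [closedStrip, abs_le]
  rw [h1, h2, Complex.closure_preimage_im, closure_Ioo (by linarith)]

lemma isOpen_openStrip (σ : ℝ) : IsOpen (openStrip σ) :=
  isOpen_lt (continuous_abs.comp Complex.continuous_im) continuous_const

lemma convex_openStrip (σ : ℝ) : Convex ℝ (openStrip σ) := by
  have h1 : openStrip σ = Complex.imLm ⁻¹' Ioo (-σ) σ := by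
    ext z
    simp [openStrip, abs_lt]
  rw [h1]
  exact (convex_Ioo _ _).linear_preimage _

/-- Two functions on the strip that agree a.e. on the real locus agree. -/
lemma IsStripFunction.eq_of_ae {σ : ℝ} (hσ : 0 < σ) {A B : ℂ → ℝ → ℂ} (hA : IsStripFunction σ A)
    (hB : IsStripFunction σ B)
    (h : ∀ᵐ y ∂((volume : Measure ℝ).prod intervalMeasure), A (y.1 : ℂ) y.2 = B (y.1 : ℂ) y.2)
    {z : ℂ} (hz : z ∈ closedStrip σ) {t : ℝ} (ht : t ∈ Icc (0 : ℝ) 1) : A z t = B z t := by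
  have hsec : ∀ {A : ℂ → ℝ → ℂ}, IsStripFunction σ A → ∀ z ∈ closedStrip σ,
      ContinuousOn (fun t => A z t) (Icc 0 1) := fun hA z hz =>
    hA.continuousOn.comp (f := fun t : ℝ => (z, t)) (by fun_prop) fun t ht => ⟨hz, ht⟩
  have hsec' : ∀ {A : ℂ → ℝ → ℂ}, IsStripFunction σ A →
      ContinuousOn (fun z => A z t) (closedStrip σ) := fun hA =>
    hA.continuousOn.comp (f := fun z : ℂ => (z, t)) (by fun_prop) fun z hz => ⟨hz, ht⟩
  have h1 : ∀ᵐ x : ℝ, A (x : ℂ) t = B (x : ℂ) t := by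
    filter_upwards [Measure.ae_ae_of_ae_prod h] with x hx
    exact Measure.eqOn_Icc_of_ae_eq volume zero_ne_one hx
      (hsec hA _ (ofReal_mem_closedStrip hσ.le x)) (hsec hB _ (ofReal_mem_closedStrip hσ.le x)) ht
  have h2 : ∀ x : ℝ, A (x : ℂ) t = B (x : ℂ) t := by
    have cA := (hsec' hA).comp_continuous Complex.continuous_ofReal
      (ofReal_mem_closedStrip hσ.le)
    have cB := (hsec' hB).comp_continuous Complex.continuous_ofReal
      (ofReal_mem_closedStrip hσ.le)
    exact congrFun ((Continuous.ae_eq_iff_eq volume cA cB).1 h1)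
  have h3 : EqOn (fun z => A z t) (fun z => B z t) (openStrip σ) := by
    refine AnalyticOnNhd.eqOn_of_preconnected_of_frequently_eq
      ((hA.holomorphic t ht).analyticOnNhd (isOpen_openStrip σ))
      ((hB.holomorphic t ht).analyticOnNhd (isOpen_openStrip σ))
      (convex_openStrip σ).isPreconnected (z₀ := 0) (by simpa [openStrip] using hσ) ?_
    have hr : Filter.Tendsto (fun x : ℝ => (x : ℂ)) (nhdsWithin 0 {0}ᶜ) (nhdsWithin 0 {0}ᶜ) := by
      refine tendsto_nhdsWithin_of_tendsto_nhds_of_eventually_within _ ?_ ?_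
      · exact (Complex.continuous_ofReal.tendsto' 0 0 (by simp)).mono_left nhdsWithin_le_nhds
      · filter_upwards [self_mem_nhdsWithin] with x hx
        simpa using hx
    exact hr.frequently (Filter.Eventually.of_forall h2).frequently
  exact h3.of_subset_closure (hsec' hA) (hsec' hB) (openStrip_subset_closedStrip σ)
    (closedStrip_subset_closure hσ) hz

lemma IsContinuation.unique {σ : ℝ} (hσ : 0 < σ) {a : L2Strip} {A B : ℂ → ℝ → ℂ}
    (hA : IsContinuation σ a A) (hB : IsContinuation σ a B)
    {z : ℂ} (hz : z ∈ closedStrip σ) {t : ℝ} (ht : t ∈ Icc (0 : ℝ) 1) : A z t = B z t := by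
  refine hA.isStripFunction.eq_of_ae hσ hB.isStripFunction ?_ hz ht
  filter_upwards [hA.ae_eq, hB.ae_eq] with y h1 h2
  rw [← h1, h2]

lemma IsContinuation.ext {σ : ℝ} (hσ : 0 ≤ σ) {a b : L2Strip} {A B : ℂ → ℝ → ℂ}
    (hA : IsContinuation σ a A) (hB : IsContinuation σ b B)
    (h : ∀ z ∈ closedStrip σ, ∀ t ∈ Icc (0 : ℝ) 1, A z t = B z t) : a = b := by
  refine L2Strip_ext_of_coe ?_
  filter_upwards [hA.ae_eq, hB.ae_eq, ae_snd_mem_Icc] with y h1 h2 h3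
  rw [h1, h2, h _ (ofReal_mem_closedStrip hσ _) _ h3]

lemma IsContinuation.add {σ : ℝ} {a b : L2Strip} {A B : ℂ → ℝ → ℂ}
    (hA : IsContinuation σ a A) (hB : IsContinuation σ b B) :
    IsContinuation σ (a + b) (fun z t => A z t + B z t) where
  periodic z hz t ht := by rw [hA.periodic z hz t ht, hB.periodic z hz t ht]
  continuousOn := hA.continuousOn.add hB.continuousOn
  holomorphic t ht := (hA.holomorphic t ht).add (hB.holomorphic t ht)
  ae_eq := by
    filter_upwards [hA.ae_eq, hB.ae_eq, ae_comp_coe (Lp.coeFn_add a b)] with y h1 h2 h3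
    rw [h3, Pi.add_apply, h1, h2]

lemma IsContinuation.smul {σ : ℝ} (c : ℂ) {a : L2Strip} {A : ℂ → ℝ → ℂ}
    (hA : IsContinuation σ a A) : IsContinuation σ (c • a) (fun z t => c * A z t) where
  periodic z hz t ht := by rw [hA.periodic z hz t ht]
  continuousOn := hA.continuousOn.const_smul c
  holomorphic t ht := (hA.holomorphic t ht).const_mul c
  ae_eq := by
    filter_upwards [hA.ae_eq, ae_comp_coe (Lp.coeFn_smul c a)] with y h1 h3
    rw [h3, Pi.smul_apply, h1, smul_eq_mul]

/-- A function on the strip with smooth partial Fourier coefficients, whose weighted derivatives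
are square summable, is the continuation of an element of `Y`. -/
lemma exists_isContinuation_of_smooth {σ : ℝ} {m : ℕ} {A : ℂ → ℝ → ℂ}
    (hA : IsStripFunction σ A)
    {g : Circ × ℝ → ℂ} (hg : Continuous g)
    (hgA : ∀ x : ℝ, ∀ t ∈ Icc (0 : ℝ) 1, g ((x : Circ), t) = A x t)
    {v : ℤ → ℕ → ℝ → ℂ} (hv : ∀ k, ∀ i ≤ m, ContinuousOn (v k i) (Icc 0 1))
    (hd : ∀ k, ∀ i < m, ∀ t ∈ Ioo (0 : ℝ) 1, HasDerivAt (v k i) (v k (i + 1) t) t)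
    (hv0 : ∀ k, ∀ t ∈ Icc (0 : ℝ) 1, partialCoeff g k t = v k 0 t)
    {d : ℤ → ℕ → L2Interval} (hdv : ∀ k, ∀ i ≤ m, d k i =ᵐ[intervalMeasure] v k i)
    (hs : Summable fun i : ℤ × OrderIndex m =>
      ((|(i.1 : ℝ)| ^ i.2.1.2 * Real.exp (σ * |(i.1 : ℝ)|)) * ‖d i.1 i.2.1.1‖) ^ 2) :
    ∃ c : Y σ m, IsContinuation σ (Y.toL2 c) A ∧ ∀ i : ℤ × OrderIndex m,
      weightedDerivs σ m (Y.toL2 c) i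
        = ((i.1 : ℝ) ^ i.2.1.2 * Real.exp (σ * |(i.1 : ℝ)|)) • d i.1 i.2.1.1 := by
  have hm := memLp_strip_of_continuous hg
  have hcoeff : ∀ k, v k 0 =ᵐ[intervalMeasure] partialCoeff (hm.toLp g) k := by
    intro k
    filter_upwards [partialCoeff_congr hm.coeFn_toLp k, ae_restrict_mem measurableSet_Icc]
      with t h1 h2
    rw [h1, hv0 k t h2]
  have hmem : Memℓp (fun i : ℤ × OrderIndex m =>
      ((i.1 : ℝ) ^ i.2.1.2 * Real.exp (σ * |(i.1 : ℝ)|)) • d i.1 i.2.1.1) 2 := by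
    refine memℓp_gen ?_
    simpa [norm_smul] using hs
  obtain ⟨c, h1, h2⟩ := Y.exists_toSeq_eq (σ := σ) (hm.toLp g) ⟨_, hmem⟩ d
    (fun k p hp => (isWeakDeriv_of_hasDerivAt (fun i hi => hv k i (hi.trans hp))
      (fun i hi => hd k i (lt_of_lt_of_le hi hp)) (hdv k p hp)).congr (hcoeff k))
    (fun i => rfl)
  refine ⟨c, ⟨hA.periodic, hA.continuousOn, hA.holomorphic, ?_⟩, fun i => ?_⟩
  · rw [h1]
    filter_upwards [ae_comp_coe hm.coeFn_toLp, ae_snd_mem_Icc] with y e1 e2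
    rw [e1, hgA _ _ e2]
  · rw [← Y.toSeq_apply, h2]

/-! ### Polynomials on `[0,1]` -/

open Polynomial in
lemma continuous_eval_ofReal (u : ℂ[X]) : Continuous (fun t : ℝ => u.eval (t : ℂ)) :=
  u.continuous.comp Complex.continuous_ofReal

open Polynomial in
/-- A polynomial as an element of `L²[0,1]`. -/
def polyL2 : ℂ[X] →ₗ[ℂ] L2Interval where
  toFun u := (memLp_of_continuousOn (continuous_eval_ofReal u).continuousOn).toLp _
  map_add' u v := by
    rw [← MemLp.toLp_add]
    refine MemLp.toLp_congr _ _ (Filter.Eventually.of_forall fun t => ?_)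
    simp
  map_smul' c u := by
    rw [RingHom.id_apply, ← MemLp.toLp_const_smul]
    refine MemLp.toLp_congr _ _ (Filter.Eventually.of_forall fun t => ?_)
    simp

open Polynomial in
lemma coeFn_polyL2 (u : ℂ[X]) : polyL2 u =ᵐ[intervalMeasure] fun t : ℝ => u.eval (t : ℂ) :=
  MemLp.coeFn_toLp (memLp_of_continuousOn (continuous_eval_ofReal u).continuousOn)

lemma L2_norm_le_mul_of_ae {α : Type*} [MeasurableSpace α] {μ : Measure α} {g h : Lp ℂ 2 μ} {C : ℝ}
    (hC : ∀ᵐ t ∂μ, ‖g t‖ ≤ C * ‖h t‖) : ‖g‖ ≤ C * ‖h‖ :=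
  Lp.norm_le_mul_norm_of_ae_le_mul hC

instance isProbabilityMeasure_intervalMeasure : IsProbabilityMeasure intervalMeasure :=
  ⟨by simp⟩

lemma L2_norm_le_of_ae {g : L2Interval} {C : ℝ} (hC0 : 0 ≤ C)
    (hC : ∀ᵐ t ∂intervalMeasure, ‖g t‖ ≤ C) : ‖g‖ ≤ C := by
  have := Lp.norm_le_of_ae_bound (p := 2) hC0 hC
  simpa [measureUnivNNReal] using this

lemma integral_norm_le_L2_norm (g : L2Interval) : ∫ t, ‖g t‖ ∂intervalMeasure ≤ ‖g‖ := by
  have h1 : (eLpNorm g 1 intervalMeasure).toReal ≤ (eLpNorm g 2 intervalMeasure).toReal :=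
    ENNReal.toReal_mono (Lp.eLpNorm_ne_top g)
      (eLpNorm_le_eLpNorm_of_exponent_le (by norm_num) (Lp.aestronglyMeasurable g))
  rw [Lp.norm_def]
  refine le_trans (le_of_eq ?_) h1
  rw [eLpNorm_one_eq_lintegral_enorm,
    integral_norm_eq_lintegral_enorm (Lp.aestronglyMeasurable g)]

open Polynomial in
lemma integral_norm_eval_le (u : ℂ[X]) :
    ∫ t : ℝ in (0 : ℝ)..1, ‖u.eval (t : ℂ)‖ ≤ ‖polyL2 u‖ := by
  refine le_trans (le_of_eq ?_) (integral_norm_le_L2_norm (polyL2 u))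
  rw [intervalIntegral.integral_of_le zero_le_one, ← integral_Icc_eq_integral_Ioc]
  refine integral_congr_ae ?_
  filter_upwards [coeFn_polyL2 u] with t ht
  rw [ht]

open Polynomial in
lemma hasDerivAt_eval_ofReal (u : ℂ[X]) (t : ℝ) :
    HasDerivAt (fun t : ℝ => u.eval (t : ℂ)) ((derivative u).eval (t : ℂ)) t :=
  (u.hasDerivAt (t : ℂ)).comp_ofReal

open Polynomial in
/-- Agmon's inequality. -/
lemma norm_eval_le (u : ℂ[X]) {t : ℝ} (ht : t ∈ Icc (0 : ℝ) 1) :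
    ‖u.eval (t : ℂ)‖ ≤ ‖polyL2 u‖ + ‖polyL2 (derivative u)‖ := by
  have hc := continuous_eval_ofReal u
  have hc' := continuous_eval_ofReal (derivative u)
  have h1 : ∀ s ∈ Icc (0 : ℝ) 1, ‖u.eval (t : ℂ)‖
      ≤ ‖u.eval (s : ℂ)‖ + ‖polyL2 (derivative u)‖ := by
    intro s hs
    have e : ∫ r in s..t, (derivative u).eval (r : ℂ) = u.eval (t : ℂ) - u.eval (s : ℂ) :=
      intervalIntegral.integral_eq_sub_of_hasDerivAt (fun r _ => hasDerivAt_eval_ofReal u r)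
        (hc'.intervalIntegrable _ _)
    have e2 : ‖∫ r in s..t, (derivative u).eval (r : ℂ)‖ ≤ ‖polyL2 (derivative u)‖ := by
      refine le_trans ?_ (integral_norm_eval_le _)
      refine (intervalIntegral.norm_integral_le_integral_norm_uIoc).trans ?_
      rw [intervalIntegral.integral_of_le zero_le_one]
      refine setIntegral_mono_set ((hc'.norm.intervalIntegrable 0 1).1) ?_ ?_
      · exact Filter.Eventually.of_forall fun r => norm_nonneg _
      · refine LE.le.eventuallyLE fun r hr => ?_
        rw [uIoc, mem_Ioc] at hr
        exact ⟨lt_of_le_of_lt (le_min hs.1 ht.1) hr.1, hr.2.trans (max_le hs.2 ht.2)⟩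
    calc ‖u.eval (t : ℂ)‖ = ‖u.eval (s : ℂ) + ∫ r in s..t, (derivative u).eval (r : ℂ)‖ := by
          rw [e]; congr 1; ring
      _ ≤ _ := (norm_add_le _ _).trans (by gcongr)
  have h2 := intervalIntegral.integral_mono_on (a := 0) (b := 1) (μ := volume) zero_le_one
    ((continuous_const (y := ‖u.eval (t : ℂ)‖)).intervalIntegrable 0 1)
    (g := fun s : ℝ => ‖u.eval (s : ℂ)‖ + ‖polyL2 (derivative u)‖)
    ((hc.norm.add continuous_const).intervalIntegrable 0 1) h1
  rw [intervalIntegral.integral_add (hc.norm.intervalIntegrable 0 1)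
    (continuous_const.intervalIntegrable 0 1)] at h2
  simp only [intervalIntegral.integral_const, sub_zero, one_smul] at h2
  exact h2.trans (by gcongr; exact integral_norm_eval_le u)

open Polynomial in
lemma norm_polyL2_mul_le (u v : ℂ[X]) :
    ‖polyL2 (u * v)‖ ≤ (‖polyL2 u‖ + ‖polyL2 (derivative u)‖) * ‖polyL2 v‖ := by
  refine L2_norm_le_mul_of_ae ?_
  filter_upwards [coeFn_polyL2 (u * v), coeFn_polyL2 v, ae_restrict_mem measurableSet_Icc]
    with t h1 h2 h3
  rw [h1, h2, eval_mul, norm_mul]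
  gcongr
  exact norm_eval_le u h3

open Polynomial in
lemma norm_polyL2_mul_le' (u v : ℂ[X]) :
    ‖polyL2 (u * v)‖ ≤ ‖polyL2 u‖ * (‖polyL2 v‖ + ‖polyL2 (derivative v)‖) := by
  rw [mul_comm u v, mul_comm ‖polyL2 u‖]
  exact norm_polyL2_mul_le v u

/-! ### Trigonometric polynomials in `x` with coefficients polynomial in `ψ` -/

/-- Finite sums `∑ p_k(ψ) e^{ikz}` with polynomials `p_k`. -/
abbrev TrigPoly : Type := AddMonoidAlgebra (Polynomial ℂ) ℤ

/-- The character `k ↦ e^{ikz}`. -/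
def expChar (z : ℂ) : Multiplicative ℤ →* ℂ where
  toFun k := Complex.exp (Complex.I * (k.toAdd : ℂ) * z)
  map_one' := by simp
  map_mul' k l := by
    rw [← Complex.exp_add, toAdd_mul]
    congr 1
    push_cast
    ring

/-- The value of a trigonometric polynomial. -/
def evalTrig (z w : ℂ) : TrigPoly →+* ℂ :=
  AddMonoidAlgebra.liftNCRingHom (Polynomial.evalRingHom w) (expChar z)
    (fun _ _ => Commute.all _ _)

lemma evalTrig_apply (z w : ℂ) (p : TrigPoly) :
    evalTrig z w p = ∑ k ∈ p.coeff.support,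
      (p.coeff k).eval w * Complex.exp (Complex.I * (k : ℂ) * z) := rfl

lemma fourier_eq_exp (k : ℤ) (x : ℝ) :
    (fourier k (x : Circ) : ℂ) = Complex.exp (Complex.I * (k : ℂ) * x) := by
  rw [fourier_coe_apply]
  congr 1
  have : (Real.pi : ℂ) ≠ 0 := by exact_mod_cast Real.pi_ne_zero
  push_cast
  field_simp

lemma differentiable_evalTrig (p : TrigPoly) :
    Differentiable ℂ (fun w : ℂ × ℂ => evalTrig w.1 w.2 p) := by
  simp only [evalTrig_apply]
  refine Differentiable.fun_sum fun k _ => Differentiable.mul ?_ ?_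
  · exact (p.coeff k).differentiable.comp differentiable_snd
  · exact (differentiable_fst.const_mul _).cexp

lemma evalTrig_add_two_pi (p : TrigPoly) (z w : ℂ) :
    evalTrig (z + 2 * Real.pi) w p = evalTrig z w p := by
  simp only [evalTrig_apply]
  refine Finset.sum_congr rfl fun k _ => ?_
  congr 1
  rw [Complex.exp_eq_exp_iff_exists_int]
  exact ⟨k, by ring⟩

lemma isStripFunction_evalTrig (σ : ℝ) (p : TrigPoly) :
    IsStripFunction σ (fun z t => evalTrig z (t : ℂ) p) where
  periodic z _ t _ := evalTrig_add_two_pi p z t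
  continuousOn := ((differentiable_evalTrig p).continuous.comp
    (continuous_fst.prodMk (Complex.continuous_ofReal.comp continuous_snd))).continuousOn
  holomorphic t _ := ((differentiable_evalTrig p).comp
    (differentiable_id.prodMk (differentiable_const (t : ℂ)))).differentiableOn

/-- There are finitely many orders of differentiation. -/
instance fintypeOrderIndex (m : ℕ) : Fintype (OrderIndex m) :=
  @Fintype.ofFinite _ (Finite.of_injective (β := Fin (m + 1) × Fin (m + 1))
    (fun o => (⟨o.1.1, by have := o.2; omega⟩, ⟨o.1.2, by have := o.2; omega⟩)) (by
      intro o o' h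
      simp only [Prod.mk.injEq, Fin.mk.injEq] at h
      exact Subtype.ext (Prod.ext h.1 h.2)))

open Polynomial in
/-- The weighted norm `|k|^q e^{σ|k|} ‖D^i p_k‖` of a coefficient. -/
def trigWeight (σ : ℝ) (p : TrigPoly) (i q : ℕ) (k : ℤ) : ℝ :=
  |(k : ℝ)| ^ q * Real.exp (σ * |(k : ℝ)|) * ‖polyL2 (derivative^[i] (p.coeff k))‖

lemma trigWeight_nonneg (σ : ℝ) (p : TrigPoly) (i q : ℕ) (k : ℤ) : 0 ≤ trigWeight σ p i q k := by
  unfold trigWeight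
  positivity

open Polynomial in
lemma exists_isContinuation_evalTrig (σ : ℝ) (m : ℕ) (p : TrigPoly) :
    ∃ c : Y σ m, IsContinuation σ (Y.toL2 c) (fun z t => evalTrig z (t : ℂ) p) ∧
      ∀ i : ℤ × OrderIndex m, weightedDerivs σ m (Y.toL2 c) i
        = ((i.1 : ℝ) ^ i.2.1.2 * Real.exp (σ * |(i.1 : ℝ)|)) •
          polyL2 (derivative^[i.2.1.1] (p.coeff i.1)) := by
  refine exists_isContinuation_of_smooth (isStripFunction_evalTrig σ p)
    (g := fun y => ∑ k ∈ p.coeff.support, (p.coeff k).eval (y.2 : ℂ) * fourier k y.1)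
    (v := fun k i t => (derivative^[i] (p.coeff k)).eval (t : ℂ))
    (d := fun k i => polyL2 (derivative^[i] (p.coeff k))) ?_ ?_ ?_ ?_ ?_ ?_ ?_
  · refine continuous_finsetSum _ fun k _ => Continuous.mul ?_ ?_
    · exact (continuous_eval_ofReal _).comp continuous_snd
    · exact (fourier k).continuous.comp continuous_fst
  · intro x t _
    simp only [evalTrig_apply, fourier_eq_exp]
  · exact fun k i _ => (continuous_eval_ofReal _).continuousOn
  · intro k i _ t _
    rw [Function.iterate_succ_apply']
    exact hasDerivAt_eval_ofReal _ t
  · intro k t _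
    have e : (fun x : Circ => ∑ j ∈ p.coeff.support, (p.coeff j).eval (t : ℂ) * fourier j x)
        = ∑ j ∈ p.coeff.support, fun x : Circ => (p.coeff j).eval (t : ℂ) * fourier j x := by
      funext x
      simp
    simp only [partialCoeff]
    rw [e, fourierCoeff.sum _ _ fun j _ => ?_, Finset.sum_apply]
    · simp only [fourierCoeff.const_mul, fourierCoeff_fourier, Function.iterate_zero, id_eq]
      rw [Finset.sum_eq_single k]
      · simp
      · intro j _ hj
        simp [hj.symm]
      · intro hk
        simp [Finsupp.notMem_support_iff.1 hk]
    · exact (continuous_const.mul (fourier j).continuous).integrable_of_hasCompactSupport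
        (HasCompactSupport.of_compactSpace _)
  · exact fun k i _ => coeFn_polyL2 _
  · refine summable_of_ne_finset_zero (s := p.coeff.support ×ˢ Finset.univ) fun i hi => ?_
    have : p.coeff i.1 = 0 := by
      by_contra h
      exact hi (by simp [h])
    simp [this]

/-- A trigonometric polynomial as an element of `Y`. -/
def trigY (σ : ℝ) (m : ℕ) (p : TrigPoly) : Y σ m := (exists_isContinuation_evalTrig σ m p).choose

lemma isContinuation_trigY (σ : ℝ) (m : ℕ) (p : TrigPoly) :
    IsContinuation σ (Y.toL2 (trigY σ m p)) (fun z t => evalTrig z (t : ℂ) p) :=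
  (exists_isContinuation_evalTrig σ m p).choose_spec.1

open Polynomial in
lemma weightedDerivs_trigY (σ : ℝ) (m : ℕ) (p : TrigPoly) (i : ℤ × OrderIndex m) :
    weightedDerivs σ m (Y.toL2 (trigY σ m p)) i
      = ((i.1 : ℝ) ^ i.2.1.2 * Real.exp (σ * |(i.1 : ℝ)|)) •
          polyL2 (derivative^[i.2.1.1] (p.coeff i.1)) :=
  (exists_isContinuation_evalTrig σ m p).choose_spec.2 i

lemma hasSum_trigWeight (σ : ℝ) (m : ℕ) (p : TrigPoly) :
    HasSum (fun i : ℤ × OrderIndex m => trigWeight σ p i.2.1.1 i.2.1.2 i.1 ^ 2)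
      (‖trigY σ m p‖ ^ 2) := by
  refine (Y.hasSum_norm_sq (trigY σ m p)).congr_fun fun i => ?_
  rw [weightedDerivs_trigY, norm_smul]
  simp [trigWeight]

lemma trigY_sub {σ : ℝ} (hσ : 0 ≤ σ) (m : ℕ) (p r : TrigPoly) :
    trigY σ m (p - r) = trigY σ m p - trigY σ m r := by
  have h := (isContinuation_trigY σ m p).add ((isContinuation_trigY σ m r).smul (-1))
  refine Y.toL2_injective ((isContinuation_trigY σ m (p - r)).ext hσ
    (b := Y.toL2 (trigY σ m p - trigY σ m r))
    (B := fun z t => evalTrig z (t : ℂ) p + -1 * evalTrig z (t : ℂ) r) ?_ ?_)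
  · convert h using 1
    rw [map_sub, sub_eq_add_neg, neg_one_smul]
  · intro z _ t _
    rw [map_sub]
    ring

/-! ### Sup bound and product bound for trigonometric polynomials -/

/-- Young's inequality `ℓ² * ℓ¹ ⊆ ℓ²` for finite sums. -/
lemma sum_sq_conv_le {A B : ℤ → ℝ} (hB : ∀ k, 0 ≤ B k) {α β : ℝ}
    (h1 : ∀ S : Finset ℤ, ∑ k ∈ S, A k ^ 2 ≤ α ^ 2)
    (h2 : ∀ S : Finset ℤ, ∑ k ∈ S, B k ≤ β) (S T : Finset ℤ) :
    ∑ k ∈ T, (∑ j ∈ S, A j * B (k - j)) ^ 2 ≤ (α * β) ^ 2 := by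
  have hβ : 0 ≤ β := by simpa using h2 ∅
  have hsub : ∀ k, ∑ j ∈ S, B (k - j) ≤ β := by
    intro k
    have := h2 (S.image fun j => k - j)
    rwa [Finset.sum_image (fun x _ y _ h => by simpa using h)] at this
  have hsub' : ∀ j, ∑ k ∈ T, B (k - j) ≤ β := by
    intro j
    have := h2 (T.image fun k => k - j)
    rwa [Finset.sum_image (fun x _ y _ h => by simpa using h)] at this
  calc ∑ k ∈ T, (∑ j ∈ S, A j * B (k - j)) ^ 2
      ≤ ∑ k ∈ T, β * ∑ j ∈ S, A j ^ 2 * B (k - j) := by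
        refine Finset.sum_le_sum fun k _ => ?_
        refine (Finset.sum_sq_le_sum_mul_sum_of_sq_le_mul S (fun j _ => hB (k - j))
          (fun j _ => mul_nonneg (sq_nonneg (A j)) (hB (k - j))) (fun j _ => le_of_eq (by ring))).trans ?_
        exact mul_le_mul_of_nonneg_right (hsub k)
          (Finset.sum_nonneg fun j _ => mul_nonneg (sq_nonneg _) (hB _))
    _ = β * ∑ j ∈ S, A j ^ 2 * ∑ k ∈ T, B (k - j) := by
        rw [← Finset.mul_sum, Finset.sum_comm]
        simp only [Finset.mul_sum]
    _ ≤ β * ∑ j ∈ S, A j ^ 2 * β := by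
        gcongr with j _
        exact hsub' j
    _ = β ^ 2 * ∑ j ∈ S, A j ^ 2 := by rw [← Finset.sum_mul]; ring
    _ ≤ β ^ 2 * α ^ 2 := by
        gcongr
        exact h1 S
    _ = (α * β) ^ 2 := by ring

lemma sum_sq_conv_le' {A B : ℤ → ℝ} (hB : ∀ k, 0 ≤ B k) {α β : ℝ}
    (h1 : ∀ S : Finset ℤ, ∑ k ∈ S, A k ^ 2 ≤ α ^ 2)
    (h2 : ∀ S : Finset ℤ, ∑ k ∈ S, B k ≤ β) (S T : Finset ℤ) :
    ∑ k ∈ T, (∑ j ∈ S, B j * A (k - j)) ^ 2 ≤ (β * α) ^ 2 := by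
  have hβ : 0 ≤ β := by simpa using h2 ∅
  have hsub' : ∀ j, ∑ k ∈ T, A (k - j) ^ 2 ≤ α ^ 2 := by
    intro j
    have := h1 (T.image fun k => k - j)
    rwa [Finset.sum_image (fun x _ y _ h => by simpa using h)] at this
  calc ∑ k ∈ T, (∑ j ∈ S, B j * A (k - j)) ^ 2
      ≤ ∑ k ∈ T, β * ∑ j ∈ S, B j * A (k - j) ^ 2 := by
        refine Finset.sum_le_sum fun k _ => ?_
        refine (Finset.sum_sq_le_sum_mul_sum_of_sq_le_mul S (fun j _ => hB j)
          (fun j _ => mul_nonneg (hB j) (sq_nonneg (A (k - j)))) (fun j _ => le_of_eq (by ring))).trans ?_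
        exact mul_le_mul_of_nonneg_right (h2 S)
          (Finset.sum_nonneg fun j _ => mul_nonneg (hB _) (sq_nonneg _))
    _ = β * ∑ j ∈ S, B j * ∑ k ∈ T, A (k - j) ^ 2 := by
        rw [← Finset.mul_sum, Finset.sum_comm]
        simp only [Finset.mul_sum]
    _ ≤ β * ∑ j ∈ S, B j * α ^ 2 := by
        gcongr with j _
        · exact hB j
        · exact hsub' j
    _ = (β * ∑ j ∈ S, B j) * α ^ 2 := by rw [← Finset.sum_mul]; ring
    _ ≤ (β * β) * α ^ 2 := by
        gcongr
        exact h2 S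
    _ = (β * α) ^ 2 := by ring

lemma summable_one_div_one_add_sq : Summable fun k : ℤ => 1 / (1 + (k : ℝ) ^ 2) := by
  refine Summable.of_norm_bounded_eventually (Real.summable_one_div_int_pow.2 one_lt_two) ?_
  have h : ∀ᶠ k : ℤ in Filter.cofinite, k ≠ 0 := by
    rw [Filter.eventually_cofinite]
    simp
  filter_upwards [h] with k hk
  have hk' : (0 : ℝ) < (k : ℝ) ^ 2 := by positivity
  rw [Real.norm_of_nonneg (by positivity)]
  exact one_div_le_one_div_of_le hk' (by linarith)

/-- The constant `(2 ∑ 1 / (1 + k²))^{1/2}`. -/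
def latticeConst : ℝ := √(2 * ∑' k : ℤ, 1 / (1 + (k : ℝ) ^ 2))

lemma latticeConst_nonneg : 0 ≤ latticeConst := Real.sqrt_nonneg _

/-- The weight controlling the supremum of a weighted coefficient. -/
def supWeight (σ : ℝ) (p : TrigPoly) (i q : ℕ) (k : ℤ) : ℝ :=
  trigWeight σ p i q k + trigWeight σ p (i + 1) q k

lemma supWeight_nonneg (σ : ℝ) (p : TrigPoly) (i q : ℕ) (k : ℤ) : 0 ≤ supWeight σ p i q k :=
  add_nonneg (trigWeight_nonneg _ _ _ _ _) (trigWeight_nonneg _ _ _ _ _)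

section bounds

variable (σ : ℝ) {m : ℕ} (p : TrigPoly) {i q : ℕ}

lemma sum_sq_trigWeight_le (h : i + q ≤ m) (S : Finset ℤ) :
    ∑ k ∈ S, trigWeight σ p i q k ^ 2 ≤ ‖trigY σ m p‖ ^ 2 := by
  have := sum_le_hasSum (S.image fun k => ((k, ⟨(i, q), h⟩) : ℤ × OrderIndex m))
    (fun _ _ => sq_nonneg _) (hasSum_trigWeight σ m p)
  rwa [Finset.sum_image (fun x _ y _ h => congrArg Prod.fst h)] at this

lemma sum_trigWeight_le (h : i + q + 1 ≤ m) (S : Finset ℤ) :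
    ∑ k ∈ S, trigWeight σ p i q k ≤ latticeConst * ‖trigY σ m p‖ := by
  have e : ∀ k : ℤ, (1 + (k : ℝ) ^ 2) * trigWeight σ p i q k ^ 2
      = trigWeight σ p i q k ^ 2 + trigWeight σ p i (q + 1) k ^ 2 := by
    intro k
    have hk : |(k : ℝ)| ^ 2 = (k : ℝ) ^ 2 := sq_abs _
    simp only [trigWeight, pow_succ |(k : ℝ)| q]
    rw [← hk]
    ring
  have h1 : (∑ k ∈ S, trigWeight σ p i q k) ^ 2
      ≤ (∑ k ∈ S, 1 / (1 + (k : ℝ) ^ 2)) *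
        ∑ k ∈ S, (1 + (k : ℝ) ^ 2) * trigWeight σ p i q k ^ 2 := by
    refine Finset.sum_sq_le_sum_mul_sum_of_sq_le_mul S (fun k _ => by positivity)
      (fun k _ => by positivity) fun k _ => le_of_eq ?_
    field_simp
  have h2 : ∑ k ∈ S, (1 + (k : ℝ) ^ 2) * trigWeight σ p i q k ^ 2
      ≤ 2 * ‖trigY σ m p‖ ^ 2 := by
    simp only [e, Finset.sum_add_distrib]
    have a1 := sum_sq_trigWeight_le σ p (m := m) (i := i) (q := q) (by omega) S
    have a2 := sum_sq_trigWeight_le σ p (m := m) (i := i) (q := q + 1) (by omega) S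
    linarith
  have h3 : ∑ k ∈ S, 1 / (1 + (k : ℝ) ^ 2) ≤ ∑' k : ℤ, 1 / (1 + (k : ℝ) ^ 2) :=
    summable_one_div_one_add_sq.sum_le_tsum S fun k _ => by positivity
  refine abs_le_of_sq_le_sq' ?_ (mul_nonneg latticeConst_nonneg (norm_nonneg _)) |>.2
  have h0 : 0 ≤ ∑' k : ℤ, 1 / (1 + (k : ℝ) ^ 2) := tsum_nonneg fun k => by positivity
  rw [mul_pow, latticeConst, Real.sq_sqrt (by positivity)]
  calc _ ≤ _ := h1
    _ ≤ (∑' k : ℤ, 1 / (1 + (k : ℝ) ^ 2)) * (2 * ‖trigY σ m p‖ ^ 2) := by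
        gcongr
    _ = _ := by ring

lemma sum_sq_supWeight_le (h : i + q + 1 ≤ m) (S : Finset ℤ) :
    ∑ k ∈ S, supWeight σ p i q k ^ 2 ≤ (2 * ‖trigY σ m p‖) ^ 2 := by
  have a1 := sum_sq_trigWeight_le σ p (m := m) (i := i) (q := q) (by omega) S
  have a2 := sum_sq_trigWeight_le σ p (m := m) (i := i + 1) (q := q) (by omega) S
  calc ∑ k ∈ S, supWeight σ p i q k ^ 2
      ≤ ∑ k ∈ S, (2 * trigWeight σ p i q k ^ 2 + 2 * trigWeight σ p (i + 1) q k ^ 2) := by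
        refine Finset.sum_le_sum fun k _ => ?_
        rw [← mul_add]
        exact add_sq_le
    _ ≤ (2 * ‖trigY σ m p‖) ^ 2 := by
        rw [Finset.sum_add_distrib, ← Finset.mul_sum, ← Finset.mul_sum]
        linarith

lemma sum_supWeight_le (h : i + q + 2 ≤ m) (S : Finset ℤ) :
    ∑ k ∈ S, supWeight σ p i q k ≤ 2 * latticeConst * ‖trigY σ m p‖ := by
  have a1 := sum_trigWeight_le σ p (m := m) (i := i) (q := q) (by omega) S
  have a2 := sum_trigWeight_le σ p (m := m) (i := i + 1) (q := q) (by omega) S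
  simp only [supWeight, Finset.sum_add_distrib]
  linarith

end bounds

lemma norm_exp_le {σ : ℝ} {z : ℂ} (hz : z ∈ closedStrip σ) (k : ℤ) :
    ‖Complex.exp (Complex.I * (k : ℂ) * z)‖ ≤ Real.exp (σ * |(k : ℝ)|) := by
  rw [Complex.norm_exp, Real.exp_le_exp]
  have h : (Complex.I * (k : ℂ) * z).re = -((k : ℝ) * z.im) := by
    simp [Complex.mul_re]
  rw [h]
  refine (neg_le_abs _).trans ?_
  rw [abs_mul, mul_comm]
  exact mul_le_mul_of_nonneg_right hz (abs_nonneg _)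

lemma norm_evalTrig_le {σ : ℝ} {m : ℕ} (hm : 1 < m) (p : TrigPoly) {z : ℂ}
    (hz : z ∈ closedStrip σ) {t : ℝ} (ht : t ∈ Icc (0 : ℝ) 1) :
    ‖evalTrig z (t : ℂ) p‖ ≤ 2 * latticeConst * ‖trigY σ m p‖ := by
  rw [evalTrig_apply]
  refine (norm_sum_le _ _).trans (le_trans (Finset.sum_le_sum fun k _ => ?_)
    (sum_supWeight_le σ p (i := 0) (q := 0) (by omega) p.coeff.support))
  rw [norm_mul, mul_comm]
  calc _ ≤ Real.exp (σ * |(k : ℝ)|)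
        * (‖polyL2 (p.coeff k)‖ + ‖polyL2 (Polynomial.derivative (p.coeff k))‖) :=
        mul_le_mul (norm_exp_le hz k) (norm_eval_le _ ht) (norm_nonneg _) (Real.exp_pos _).le
    _ = _ := by simp [supWeight, trigWeight, mul_add]

open Polynomial in
/-- The contribution of the product of the `j`-th and the `(k-j)`-th coefficients. -/
def convWeight (σ : ℝ) (p r : TrigPoly) (i₁ q₁ i₂ q₂ : ℕ) (k j : ℤ) : ℝ :=
  (|(j : ℝ)| ^ q₁ * Real.exp (σ * |(j : ℝ)|)) *
    (|((k - j : ℤ) : ℝ)| ^ q₂ * Real.exp (σ * |((k - j : ℤ) : ℝ)|)) *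
    ‖polyL2 (derivative^[i₁] (p.coeff j) * derivative^[i₂] (r.coeff (k - j)))‖

lemma convWeight_nonneg (σ : ℝ) (p r : TrigPoly) (i₁ q₁ i₂ q₂ : ℕ) (k j : ℤ) :
    0 ≤ convWeight σ p r i₁ q₁ i₂ q₂ k j := by
  unfold convWeight
  positivity

lemma convWeight_le (σ : ℝ) (p r : TrigPoly) (i₁ q₁ i₂ q₂ : ℕ) (k j : ℤ) :
    convWeight σ p r i₁ q₁ i₂ q₂ k j ≤ supWeight σ p i₁ q₁ j * trigWeight σ r i₂ q₂ (k - j) := by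
  unfold convWeight
  refine (mul_le_mul_of_nonneg_left (norm_polyL2_mul_le _ _) (by positivity)).trans (le_of_eq ?_)
  simp only [supWeight, trigWeight, Function.iterate_succ_apply']
  ring

lemma convWeight_le' (σ : ℝ) (p r : TrigPoly) (i₁ q₁ i₂ q₂ : ℕ) (k j : ℤ) :
    convWeight σ p r i₁ q₁ i₂ q₂ k j ≤ trigWeight σ p i₁ q₁ j * supWeight σ r i₂ q₂ (k - j) := by
  unfold convWeight
  refine (mul_le_mul_of_nonneg_left (norm_polyL2_mul_le' _ _) (by positivity)).trans (le_of_eq ?_)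
  simp only [supWeight, trigWeight, Function.iterate_succ_apply']
  ring

lemma sum_sq_convWeight_le (σ : ℝ) {m : ℕ} (hm : 1 < m) (p r : TrigPoly) {i₁ q₁ i₂ q₂ : ℕ}
    (h : (i₁ + q₁) + (i₂ + q₂) ≤ m) (S T : Finset ℤ) :
    ∑ k ∈ T, (∑ j ∈ S, convWeight σ p r i₁ q₁ i₂ q₂ k j) ^ 2
      ≤ (2 * latticeConst * ‖trigY σ m p‖ * ‖trigY σ m r‖) ^ 2 := by
  have mono : ∀ {B : ℤ → ℤ → ℝ}, (∀ k j, convWeight σ p r i₁ q₁ i₂ q₂ k j ≤ B k j) →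
      ∑ k ∈ T, (∑ j ∈ S, convWeight σ p r i₁ q₁ i₂ q₂ k j) ^ 2
        ≤ ∑ k ∈ T, (∑ j ∈ S, B k j) ^ 2 := by
    intro B hB
    refine Finset.sum_le_sum fun k _ => ?_
    gcongr with j _
    · exact Finset.sum_nonneg fun j _ => convWeight_nonneg _ _ _ _ _ _ _ _ _
    · exact hB k j
  by_cases h1 : i₁ + q₁ + 1 ≤ m
  · by_cases h2 : i₂ + q₂ + 1 ≤ m
    · refine (mono (convWeight_le σ p r i₁ q₁ i₂ q₂)).trans ?_
      refine (sum_sq_conv_le (trigWeight_nonneg σ r i₂ q₂)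
        (sum_sq_supWeight_le σ p h1) (sum_trigWeight_le σ r h2) S T).trans (le_of_eq ?_)
      ring
    · refine (mono (convWeight_le σ p r i₁ q₁ i₂ q₂)).trans ?_
      refine (sum_sq_conv_le' (supWeight_nonneg σ p i₁ q₁)
        (sum_sq_trigWeight_le σ r (m := m) (by omega)) (sum_supWeight_le σ p (by omega))
        S T)
  · refine (mono (convWeight_le' σ p r i₁ q₁ i₂ q₂)).trans ?_
    refine (sum_sq_conv_le (supWeight_nonneg σ r i₂ q₂)
      (sum_sq_trigWeight_le σ p (m := m) (by omega)) (sum_supWeight_le σ r (m := m) (by omega))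
      S T).trans (le_of_eq ?_)
    ring

lemma abs_pow_le_two_pow_mul (x y : ℝ) (q : ℕ) :
    |x + y| ^ q ≤ 2 ^ q * (|x| ^ q + |y| ^ q) := by
  have h1 : |x + y| ≤ 2 * max |x| |y| := by
    have := abs_add_le x y
    have h2 := le_max_left |x| |y|
    have h3 := le_max_right |x| |y|
    linarith
  calc |x + y| ^ q ≤ (2 * max |x| |y|) ^ q := by gcongr
    _ = 2 ^ q * (max |x| |y|) ^ q := by rw [mul_pow]
    _ ≤ 2 ^ q * (|x| ^ q + |y| ^ q) := by
        gcongr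
        rcases max_choice |x| |y| with h | h <;> rw [h]
        · exact le_add_of_nonneg_right (by positivity)
        · exact le_add_of_nonneg_left (by positivity)

open Polynomial in
/-- Leibniz' rule. -/
lemma trigWeight_mul_le {σ : ℝ} (hσ : 0 ≤ σ) (p r : TrigPoly) (i q : ℕ) (k : ℤ) :
    trigWeight σ (p * r) i q k ≤ 2 ^ q * 2 ^ i * ∑ h ∈ Finset.range (i + 1),
      (∑ j ∈ p.coeff.support, convWeight σ p r (i - h) q h 0 k j
        + ∑ j ∈ p.coeff.support, convWeight σ p r (i - h) 0 h q k j) := by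
  have hcoeff : (p * r).coeff k = ∑ j ∈ p.coeff.support, p.coeff j * r.coeff (k - j) := by
    rw [AddMonoidAlgebra.coeff_mul_apply_left]
    refine Finset.sum_congr rfl fun j _ => ?_
    simp only [neg_add_eq_sub]
  have hterm : ∀ j, |(k : ℝ)| ^ q * Real.exp (σ * |(k : ℝ)|) *
      ‖polyL2 (derivative^[i] (p.coeff j * r.coeff (k - j)))‖
      ≤ 2 ^ q * 2 ^ i * ∑ h ∈ Finset.range (i + 1),
      (convWeight σ p r (i - h) q h 0 k j + convWeight σ p r (i - h) 0 h q k j) := by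
    intro j
    have hk : (k : ℝ) = (j : ℝ) + ((k - j : ℤ) : ℝ) := by push_cast; ring
    have hw : |(k : ℝ)| ^ q * Real.exp (σ * |(k : ℝ)|)
        ≤ 2 ^ q * (|(j : ℝ)| ^ q + |((k - j : ℤ) : ℝ)| ^ q) *
          (Real.exp (σ * |(j : ℝ)|) * Real.exp (σ * |((k - j : ℤ) : ℝ)|)) := by
      refine mul_le_mul ?_ ?_ (Real.exp_pos _).le (by positivity)
      · conv_lhs => rw [hk]
        exact abs_pow_le_two_pow_mul _ _ q
      · rw [← Real.exp_add, Real.exp_le_exp, ← mul_add]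
        refine mul_le_mul_of_nonneg_left ?_ hσ
        conv_lhs => rw [hk]
        exact abs_add_le _ _
    have hD : ‖polyL2 (derivative^[i] (p.coeff j * r.coeff (k - j)))‖
        ≤ 2 ^ i * ∑ h ∈ Finset.range (i + 1),
          ‖polyL2 (derivative^[i - h] (p.coeff j) * derivative^[h] (r.coeff (k - j)))‖ := by
      rw [iterate_derivative_mul, map_sum, Finset.mul_sum]
      refine (norm_sum_le _ _).trans (Finset.sum_le_sum fun h _ => ?_)
      rw [map_nsmul, ← Nat.cast_smul_eq_nsmul ℝ, norm_smul]
      gcongr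
      rw [Real.norm_natCast]
      exact_mod_cast Nat.choose_le_two_pow i h
    refine (mul_le_mul hw hD (norm_nonneg _) (by positivity)).trans (le_of_eq ?_)
    simp only [Finset.mul_sum, convWeight]
    refine Finset.sum_congr rfl fun h _ => ?_
    ring
  unfold trigWeight
  rw [hcoeff, iterate_derivative_sum, map_sum]
  calc _ ≤ |(k : ℝ)| ^ q * Real.exp (σ * |(k : ℝ)|) * ∑ j ∈ p.coeff.support,
        ‖polyL2 (derivative^[i] (p.coeff j * r.coeff (k - j)))‖ := by
        gcongr
        exact norm_sum_le _ _
    _ ≤ ∑ j ∈ p.coeff.support, 2 ^ q * 2 ^ i * ∑ h ∈ Finset.range (i + 1),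
      (convWeight σ p r (i - h) q h 0 k j + convWeight σ p r (i - h) 0 h q k j) := by
        rw [Finset.mul_sum]
        exact Finset.sum_le_sum fun j _ => hterm j
    _ = _ := by
        rw [← Finset.mul_sum, Finset.sum_comm]
        simp only [Finset.sum_add_distrib]

lemma sum_sq_trigWeight_mul_le {σ : ℝ} (hσ : 0 ≤ σ) {m : ℕ} (hm : 1 < m) (p r : TrigPoly)
    {i q : ℕ} (h : i + q ≤ m) (T : Finset ℤ) :
    ∑ k ∈ T, trigWeight σ (p * r) i q k ^ 2
      ≤ (2 * (m + 1) * 4 ^ m * (2 * latticeConst) * ‖trigY σ m p‖ * ‖trigY σ m r‖) ^ 2 := by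
  set D := 2 * latticeConst * ‖trigY σ m p‖ * ‖trigY σ m r‖ with hD
  have hpow : (2 : ℝ) ^ q * 2 ^ i ≤ 4 ^ m := by
    rw [← pow_add]
    calc (2 : ℝ) ^ (q + i) ≤ 2 ^ (2 * m) := pow_le_pow_right₀ (by norm_num) (by omega)
      _ = 4 ^ m := by rw [pow_mul]; norm_num
  have hi : ((i + 1 : ℕ) : ℝ) ≤ (m + 1 : ℝ) := by
    have : i ≤ m := by omega
    push_cast
    have : (i : ℝ) ≤ m := by exact_mod_cast this
    linarith
  let a : ℕ → ℤ → ℝ := fun h k => ∑ j ∈ p.coeff.support, convWeight σ p r (i - h) q h 0 k j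
  let b : ℕ → ℤ → ℝ := fun h k => ∑ j ∈ p.coeff.support, convWeight σ p r (i - h) 0 h q k j
  calc ∑ k ∈ T, trigWeight σ (p * r) i q k ^ 2
      ≤ ∑ k ∈ T, ((4 : ℝ) ^ m) ^ 2 * (((m : ℝ) + 1) * ∑ h ∈ Finset.range (i + 1),
          (2 * (a h k ^ 2 + b h k ^ 2))) := by
        refine Finset.sum_le_sum fun k _ => ?_
        have h0 : 0 ≤ ∑ h ∈ Finset.range (i + 1), (a h k + b h k) :=
          Finset.sum_nonneg fun h _ => add_nonneg
            (Finset.sum_nonneg fun j _ => convWeight_nonneg _ _ _ _ _ _ _ _ _)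
            (Finset.sum_nonneg fun j _ => convWeight_nonneg _ _ _ _ _ _ _ _ _)
        have h1 : trigWeight σ (p * r) i q k
            ≤ 4 ^ m * ∑ h ∈ Finset.range (i + 1), (a h k + b h k) :=
          (trigWeight_mul_le hσ p r i q k).trans (mul_le_mul_of_nonneg_right hpow h0)
        calc trigWeight σ (p * r) i q k ^ 2
            ≤ (4 ^ m * ∑ h ∈ Finset.range (i + 1), (a h k + b h k)) ^ 2 := by
              have := trigWeight_nonneg σ (p * r) i q k
              gcongr
          _ = (4 ^ m) ^ 2 * (∑ h ∈ Finset.range (i + 1), (a h k + b h k)) ^ 2 := by ring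
          _ ≤ (4 ^ m) ^ 2 * (((Finset.range (i + 1)).card : ℝ) *
                ∑ h ∈ Finset.range (i + 1), (a h k + b h k) ^ 2) := by
              gcongr
              exact sq_sum_le_card_mul_sum_sq
          _ ≤ _ := by
              rw [Finset.card_range]
              gcongr
              exact add_sq_le
    _ = ((4 : ℝ) ^ m) ^ 2 * (((m : ℝ) + 1) * ∑ h ∈ Finset.range (i + 1),
          (2 * (∑ k ∈ T, a h k ^ 2 + ∑ k ∈ T, b h k ^ 2))) := by
        rw [← Finset.mul_sum, ← Finset.mul_sum, Finset.sum_comm]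
        simp only [← Finset.mul_sum, Finset.sum_add_distrib]
    _ ≤ ((4 : ℝ) ^ m) ^ 2 * (((m : ℝ) + 1) * ∑ h ∈ Finset.range (i + 1), (2 * (D ^ 2 + D ^ 2))) := by
        gcongr with h' hh
        · rw [Finset.mem_range] at hh
          exact sum_sq_convWeight_le σ hm p r (by omega) _ _
        · rw [Finset.mem_range] at hh
          exact sum_sq_convWeight_le σ hm p r (by omega) _ _
    _ = ((4 : ℝ) ^ m) ^ 2 * (((m : ℝ) + 1) * (((i + 1 : ℕ) : ℝ) * (4 * D ^ 2))) := by
        rw [Finset.sum_const, Finset.card_range, nsmul_eq_mul]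
        ring
    _ ≤ ((4 : ℝ) ^ m) ^ 2 * (((m : ℝ) + 1) * ((m + 1) * (4 * D ^ 2))) := by gcongr
    _ = _ := by
        rw [hD]
        ring

/-- The constant of the product estimate. -/
def mulConst (m : ℕ) : ℝ :=
  √(Fintype.card (OrderIndex m)) * (2 * (m + 1) * 4 ^ m * (2 * latticeConst))

lemma mulConst_nonneg (m : ℕ) : 0 ≤ mulConst m := by
  have := latticeConst_nonneg
  unfold mulConst
  positivity

lemma norm_trigY_mul_le {σ : ℝ} (hσ : 0 ≤ σ) {m : ℕ} (hm : 1 < m) (p r : TrigPoly) :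
    ‖trigY σ m (p * r)‖ ≤ mulConst m * ‖trigY σ m p‖ * ‖trigY σ m r‖ := by
  have hL := latticeConst_nonneg
  refine abs_le_of_sq_le_sq' ?_ (mul_nonneg (mul_nonneg (mulConst_nonneg m) (norm_nonneg _))
    (norm_nonneg _)) |>.2
  refine hasSum_le_of_sum_le (hasSum_trigWeight σ m (p * r)) fun s => ?_
  let T : Finset ℤ := s.image Prod.fst
  calc ∑ i ∈ s, trigWeight σ (p * r) i.2.1.1 i.2.1.2 i.1 ^ 2
      ≤ ∑ i ∈ T ×ˢ (Finset.univ : Finset (OrderIndex m)),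
          trigWeight σ (p * r) i.2.1.1 i.2.1.2 i.1 ^ 2 := by
        refine Finset.sum_le_sum_of_subset_of_nonneg (fun i hi => ?_) fun _ _ _ => sq_nonneg _
        exact Finset.mem_product.2 ⟨Finset.mem_image_of_mem _ hi, Finset.mem_univ _⟩
    _ = ∑ o : OrderIndex m, ∑ k ∈ T, trigWeight σ (p * r) o.1.1 o.1.2 k ^ 2 :=
        Finset.sum_product_right _ _ _
    _ ≤ ∑ _o : OrderIndex m, (2 * (m + 1) * 4 ^ m * (2 * latticeConst) *
          ‖trigY σ m p‖ * ‖trigY σ m r‖) ^ 2 :=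
        Finset.sum_le_sum fun o _ => sum_sq_trigWeight_mul_le hσ hm p r o.2 T
    _ = _ := by
        have hc : √(Fintype.card (OrderIndex m) : ℝ) ^ 2 = Fintype.card (OrderIndex m) :=
          Real.sq_sqrt (by positivity)
        rw [Finset.sum_const, Finset.card_univ, nsmul_eq_mul, mulConst]
        generalize √(Fintype.card (OrderIndex m) : ℝ) = c at hc ⊢
        rw [← hc]
        ring

/-! ### Density of trigonometric polynomials -/

lemma IsWeakDeriv.of_succ {p : ℕ} {u : ℝ → ℂ} {g h : L2Interval} (hg : IsWeakDeriv p u g)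
    (hh : IsWeakDeriv (p + 1) u h) : IsWeakDeriv 1 g h := by
  intro φ h1 h2 h3
  have e1 := hh φ h1 h2 h3
  have e2 := hg (deriv φ) (h1.deriv' (n := ∞)) h2.deriv (tsupport_deriv_subset.trans h3)
  rw [iteratedDeriv_succ', e2, pow_succ, mul_assoc] at e1
  rw [iteratedDeriv_one, pow_one]
  exact mul_left_cancel₀ (pow_ne_zero p (by norm_num : (-1 : ℂ) ≠ 0)) e1

lemma IsWeakDeriv.of_tendsto_L2 {p : ℕ} {u g : ℕ → L2Interval} {u' g' : L2Interval}
    (h : ∀ n, IsWeakDeriv p (u n) (g n))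
    (hu : Filter.Tendsto u Filter.atTop (nhds u')) (hg : Filter.Tendsto g Filter.atTop (nhds g')) :
    IsWeakDeriv p u' g' := by
  intro φ h1 h2 h3
  have c1 := (continuous_integral_mul_L2 (memLp_of_continuous_hasCompactSupport
    (h1.continuous_iteratedDeriv p (by exact_mod_cast le_top))
    (hasCompactSupport_iteratedDeriv h2 p))).continuousAt.tendsto.comp hu
  have c2 := ((continuous_integral_mul_L2 (memLp_of_continuous_hasCompactSupport h1.continuous
    h2)).continuousAt.tendsto.comp hg).const_mul ((-1 : ℂ) ^ p)
  have c3 := tendsto_nhds_unique c1 (c2.congr fun n => by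
    have := h n φ h1 h2 h3
    simp only [Complex.real_smul] at this
    simp only [Function.comp_apply]
    rw [this])
  simp only [Complex.real_smul]
  rw [c3]

/-- A test function is, up to a multiple of a fixed bump, the derivative of a test function. -/
lemma exists_deriv_eq_sub_smul {ψ χ : ℝ → ℝ} (hψ : ContDiff ℝ ∞ ψ) (hχ : ContDiff ℝ ∞ χ)
    (hψc : HasCompactSupport ψ) (hχc : HasCompactSupport χ)
    (hψs : tsupport ψ ⊆ Ioo (0 : ℝ) 1) (hχs : tsupport χ ⊆ Ioo (0 : ℝ) 1)
    (hχ1 : ∫ t in (0 : ℝ)..1, χ t = 1) (hne : (tsupport χ).Nonempty) :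
    ∃ φ : ℝ → ℝ, ContDiff ℝ ∞ φ ∧ HasCompactSupport φ ∧ tsupport φ ⊆ Ioo (0 : ℝ) 1 ∧
      deriv φ = fun t => ψ t - (∫ s in (0 : ℝ)..1, ψ s) * χ t := by
  set I := ∫ s in (0 : ℝ)..1, ψ s with hI
  set η : ℝ → ℝ := fun t => ψ t - I * χ t with hη
  have hηd : ContDiff ℝ ∞ η := hψ.sub (contDiff_const.mul hχ)
  have hηc : Continuous η := hηd.continuous
  have hder : ∀ t, HasDerivAt (fun t => ∫ s in (0 : ℝ)..t, η s) (η t) t := fun t =>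
    intervalIntegral.integral_hasDerivAt_right (hηc.intervalIntegrable _ _)
      hηc.stronglyMeasurable.stronglyMeasurableAtFilter hηc.continuousAt
  have hde : deriv (fun t => ∫ s in (0 : ℝ)..t, η s) = η := funext fun t => (hder t).deriv
  have hK : IsCompact (tsupport ψ ∪ tsupport χ) := hψc.union hχc
  have hKs : tsupport ψ ∪ tsupport χ ⊆ Ioo (0 : ℝ) 1 := union_subset hψs hχs
  have hKn : (tsupport ψ ∪ tsupport χ).Nonempty := hne.mono subset_union_right
  obtain ⟨a, haK, ha⟩ := hK.exists_isLeast hKn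
  obtain ⟨b, hbK, hb⟩ := hK.exists_isGreatest hKn
  have hz : ∀ s, s ∉ tsupport ψ ∪ tsupport χ → η s = 0 := by
    intro s hs
    rw [mem_union, not_or] at hs
    simp [hη, image_eq_zero_of_notMem_tsupport hs.1, image_eq_zero_of_notMem_tsupport hs.2]
  have hza : ∀ s, s < a → η s = 0 := fun s hs => hz s fun h => absurd (ha h) (not_le.2 hs)
  have hzb : ∀ s, b < s → η s = 0 := fun s hs => hz s fun h => absurd (hb h) (not_le.2 hs)
  have hsupp : Function.support (fun t => ∫ s in (0 : ℝ)..t, η s) ⊆ Icc a b := by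
    intro t ht
    by_contra hn
    refine ht ?_
    rw [mem_Icc, not_and_or, not_le, not_le] at hn
    rcases hn with hn | hn
    · refine (intervalIntegral.integral_congr (g := fun _ => (0 : ℝ)) fun s hs => ?_).trans (by simp)
      exact hza s (lt_of_le_of_lt hs.2 (max_lt (hKs haK).1 hn))
    · have h01 : ∫ s in (0 : ℝ)..1, η s = 0 := by
        simp only [hη]
        rw [intervalIntegral.integral_sub (hψ.continuous.intervalIntegrable _ _)
          ((hχ.continuous.intervalIntegrable _ _).const_mul I),
          intervalIntegral.integral_const_mul, hχ1, ← hI]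
        ring
      have h1t : ∫ s in (1 : ℝ)..t, η s = 0 := by
        refine (intervalIntegral.integral_congr (g := fun _ => (0 : ℝ)) fun s hs => ?_).trans
          (by simp)
        exact hzb s (lt_of_lt_of_le (lt_min (hKs hbK).2 hn) hs.1)
      have := intervalIntegral.integral_add_adjacent_intervals
        (hηc.intervalIntegrable (μ := volume) 0 1) (hηc.intervalIntegrable (μ := volume) 1 t)
      simp only
      rw [← this, h01, h1t, add_zero]
  refine ⟨fun t => ∫ s in (0 : ℝ)..t, η s, ?_, ?_, ?_, hde⟩
  · rw [contDiff_infty_iff_deriv, hde]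
    exact ⟨fun t => (hder t).differentiableAt, hηd⟩
  · exact HasCompactSupport.of_support_subset_isCompact isCompact_Icc hsupp
  · refine (closure_minimal hsupp isClosed_Icc).trans fun t ht => ?_
    exact ⟨lt_of_lt_of_le (hKs haK).1 ht.1, lt_of_le_of_lt ht.2 (hKs hbK).2⟩

/-- The lemma of du Bois-Reymond. -/
lemma IsWeakDeriv.ae_const {y : L2Interval} (h : IsWeakDeriv 1 y 0) :
    ∃ c : ℂ, y =ᵐ[intervalMeasure] fun _ => c := by
  let f : ContDiffBump (1 / 2 : ℝ) := ⟨1 / 8, 1 / 4, by norm_num, by norm_num⟩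
  set χ : ℝ → ℝ := f.normed volume with hχ
  have hs : tsupport χ = Metric.closedBall (1 / 2) (1 / 4) := f.tsupport_normed_eq
  have hsub : tsupport χ ⊆ Ioo (0 : ℝ) 1 := by
    rw [hs, Real.closedBall_eq_Icc]
    exact fun t ht => ⟨by linarith [ht.1], by linarith [ht.2]⟩
  have hc : HasCompactSupport χ := f.hasCompactSupport_normed
  have hd : ContDiff ℝ ∞ χ := f.contDiff_normed
  have h1 : ∫ t in (0 : ℝ)..1, χ t = 1 := by
    rw [intervalIntegral.integral_eq_integral_of_support_subset, f.integral_normed]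
    exact (subset_tsupport χ).trans (hsub.trans Ioo_subset_Ioc_self)
  refine ⟨∫ t, χ t • y t ∂intervalMeasure, ?_⟩
  refine ae_eq_of_integral_test_eq (integrable_L2 y) (integrable_const _) fun ψ p1 p2 p3 => ?_
  obtain ⟨φ, q1, q2, q3, q4⟩ := exists_deriv_eq_sub_smul p1 hd p2 hc p3 hsub h1
    (by rw [hs]; exact ⟨1 / 2, by simp⟩)
  have e := h φ q1 q2 q3
  have e0 : ∫ t, φ t • (0 : L2Interval) t ∂intervalMeasure = 0 := by
    refine integral_eq_zero_of_ae ?_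
    filter_upwards [Lp.coeFn_zero ℂ 2 intervalMeasure] with t ht
    rw [ht]
    simp
  rw [e0, mul_zero, iteratedDeriv_one, q4] at e
  simp only [sub_smul, mul_smul] at e
  rw [integral_sub (integrable_test_smul p1.continuous p2 (integrable_L2 y))
    (g := fun t => (∫ s in (0 : ℝ)..1, ψ s) • χ t • y t)
    ((integrable_test_smul hd.continuous hc (integrable_L2 y)).smul (∫ s in (0 : ℝ)..1, ψ s)),
    integral_smul, sub_eq_zero] at e
  rw [e, integral_smul_const]
  congr 1
  rw [intervalIntegral.integral_of_le zero_le_one, integral_Icc_eq_integral_Ioc]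

open Polynomial in
lemma isWeakDeriv_polyL2 (R : ℂ[X]) : IsWeakDeriv 1 (polyL2 R) (polyL2 (derivative R)) := by
  refine IsWeakDeriv.congr (u := fun t : ℝ => R.eval (t : ℂ)) ?_ (coeFn_polyL2 R).symm
  refine isWeakDeriv_of_hasDerivAt (v := fun i t => (derivative^[i] R).eval (t : ℂ)) (p := 1)
    (fun i _ => (continuous_eval_ofReal _).continuousOn) (fun i _ t _ => ?_) (coeFn_polyL2 _)
  rw [Function.iterate_succ_apply']
  exact hasDerivAt_eval_ofReal _ t

open Polynomial in
lemma norm_polyL2_le_of_eval_zero {R : ℂ[X]} (h0 : R.eval 0 = 0) :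
    ‖polyL2 R‖ ≤ ‖polyL2 (derivative R)‖ := by
  refine L2_norm_le_of_ae (norm_nonneg _) ?_
  filter_upwards [coeFn_polyL2 R, ae_restrict_mem measurableSet_Icc] with t h1 ht
  have hc' := continuous_eval_ofReal (derivative R)
  have e : ∫ r in (0 : ℝ)..t, (derivative R).eval (r : ℂ) = R.eval (t : ℂ) := by
    rw [intervalIntegral.integral_eq_sub_of_hasDerivAt (fun r _ => hasDerivAt_eval_ofReal R r)
        (hc'.intervalIntegrable _ _)]
    simp [h0]
  rw [h1, ← e]
  refine le_trans ?_ (integral_norm_eval_le _)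
  refine (intervalIntegral.norm_integral_le_integral_norm ht.1).trans ?_
  exact intervalIntegral.integral_mono_interval le_rfl ht.1 ht.2
    (Filter.Eventually.of_forall fun _ => norm_nonneg _) (hc'.norm.intervalIntegrable 0 1)

open Polynomial in
lemma exists_derivative_eq (q : ℂ[X]) : ∃ R : ℂ[X], R.eval 0 = 0 ∧ derivative R = q := by
  induction q using Polynomial.induction_on' with
  | add p q hp hq =>
    obtain ⟨R, h1, h2⟩ := hp
    obtain ⟨S, h3, h4⟩ := hq
    exact ⟨R + S, by simp [h1, h3], by simp [h2, h4]⟩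
  | monomial n a =>
    refine ⟨monomial (n + 1) (a / (n + 1)), by simp, ?_⟩
    rw [derivative_monomial]
    have : (n : ℂ) + 1 ≠ 0 := by exact_mod_cast n.succ_ne_zero
    simp [this]

open Polynomial in
lemma denseRange_polyL2 : DenseRange polyL2 := by
  refine Metric.denseRange_iff.2 fun g ε hε => ?_
  obtain ⟨f, hf⟩ := Metric.denseRange_iff.1
    (BoundedContinuousFunction.toLp_denseRange (p := 2) (μ := intervalMeasure) ℂ ℂ
      (by norm_num)) g (ε / 2) (by positivity)
  obtain ⟨P, hP⟩ := exists_polynomial_near_of_continuousOn 0 1 (fun t => (f t).re)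
    (Complex.continuous_re.comp f.continuous).continuousOn (ε / 8) (by positivity)
  obtain ⟨Q, hQ⟩ := exists_polynomial_near_of_continuousOn 0 1 (fun t => (f t).im)
    (Complex.continuous_im.comp f.continuous).continuousOn (ε / 8) (by positivity)
  let q : ℂ[X] := P.map (algebraMap ℝ ℂ) + C Complex.I * Q.map (algebraMap ℝ ℂ)
  have hq : ∀ t : ℝ, q.eval (t : ℂ) = ((P.eval t : ℝ) : ℂ) + Complex.I * ((Q.eval t : ℝ) : ℂ) := by
    intro t
    have h : ∀ P : ℝ[X], (P.map (algebraMap ℝ ℂ)).eval (t : ℂ) = ((P.eval t : ℝ) : ℂ) := by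
      intro P
      rw [eval_map]
      exact eval₂_at_apply (algebraMap ℝ ℂ) t
    simp [q, h]
  refine ⟨q, ?_⟩
  have h2 : ‖BoundedContinuousFunction.toLp 2 intervalMeasure ℂ f - polyL2 q‖ ≤ ε / 4 := by
    refine L2_norm_le_of_ae (by positivity) ?_
    filter_upwards [Lp.coeFn_sub (BoundedContinuousFunction.toLp 2 intervalMeasure ℂ f)
      (polyL2 q), BoundedContinuousFunction.coeFn_toLp (p := 2) (𝕜 := ℂ) intervalMeasure f,
      coeFn_polyL2 q, ae_restrict_mem measurableSet_Icc] with t e1 e2 e3 ht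
    rw [e1, Pi.sub_apply, e2, e3, hq]
    have a1 := hP t ht
    have a2 := hQ t ht
    rw [abs_sub_comm] at a1 a2
    refine (Complex.norm_le_abs_re_add_abs_im _).trans ?_
    simp only [Complex.sub_re, Complex.add_re, Complex.ofReal_re, Complex.mul_re, Complex.I_re,
      zero_mul, Complex.I_im, Complex.ofReal_im, mul_zero, sub_zero, add_zero, Complex.sub_im,
      Complex.add_im, Complex.mul_im, one_mul, zero_add]
    linarith
  calc dist g (polyL2 q) ≤ dist g (BoundedContinuousFunction.toLp 2 intervalMeasure ℂ f)
        + dist (BoundedContinuousFunction.toLp 2 intervalMeasure ℂ f) (polyL2 q) :=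
        dist_triangle _ _ _
    _ < ε := by
        rw [dist_eq_norm (BoundedContinuousFunction.toLp 2 intervalMeasure ℂ f)]
        linarith

open Polynomial in
/-- Primitives of square integrable functions. -/
lemma exists_primitive (g : L2Interval) : ∃ v : L2Interval, IsWeakDeriv 1 v g ∧
    ∀ R : ℂ[X], R.eval 0 = 0 → ‖v - polyL2 R‖ ≤ ‖g - polyL2 (derivative R)‖ := by
  have hr : ∀ n : ℕ, ∃ r : ℂ[X], dist g (polyL2 r) < 1 / ((n : ℝ) + 1) := fun n =>
    Metric.denseRange_iff.1 denseRange_polyL2 g _ (by positivity)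
  choose r hr using hr
  choose R hR0 hRd using fun n => exists_derivative_eq (r n)
  have hlim : Filter.Tendsto (fun n => polyL2 (r n)) Filter.atTop (nhds g) := by
    rw [tendsto_iff_dist_tendsto_zero]
    refine squeeze_zero (fun _ => dist_nonneg) (fun n => ?_)
      tendsto_one_div_add_atTop_nhds_zero_nat
    rw [dist_comm]
    exact (hr n).le
  have hle : ∀ (n : ℕ) (S : ℂ[X]), S.eval 0 = 0 →
      ‖polyL2 (R n) - polyL2 S‖ ≤ ‖polyL2 (r n) - polyL2 (derivative S)‖ := by
    intro n S hS
    rw [← map_sub, ← map_sub, ← hRd n, ← derivative_sub]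
    exact norm_polyL2_le_of_eval_zero (by simp [hR0, hS])
  have hc : CauchySeq fun n => polyL2 (R n) := by
    have h := hlim.cauchySeq
    rw [Metric.cauchySeq_iff] at h ⊢
    intro ε hε
    obtain ⟨N, hN⟩ := h ε hε
    refine ⟨N, fun i hi j hj => ?_⟩
    rw [dist_eq_norm]
    refine (hle i (R j) (hR0 j)).trans_lt ?_
    rw [hRd, ← dist_eq_norm]
    exact hN i hi j hj
  obtain ⟨v, hv⟩ := cauchySeq_tendsto_of_complete hc
  refine ⟨v, IsWeakDeriv.of_tendsto_L2 (fun n => ?_) hv hlim, fun S hS => ?_⟩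
  · rw [← hRd n]
    exact isWeakDeriv_polyL2 (R n)
  · exact le_of_tendsto_of_tendsto' (hv.sub_const _).norm (hlim.sub_const _).norm
      fun n => hle n S hS

open Polynomial in
lemma polyL2_C (c : ℂ) : polyL2 (C c) =ᵐ[intervalMeasure] fun _ => c := by
  filter_upwards [coeFn_polyL2 (C c)] with t ht
  rw [ht, eval_C]

open Polynomial in
lemma IsWeakDeriv.exists_approx {h g : L2Interval} (hg : IsWeakDeriv 1 h g) (q : ℂ[X]) :
    ∃ R : ℂ[X], derivative R = q ∧ ‖h - polyL2 R‖ ≤ ‖g - polyL2 q‖ := by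
  obtain ⟨v, hv, hvle⟩ := exists_primitive g
  have hd : IsWeakDeriv 1 (h - v : L2Interval) 0 := by
    have h1 := hg.add (integrable_L2 h) ((integrable_L2 v).smul (-1 : ℂ)) (hv.smul (-1 : ℂ))
    rw [show g + (-1 : ℂ) • g = 0 by module] at h1
    refine h1.congr ?_
    filter_upwards [Lp.coeFn_sub h v] with t ht
    rw [ht, Pi.sub_apply, Pi.add_apply, Pi.smul_apply, neg_one_smul, ← sub_eq_add_neg]
  obtain ⟨c, hc⟩ := hd.ae_const
  have hc' : h - v = polyL2 (C c) := Lp.ext (hc.trans (polyL2_C c).symm)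
  obtain ⟨R, hR0, hRd⟩ := exists_derivative_eq q
  refine ⟨R + C c, by simp [hRd], ?_⟩
  have e : h - polyL2 (R + C c) = v - polyL2 R := by
    rw [map_add, ← hc']
    abel
  rw [e, ← hRd]
  exact hvle R hR0

open Polynomial in
/-- Polynomials are dense in `Hⁿ(0,1)`. -/
lemma exists_polynomial_approx (n : ℕ) (g : ℕ → L2Interval)
    (hg : ∀ i < n, IsWeakDeriv 1 (g i) (g (i + 1))) {ε : ℝ} (hε : 0 < ε) :
    ∃ q : ℂ[X], ∀ i ≤ n, ‖g i - polyL2 (derivative^[i] q)‖ < ε := by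
  induction n generalizing g with
  | zero =>
    obtain ⟨q, hq⟩ := Metric.denseRange_iff.1 denseRange_polyL2 (g 0) ε hε
    refine ⟨q, fun i hi => ?_⟩
    rw [Nat.le_zero.1 hi, ← dist_eq_norm]
    exact hq
  | succ n ih =>
    obtain ⟨q, hq⟩ := ih (fun i => g (i + 1)) (fun i hi => hg (i + 1) (by omega))
    obtain ⟨R, hR, hle⟩ := (hg 0 (by omega)).exists_approx q
    refine ⟨R, fun i hi => ?_⟩
    cases i with
    | zero => exact hle.trans_lt (hq 0 (Nat.zero_le n))
    | succ i =>
      rw [Function.iterate_succ_apply, hR]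
      exact hq i (by omega)

open Polynomial in
/-- Trigonometric polynomials are dense in `Y`. -/
lemma exists_trigY_approx {σ : ℝ} {m : ℕ} (a : Y σ m) {ε : ℝ} (hε : 0 < ε) :
    ∃ p : TrigPoly, ‖a - trigY σ m p‖ < ε := by
  have hA := Y.hasSum_norm_sq a
  obtain ⟨s, hs⟩ := ((hA.eventually (lt_mem_nhds (show ‖a‖ ^ 2 - ε ^ 2 / 2 < ‖a‖ ^ 2 by
    have := pow_pos hε 2
    linarith)))).exists
  set T : Finset ℤ := s.image Prod.fst with hT
  let P : Finset (ℤ × OrderIndex m) := T ×ˢ Finset.univ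
  let w : ℤ × OrderIndex m → ℝ := fun i => |(i.1 : ℝ)| ^ i.2.1.2 * Real.exp (σ * |(i.1 : ℝ)|)
  have hw : ∀ i, 0 ≤ w i := fun i => by positivity
  set M : ℝ := ∑ i ∈ P, w i ^ 2 + 1 with hM
  have hM1 : 1 ≤ M := le_add_of_nonneg_left (Finset.sum_nonneg fun i _ => sq_nonneg _)
  have hη : 0 < ε / (2 * M) := by positivity
  have hq : ∀ k : ℤ, ∃ q : ℂ[X], ∀ i ≤ m,
      ‖weakDeriv i (partialCoeff (Y.toL2 a) k) - polyL2 (derivative^[i] q)‖ < ε / (2 * M) := by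
    intro k
    refine exists_polynomial_approx m (fun i => weakDeriv i (partialCoeff (Y.toL2 a) k))
      (fun i hi => ?_) hη
    exact (weakDeriv_spec ((Y.memY a).1 k i hi.le)).of_succ
      (weakDeriv_spec ((Y.memY a).1 k (i + 1) hi))
  choose q hq using hq
  let p : TrigPoly := AddMonoidAlgebra.ofCoeff (Finsupp.indicator T fun k _ => q k)
  have hp1 : ∀ k ∈ T, p.coeff k = q k := fun k hk => by
    simp [p, Finsupp.indicator_of_mem hk]
  have hp2 : ∀ k, k ∉ T → p.coeff k = 0 := fun k hk => by
    simp [p, Finsupp.indicator_of_notMem hk]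
  refine ⟨p, ?_⟩
  have hB := Y.hasSum_norm_sq (a - trigY σ m p)
  have hwd : ∀ i, weightedDerivs σ m (Y.toL2 (a - trigY σ m p)) i
      = ((i.1 : ℝ) ^ i.2.1.2 * Real.exp (σ * |(i.1 : ℝ)|)) •
        (weakDeriv i.2.1.1 (partialCoeff (Y.toL2 a) i.1)
          - polyL2 (derivative^[i.2.1.1] (p.coeff i.1))) := by
    intro i
    rw [smul_sub, ← weightedDerivs_trigY]
    change (Y.toSeq (a - trigY σ m p) : ∀ _ : ℤ × OrderIndex m, L2Interval) i = _
    rw [map_sub]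
    rfl
  have hout : ∀ i ∉ P, ‖weightedDerivs σ m (Y.toL2 (a - trigY σ m p)) i‖ ^ 2
      - ‖weightedDerivs σ m (Y.toL2 a) i‖ ^ 2 = 0 := by
    intro i hi
    have : i.1 ∉ T := fun h => hi (Finset.mem_product.2 ⟨h, Finset.mem_univ _⟩)
    rw [hwd, hp2 _ this]
    simp [weightedDerivs]
  have heq := (hB.sub hA).unique (hasSum_sum_of_ne_finset_zero hout)
  rw [Finset.sum_sub_distrib] at heq
  have h1 : ∑ i ∈ s, ‖weightedDerivs σ m (Y.toL2 a) i‖ ^ 2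
      ≤ ∑ i ∈ P, ‖weightedDerivs σ m (Y.toL2 a) i‖ ^ 2 := by
    refine Finset.sum_le_sum_of_subset_of_nonneg (fun i hi => ?_) fun _ _ _ => sq_nonneg _
    exact Finset.mem_product.2 ⟨Finset.mem_image_of_mem _ hi, Finset.mem_univ _⟩
  have h2 : ∑ i ∈ P, ‖weightedDerivs σ m (Y.toL2 (a - trigY σ m p)) i‖ ^ 2 ≤ ε ^ 2 / 4 := by
    calc _ ≤ ∑ i ∈ P, w i ^ 2 * (ε / (2 * M)) ^ 2 := by
          refine Finset.sum_le_sum fun i hi => ?_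
          have hiT : i.1 ∈ T := (Finset.mem_product.1 hi).1
          rw [hwd, norm_smul, mul_pow, hp1 _ hiT]
          refine mul_le_mul (le_of_eq ?_) ?_ (by positivity) (by positivity)
          · simp [w]
          · have := hq i.1 i.2.1.1 (le_trans (Nat.le_add_right _ _) i.2.2)
            gcongr
      _ = (M - 1) * (ε / (2 * M)) ^ 2 := by
          rw [← Finset.sum_mul, hM]
          ring
      _ ≤ M ^ 2 * (ε / (2 * M)) ^ 2 := by
          gcongr
          nlinarith
      _ = ε ^ 2 / 4 := by
          field_simp
          norm_num
  have h3 : ‖a - trigY σ m p‖ ^ 2 < ε ^ 2 := by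
    have := pow_pos hε 2
    linarith
  exact lt_of_pow_lt_pow_left₀ 2 hε.le h3

/-! ### Evaluation and multiplication on `Y_σ^m(Π)` -/

/-- The constant of the sup bound. -/
def supConst : ℝ := 2 * latticeConst

lemma supConst_nonneg : 0 ≤ supConst := mul_nonneg zero_le_two latticeConst_nonneg

lemma exists_seq_trigY {σ : ℝ} {m : ℕ} (a : Y σ m) :
    ∃ p : ℕ → TrigPoly, ∀ n : ℕ, ‖a - trigY σ m (p n)‖ < 1 / ((n : ℝ) + 1) :=
  ⟨fun _ => (exists_trigY_approx a (by positivity)).choose,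
    fun _ => (exists_trigY_approx a (by positivity)).choose_spec⟩

lemma tendsto_trigY {σ : ℝ} {m : ℕ} {a : Y σ m} {p : ℕ → TrigPoly}
    (hp : ∀ n : ℕ, ‖a - trigY σ m (p n)‖ < 1 / ((n : ℝ) + 1)) :
    Filter.Tendsto (fun n => trigY σ m (p n)) Filter.atTop (nhds a) := by
  rw [tendsto_iff_norm_sub_tendsto_zero]
  refine squeeze_zero (fun _ => norm_nonneg _) (fun n => ?_) tendsto_one_div_add_atTop_nhds_zero_nat
  rw [norm_sub_rev]
  exact (hp n).le

/-- Every element of `Y` has a continuation to the complex strip. -/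
lemma exists_isContinuation {σ : ℝ} (hσ : 0 < σ) {m : ℕ} (hm : 1 < m) (a : Y σ m) :
    ∃ A : ℂ → ℝ → ℂ, IsContinuation σ (Y.toL2 a) A ∧
      ∀ z ∈ closedStrip σ, ∀ t ∈ Icc (0 : ℝ) 1, ‖A z t‖ ≤ supConst * ‖a‖ := by
  obtain ⟨p, hp⟩ := exists_seq_trigY a
  have hlim := tendsto_trigY hp
  have hdiff : ∀ n k, ∀ z ∈ closedStrip σ, ∀ t ∈ Icc (0 : ℝ) 1,
      ‖evalTrig z (t : ℂ) (p n) - evalTrig z (t : ℂ) (p k)‖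
        ≤ supConst * ‖trigY σ m (p n) - trigY σ m (p k)‖ := by
    intro n k z hz t ht
    rw [← map_sub, ← trigY_sub hσ.le]
    exact norm_evalTrig_le hm _ hz ht
  have hex : ∀ (z : ℂ) (t : ℝ), ∃ l : ℂ, z ∈ closedStrip σ → t ∈ Icc (0 : ℝ) 1 →
      Filter.Tendsto (fun n => evalTrig z (t : ℂ) (p n)) Filter.atTop (nhds l) := by
    intro z t
    by_cases h : z ∈ closedStrip σ ∧ t ∈ Icc (0 : ℝ) 1
    · have hz0 : Filter.Tendsto (fun n : ℕ × ℕ => supConst *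
          ‖trigY σ m (p n.1) - trigY σ m (p n.2)‖) Filter.atTop (nhds 0) := by
        have h1 := cauchySeq_iff_tendsto_dist_atTop_0.1 hlim.cauchySeq
        simp only [dist_eq_norm] at h1
        simpa using h1.const_mul supConst
      have hc : CauchySeq fun n => evalTrig z (t : ℂ) (p n) := by
        rw [cauchySeq_iff_tendsto_dist_atTop_0]
        refine squeeze_zero (fun _ => dist_nonneg) (fun n => ?_) hz0
        rw [dist_eq_norm]
        exact hdiff n.1 n.2 z h.1 t h.2
      obtain ⟨l, hl⟩ := cauchySeq_tendsto_of_complete hc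
      exact ⟨l, fun _ _ => hl⟩
    · exact ⟨0, fun h1 h2 => absurd ⟨h1, h2⟩ h⟩
  choose A hA' using hex
  have hA : ∀ z ∈ closedStrip σ, ∀ t ∈ Icc (0 : ℝ) 1,
      Filter.Tendsto (fun n => evalTrig z (t : ℂ) (p n)) Filter.atTop (nhds (A z t)) :=
    fun z hz t ht => hA' z t hz ht
  have hunif : ∀ n, ∀ z ∈ closedStrip σ, ∀ t ∈ Icc (0 : ℝ) 1,
      ‖A z t - evalTrig z (t : ℂ) (p n)‖ ≤ supConst * ‖a - trigY σ m (p n)‖ := by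
    intro n z hz t ht
    exact le_of_tendsto_of_tendsto' ((hA z hz t ht).sub_const _).norm
      ((hlim.sub_const _).norm.const_mul supConst) fun k => hdiff k n z hz t ht
  have hto0 : Filter.Tendsto (fun n => supConst * ‖a - trigY σ m (p n)‖) Filter.atTop
      (nhds 0) := by
    simpa using (hlim.const_sub a).norm.const_mul supConst
  have hU : TendstoUniformlyOn (fun n (w : ℂ × ℝ) => evalTrig w.1 (w.2 : ℂ) (p n))
      (fun w => A w.1 w.2) Filter.atTop (closedStrip σ ×ˢ Icc (0 : ℝ) 1) := by
    rw [Metric.tendstoUniformlyOn_iff]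
    intro ε hε
    filter_upwards [hto0.eventually (gt_mem_nhds hε)] with n hn w hw
    rw [dist_eq_norm]
    exact (hunif n w.1 hw.1 w.2 hw.2).trans_lt hn
  refine ⟨A, ⟨?_, ?_, ?_, ?_⟩, ?_⟩
  · intro z hz t ht
    exact tendsto_nhds_unique (hA _ (add_two_pi_mem_closedStrip hz) t ht)
      ((hA z hz t ht).congr fun n => (evalTrig_add_two_pi _ _ _).symm)
  · exact hU.continuousOn (Filter.Frequently.of_forall fun n =>
      (isStripFunction_evalTrig σ (p n)).continuousOn)
  · intro t ht
    have hU' : TendstoUniformlyOn (fun n (z : ℂ) => evalTrig z (t : ℂ) (p n))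
        (fun z => A z t) Filter.atTop (openStrip σ) := by
      rw [Metric.tendstoUniformlyOn_iff]
      intro ε hε
      filter_upwards [hto0.eventually (gt_mem_nhds hε)] with n hn z hz
      rw [dist_eq_norm]
      exact (hunif n z (openStrip_subset_closedStrip σ hz) t ht).trans_lt hn
    exact hU'.tendstoLocallyUniformlyOn.differentiableOn (Filter.Eventually.of_forall fun n =>
      (isStripFunction_evalTrig σ (p n)).holomorphic t ht) (isOpen_openStrip σ)
  · have hL2 : Filter.Tendsto (fun n => Y.toL2 (trigY σ m (p n))) Filter.atTop
        (nhds (Y.toL2 a)) := by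
      rw [tendsto_iff_norm_sub_tendsto_zero] at hlim ⊢
      refine squeeze_zero (fun _ => norm_nonneg _) (fun n => ?_) hlim
      rw [← map_sub]
      exact Y.norm_toL2_le hσ.le _
    obtain ⟨ns, hns, hae⟩ := (tendstoInMeasure_of_tendsto_Lp hL2).exists_seq_tendsto_ae
    have hae' : ∀ᵐ y ∂((volume : Measure ℝ).prod intervalMeasure), Filter.Tendsto
        (fun n => Y.toL2 (trigY σ m (p (ns n))) ((y.1 : Circ), y.2)) Filter.atTop
        (nhds (Y.toL2 a ((y.1 : Circ), y.2))) :=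
      (MeasureTheory.QuasiMeasurePreserving.prodMap quasiMeasurePreserving_coe
        (Measure.QuasiMeasurePreserving.id intervalMeasure)).ae hae
    have hc : ∀ᵐ y ∂((volume : Measure ℝ).prod intervalMeasure), ∀ n,
        Y.toL2 (trigY σ m (p n)) ((y.1 : Circ), y.2) = evalTrig (y.1 : ℂ) (y.2 : ℂ) (p n) :=
      ae_all_iff.2 fun n => (isContinuation_trigY σ m (p n)).ae_eq
    filter_upwards [hae', hc, ae_snd_mem_Icc] with y h1 h2 h3
    simp only [h2] at h1
    exact tendsto_nhds_unique h1
      ((hA y.1 (ofReal_mem_closedStrip hσ.le y.1) y.2 h3).comp hns.tendsto_atTop)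
  · intro z hz t ht
    exact le_of_tendsto_of_tendsto' (hA z hz t ht).norm (hlim.norm.const_mul supConst)
      fun n => norm_evalTrig_le hm _ hz ht

namespace Y

variable {σ : ℝ} {m : ℕ}

open Classical in
/-- The value of the continuation of `a` at `(z, t)`. -/
def ev (a : Y σ m) (z : ℂ) (t : ℝ) : ℂ :=
  if h : ∃ A : ℂ → ℝ → ℂ, IsContinuation σ (toL2 a) A then h.choose z t else 0

lemma isContinuation_ev (hσ : 0 < σ) (hm : 1 < m) (a : Y σ m) :
    IsContinuation σ (toL2 a) (ev a) := by
  have h : ∃ A : ℂ → ℝ → ℂ, IsContinuation σ (toL2 a) A :=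
    (exists_isContinuation hσ hm a).imp fun _ h => h.1
  have e : ev a = h.choose := by
    funext z t
    rw [ev, dif_pos h]
  rw [e]
  exact h.choose_spec

lemma ev_eq (hσ : 0 < σ) (hm : 1 < m) {a : Y σ m} {A : ℂ → ℝ → ℂ}
    (hA : IsContinuation σ (toL2 a) A) {z : ℂ} (hz : z ∈ closedStrip σ) {t : ℝ}
    (ht : t ∈ Icc (0 : ℝ) 1) : ev a z t = A z t :=
  (isContinuation_ev hσ hm a).unique hσ hA hz ht

lemma norm_ev_le (hσ : 0 < σ) (hm : 1 < m) (a : Y σ m) {z : ℂ} (hz : z ∈ closedStrip σ) {t : ℝ}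
    (ht : t ∈ Icc (0 : ℝ) 1) : ‖ev a z t‖ ≤ supConst * ‖a‖ := by
  obtain ⟨A, hA, hle⟩ := exists_isContinuation hσ hm a
  rw [ev_eq hσ hm hA hz ht]
  exact hle z hz t ht

lemma ev_ext (hσ : 0 < σ) (hm : 1 < m) {a b : Y σ m}
    (h : ∀ z ∈ closedStrip σ, ∀ t ∈ Icc (0 : ℝ) 1, ev a z t = ev b z t) : a = b :=
  toL2_injective ((isContinuation_ev hσ hm a).ext hσ.le (isContinuation_ev hσ hm b) h)

/-- Evaluation at a point of the strip as a continuous linear functional. -/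
def evCLM (hσ : 0 < σ) (hm : 1 < m) {z : ℂ} (hz : z ∈ closedStrip σ) {t : ℝ}
    (ht : t ∈ Icc (0 : ℝ) 1) : Y σ m →L[ℂ] ℂ :=
  LinearMap.mkContinuous
    { toFun := fun a => ev a z t
      map_add' := fun a b => by
        refine ev_eq hσ hm (A := fun z t => ev a z t + ev b z t) ?_ hz ht
        rw [map_add]
        exact (isContinuation_ev hσ hm a).add (isContinuation_ev hσ hm b)
      map_smul' := fun c a => by
        refine ev_eq hσ hm (A := fun z t => c * ev a z t) ?_ hz ht
        rw [map_smul]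
        exact (isContinuation_ev hσ hm a).smul c }
    supConst fun a => norm_ev_le hσ hm a hz ht

lemma evCLM_apply (hσ : 0 < σ) (hm : 1 < m) {z : ℂ} (hz : z ∈ closedStrip σ) {t : ℝ}
    (ht : t ∈ Icc (0 : ℝ) 1) (a : Y σ m) : evCLM hσ hm hz ht a = ev a z t := rfl

lemma ev_trigY (hσ : 0 < σ) (hm : 1 < m) (p : TrigPoly) {z : ℂ} (hz : z ∈ closedStrip σ) {t : ℝ}
    (ht : t ∈ Icc (0 : ℝ) 1) : ev (trigY σ m p) z t = evalTrig z (t : ℂ) p :=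
  ev_eq hσ hm (isContinuation_trigY σ m p) hz ht

/-- `Y` is closed under multiplication. -/
lemma exists_mul (hσ : 0 < σ) (hm : 1 < m) (a b : Y σ m) :
    ∃ c : Y σ m, (∀ z ∈ closedStrip σ, ∀ t ∈ Icc (0 : ℝ) 1, ev c z t = ev a z t * ev b z t) ∧
      ‖c‖ ≤ mulConst m * ‖a‖ * ‖b‖ := by
  have := completeSpace (m := m) hσ.le
  obtain ⟨p, hp⟩ := exists_seq_trigY a
  obtain ⟨r, hr⟩ := exists_seq_trigY b
  have hpl := tendsto_trigY hp
  have hrl := tendsto_trigY hr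
  have hmul := norm_trigY_mul_le (σ := σ) hσ.le hm
  have hC := mulConst_nonneg m
  have hdiff : ∀ n k, ‖trigY σ m (p n * r n) - trigY σ m (p k * r k)‖
      ≤ mulConst m * ‖trigY σ m (p n)‖ * ‖trigY σ m (r n) - trigY σ m (r k)‖
        + mulConst m * ‖trigY σ m (p n) - trigY σ m (p k)‖ * ‖trigY σ m (r k)‖ := by
    intro n k
    have e : trigY σ m (p n * r n) - trigY σ m (p k * r k)
        = trigY σ m (p n * (r n - r k)) + trigY σ m ((p n - p k) * r k) := by
      rw [mul_sub, sub_mul, trigY_sub hσ.le, trigY_sub hσ.le]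
      abel
    rw [e, ← trigY_sub hσ.le, ← trigY_sub hσ.le]
    exact (norm_add_le _ _).trans (add_le_add (hmul _ _) (hmul _ _))
  have hc : CauchySeq fun n => trigY σ m (p n * r n) := by
    have h1 := cauchySeq_iff_tendsto_dist_atTop_0.1 hpl.cauchySeq
    have h2 := cauchySeq_iff_tendsto_dist_atTop_0.1 hrl.cauchySeq
    simp only [dist_eq_norm] at h1 h2
    rw [cauchySeq_iff_tendsto_dist_atTop_0]
    have hfst : Filter.Tendsto (Prod.fst : ℕ × ℕ → ℕ) Filter.atTop Filter.atTop := by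
      rw [← Filter.prod_atTop_atTop_eq]
      exact Filter.tendsto_fst
    have hsnd : Filter.Tendsto (Prod.snd : ℕ × ℕ → ℕ) Filter.atTop Filter.atTop := by
      rw [← Filter.prod_atTop_atTop_eq]
      exact Filter.tendsto_snd
    have h3 := (((hpl.norm.comp hfst).const_mul (mulConst m)).mul h2).add
      ((h1.const_mul (mulConst m)).mul (hrl.norm.comp hsnd))
    simp only [mul_zero, zero_mul, add_zero] at h3
    refine squeeze_zero (fun _ => dist_nonneg) (fun n => ?_) h3
    rw [dist_eq_norm]
    exact hdiff n.1 n.2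
  obtain ⟨c, hcl⟩ := cauchySeq_tendsto_of_complete hc
  refine ⟨c, fun z hz t ht => ?_, ?_⟩
  · have e1 := ((evCLM hσ hm hz ht).continuous.tendsto c).comp hcl
    have e2 := (((evCLM hσ hm hz ht).continuous.tendsto a).comp hpl).mul
      (((evCLM hσ hm hz ht).continuous.tendsto b).comp hrl)
    refine tendsto_nhds_unique e1 (e2.congr fun n => ?_)
    simp only [Function.comp_apply, evCLM_apply, ev_trigY hσ hm _ hz ht, map_mul]
  · exact le_of_tendsto_of_tendsto' hcl.norm ((hpl.norm.const_mul (mulConst m)).mul hrl.norm)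
      fun n => hmul _ _

/-- Multiplication on `Y`. -/
def mulY (hσ : 0 < σ) (hm : 1 < m) : Y σ m →L[ℂ] Y σ m →L[ℂ] Y σ m :=
  LinearMap.mkContinuous₂
    (LinearMap.mk₂ ℂ (fun a b => (exists_mul hσ hm a b).choose)
      (fun a a' b => ev_ext hσ hm fun z hz t ht => by
        rw [← evCLM_apply hσ hm hz ht (_ + _), map_add]
        simp only [evCLM_apply]
        rw [(exists_mul hσ hm _ _).choose_spec.1 z hz t ht,
          (exists_mul hσ hm _ _).choose_spec.1 z hz t ht,
          (exists_mul hσ hm _ _).choose_spec.1 z hz t ht,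
          ← evCLM_apply hσ hm hz ht (_ + _), map_add]
        simp only [evCLM_apply, add_mul])
      (fun c a b => ev_ext hσ hm fun z hz t ht => by
        rw [← evCLM_apply hσ hm hz ht (_ • _), map_smul]
        simp only [evCLM_apply]
        rw [(exists_mul hσ hm _ _).choose_spec.1 z hz t ht,
          (exists_mul hσ hm _ _).choose_spec.1 z hz t ht,
          ← evCLM_apply hσ hm hz ht (_ • _), map_smul]
        simp only [evCLM_apply, smul_eq_mul, mul_assoc])
      (fun a b b' => ev_ext hσ hm fun z hz t ht => by
        rw [← evCLM_apply hσ hm hz ht (_ + _), map_add]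
        simp only [evCLM_apply]
        rw [(exists_mul hσ hm _ _).choose_spec.1 z hz t ht,
          (exists_mul hσ hm _ _).choose_spec.1 z hz t ht,
          (exists_mul hσ hm _ _).choose_spec.1 z hz t ht,
          ← evCLM_apply hσ hm hz ht (_ + _), map_add]
        simp only [evCLM_apply, mul_add])
      (fun c a b => ev_ext hσ hm fun z hz t ht => by
        rw [← evCLM_apply hσ hm hz ht (_ • _), map_smul]
        simp only [evCLM_apply]
        rw [(exists_mul hσ hm _ _).choose_spec.1 z hz t ht,
          (exists_mul hσ hm _ _).choose_spec.1 z hz t ht,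
          ← evCLM_apply hσ hm hz ht (_ • _), map_smul]
        simp only [evCLM_apply, smul_eq_mul, mul_left_comm]))
    (mulConst m) fun a b => (exists_mul hσ hm a b).choose_spec.2

lemma ev_mulY (hσ : 0 < σ) (hm : 1 < m) (a b : Y σ m) {z : ℂ} (hz : z ∈ closedStrip σ) {t : ℝ}
    (ht : t ∈ Icc (0 : ℝ) 1) : ev (mulY hσ hm a b) z t = ev a z t * ev b z t :=
  (exists_mul hσ hm a b).choose_spec.1 z hz t ht

end Y

/-! ### Functions holomorphic near the strip -/

/-- The complex `ε`-neighbourhood of `[0,1]`. -/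
def intervalNhd (ε : ℝ) : Set ℂ := Metric.thickening ε ((fun t : ℝ => (t : ℂ)) '' Icc (0 : ℝ) 1)

/-- A complex neighbourhood of the closed strip times `[0,1]`. -/
def tube (σ ε : ℝ) : Set (ℂ × ℂ) := openStrip (σ + ε) ×ˢ intervalNhd ε

lemma isOpen_intervalNhd (ε : ℝ) : IsOpen (intervalNhd ε) := Metric.isOpen_thickening

lemma closedBall_subset_intervalNhd {ε r : ℝ} (hr : r < ε) {t : ℝ} (ht : t ∈ Icc (0 : ℝ) 1) :
    Metric.closedBall (t : ℂ) r ⊆ intervalNhd ε := by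
  intro w hw
  exact Metric.mem_thickening_iff.2 ⟨t, ⟨t, ht, rfl⟩, (Metric.mem_closedBall.1 hw).trans_lt hr⟩

lemma ofReal_mem_intervalNhd {ε : ℝ} (hε : 0 < ε) {t : ℝ} (ht : t ∈ Icc (0 : ℝ) 1) :
    (t : ℂ) ∈ intervalNhd ε :=
  closedBall_subset_intervalNhd hε ht (by simp)

lemma analyticOnNhd_evalTrig (p : TrigPoly) :
    AnalyticOnNhd ℂ (fun w : ℂ × ℂ => evalTrig w.1 w.2 p) univ := by
  intro w _
  simp only [evalTrig_apply]
  refine Finset.analyticAt_fun_sum _ fun k _ => AnalyticAt.mul ?_ ?_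
  · exact ((p.coeff k).differentiable.analyticAt w.2).comp analyticAt_snd
  · exact (analyticAt_const.mul analyticAt_fst).cexp

/-- The Fourier coefficients of a function holomorphic in a strip decay exponentially. -/
lemma norm_integral_exp_mul_le {g : ℂ → ℂ} {s M r : ℝ} (hg : DifferentiableOn ℂ g (openStrip s))
    (hper : ∀ z, g (z + 2 * Real.pi) = g z) (hM : ∀ z ∈ openStrip s, ‖g z‖ ≤ M) (hr : 0 ≤ r)
    (hrs : r < s) (k : ℤ) :
    ‖∫ x in (0 : ℝ)..2 * Real.pi, Complex.exp (-(Complex.I * k * x)) * g x‖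
      ≤ M * Real.exp (-(r * |(k : ℝ)|)) * (2 * Real.pi) := by
  obtain ⟨c, hc, hkc⟩ : ∃ c : ℝ, |c| = r ∧ k * c = -(r * |(k : ℝ)|) := by
    rcases le_total 0 (k : ℝ) with h | h
    · exact ⟨-r, by rw [abs_neg, abs_of_nonneg hr], by rw [abs_of_nonneg h]; ring⟩
    · exact ⟨r, abs_of_nonneg hr, by rw [abs_of_nonpos h]; ring⟩
  set h : ℂ → ℂ := fun z => Complex.exp (-(Complex.I * k * z)) * g z with hh
  have hd : DifferentiableOn ℂ h (openStrip s) := by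
    refine DifferentiableOn.mul ?_ hg
    fun_prop
  have hhper : ∀ z, h (z + 2 * Real.pi) = h z := by
    intro z
    simp only [hh, hper]
    congr 1
    rw [Complex.exp_eq_exp_iff_exists_int]
    exact ⟨-k, by push_cast; ring⟩
  have hmem : ∀ x : ℝ, (x : ℂ) + c * Complex.I ∈ openStrip s := by
    intro x
    simpa [openStrip, hc] using hrs
  have hrect := Complex.integral_boundary_rect_eq_zero_of_differentiableOn h 0
    (2 * Real.pi + c * Complex.I) (hd.mono (by
      intro z hz
      have h2 := (Complex.mem_reProdIm.1 hz).2
      simp only [Complex.zero_im, Complex.add_im, Complex.mul_im, Complex.re_ofNat,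
        Complex.ofReal_im, mul_zero, Complex.im_ofNat, Complex.ofReal_re, zero_mul, add_zero,
        Complex.I_im, mul_one, Complex.I_re, zero_add] at h2
      have h3 := abs_sub_left_of_mem_uIcc h2
      simp only [sub_zero] at h3
      exact (h3.trans hc.le).trans_lt hrs))
  simp only [Complex.zero_im, Complex.add_im, Complex.mul_im, Complex.re_ofNat,
    Complex.ofReal_im, mul_zero, Complex.im_ofNat, Complex.ofReal_re, zero_mul, add_zero,
    Complex.I_im, mul_one, Complex.I_re, zero_add, Complex.zero_re, Complex.add_re, Complex.mul_re,
    sub_zero, Complex.ofReal_zero, sub_self] at hrect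
  have hv : ∀ y : ℝ, h (((2 * Real.pi : ℝ) : ℂ) + y * Complex.I) = h (y * Complex.I) := by
    intro y
    rw [← hhper (y * Complex.I)]
    congr 1
    push_cast
    ring
  simp only [hv] at hrect
  have e : ∫ x in (0 : ℝ)..2 * Real.pi, h x = ∫ x in (0 : ℝ)..2 * Real.pi, h (x + c * Complex.I) := by
    rw [← sub_eq_zero]
    simpa using hrect
  rw [e]
  have hb : ∀ x ∈ Set.uIoc (0 : ℝ) (2 * Real.pi), ‖h (x + c * Complex.I)‖
      ≤ M * Real.exp (-(r * |(k : ℝ)|)) := by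
    intro x _
    rw [hh]
    simp only [norm_mul, Complex.norm_exp]
    have e2 : (-(Complex.I * k * ((x : ℂ) + c * Complex.I))).re = -(r * |(k : ℝ)|) := by
      simp [hkc]
    rw [e2, mul_comm]
    exact mul_le_mul_of_nonneg_right (hM _ (hmem x)) (Real.exp_pos _).le
  have := intervalIntegral.norm_integral_le_of_norm_le_const hb
  rwa [sub_zero, abs_of_pos Real.two_pi_pos] at this

/-- The Fourier coefficients in the first variable of a function on the tube. -/
def tubeCoeff (G : ℂ × ℂ → ℂ) (k : ℤ) (w : ℂ) : ℂ :=
  (1 / (2 * Real.pi) : ℝ) • ∫ x in (0 : ℝ)..2 * Real.pi, Complex.exp (-(Complex.I * k * x)) * G (x, w)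

lemma mem_tube_ofReal {σ ε : ℝ} (hσ : 0 < σ) (hε : 0 < ε) {w : ℂ} (hw : w ∈ intervalNhd ε) (x : ℝ) :
    ((x : ℂ), w) ∈ tube σ ε :=
  ⟨by simpa [openStrip] using add_pos hσ hε, hw⟩

section

variable {σ ε : ℝ} (hσ : 0 < σ) (hε : 0 < ε) {G : ℂ × ℂ → ℂ} (hG : AnalyticOnNhd ℂ G (tube σ ε))

include hσ hε hG

lemma differentiableOn_tubeCoeff (k : ℤ) :
    DifferentiableOn ℂ (tubeCoeff G k) (intervalNhd ε) := by
  intro w₀ hw₀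
  obtain ⟨r, hr, hball⟩ := Metric.nhds_basis_closedBall.mem_iff.1
    ((isOpen_intervalNhd ε).mem_nhds hw₀)
  have hmem : ∀ x : ℝ, ∀ w ∈ Metric.closedBall w₀ r, ((x : ℂ), w) ∈ tube σ ε :=
    fun x w hw => mem_tube_ofReal hσ hε (hball hw) x
  have hgc : ∀ w ∈ Metric.closedBall w₀ r,
      Continuous fun x : ℝ => Complex.exp (-(Complex.I * k * x)) * G (x, w) := by
    intro w hw
    refine Continuous.mul (by fun_prop) ?_
    exact hG.continuousOn.comp_continuous (by fun_prop) fun x => hmem x w hw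
  set D : ℂ → ℝ → ℂ := fun w x =>
    Complex.exp (-(Complex.I * k * x)) * fderiv ℂ G ((x : ℂ), w) (0, 1) with hD
  have hDc : ContinuousOn (fun y : ℝ × ℂ => D y.2 y.1) (univ ×ˢ Metric.closedBall w₀ r) := by
    refine ContinuousOn.mul (by fun_prop) ?_
    refine ContinuousOn.clm_apply ?_ continuousOn_const
    refine hG.fderiv.continuousOn.comp (by fun_prop) ?_
    intro y hy
    exact hmem y.1 y.2 hy.2
  obtain ⟨C, hC⟩ := (isCompact_uIcc (a := (0 : ℝ)) (b := 2 * Real.pi)).prod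
    (isCompact_closedBall w₀ r) |>.exists_bound_of_continuousOn
    (hDc.mono (prod_mono_left (subset_univ _)))
  have hw₀r : w₀ ∈ Metric.closedBall w₀ r := Metric.mem_closedBall_self hr.le
  have key := intervalIntegral.hasDerivAt_integral_of_dominated_loc_of_deriv_le (μ := volume)
    (a := (0 : ℝ)) (b := 2 * Real.pi) (bound := fun _ => C) (F' := D) (x₀ := w₀)
    (F := fun w (x : ℝ) => Complex.exp (-(Complex.I * k * x)) * G (x, w))
    (Metric.closedBall_mem_nhds w₀ hr)
    (by
      filter_upwards [Metric.closedBall_mem_nhds w₀ hr] with w hw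
      exact (hgc w hw).aestronglyMeasurable)
    ((hgc w₀ hw₀r).intervalIntegrable _ _)
    (by
      have : Continuous (D w₀) := continuousOn_univ.1 (hDc.comp
        (f := fun x : ℝ => (x, w₀)) (by fun_prop) fun x _ => ⟨trivial, hw₀r⟩)
      exact this.aestronglyMeasurable)
    (Filter.Eventually.of_forall fun x hx w hw => hC (x, w) ⟨uIoc_subset_uIcc hx, hw⟩)
    intervalIntegrable_const
    (Filter.Eventually.of_forall fun x _ w hw => by
      have h1 : HasFDerivAt G (fderiv ℂ G ((x : ℂ), w)) ((x : ℂ), w) :=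
        (hG _ (hmem x w hw)).differentiableAt.hasFDerivAt
      have h2 : HasDerivAt (fun w : ℂ => ((x : ℂ), w)) (0, 1) w :=
        (hasDerivAt_const w (x : ℂ)).prodMk (hasDerivAt_id w)
      exact (h1.comp_hasDerivAt w h2).const_mul _)
  exact (key.2.const_smul (1 / (2 * Real.pi) : ℝ)).differentiableAt.differentiableWithinAt

lemma norm_tubeCoeff_le (hper : ∀ z w, G (z + 2 * Real.pi, w) = G (z, w)) {M : ℝ}
    (hM : ∀ y ∈ tube σ ε, ‖G y‖ ≤ M) (k : ℤ) {w : ℂ} (hw : w ∈ intervalNhd ε) :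
    ‖tubeCoeff G k w‖ ≤ M * Real.exp (-((σ + ε / 2) * |(k : ℝ)|)) := by
  have h := norm_integral_exp_mul_le (g := fun z => G (z, w)) (s := σ + ε) (M := M) (r := σ + ε / 2)
    (fun z hz => ((hG (z, w) ⟨hz, hw⟩).differentiableAt.comp z
      (differentiableAt_id.prodMk (differentiableAt_const w))).differentiableWithinAt)
    (fun z => hper z w) (fun z hz => hM _ ⟨hz, hw⟩) (by positivity) (by linarith) k
  rw [tubeCoeff, norm_smul, Real.norm_of_nonneg (by positivity)]
  calc 1 / (2 * Real.pi) * _ ≤ 1 / (2 * Real.pi) * (M * Real.exp (-((σ + ε / 2) * |(k : ℝ)|))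
        * (2 * Real.pi)) := mul_le_mul_of_nonneg_left h (by positivity)
    _ = _ := by field_simp

lemma norm_iteratedDeriv_tubeCoeff_le (hper : ∀ z w, G (z + 2 * Real.pi, w) = G (z, w)) {M : ℝ}
    (hM : ∀ y ∈ tube σ ε, ‖G y‖ ≤ M) (k : ℤ) (i : ℕ) {t : ℝ} (ht : t ∈ Icc (0 : ℝ) 1) :
    ‖iteratedDeriv i (tubeCoeff G k) t‖
      ≤ i.factorial * (M * Real.exp (-((σ + ε / 2) * |(k : ℝ)|))) / (ε / 2) ^ i := by
  have hsub := closedBall_subset_intervalNhd (half_lt_self hε) ht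
  refine Complex.norm_iteratedDeriv_le_of_forall_mem_sphere_norm_le i (half_pos hε) ?_ ?_
  · exact ((differentiableOn_tubeCoeff hσ hε hG k).mono hsub).diffContOnCl_ball subset_rfl
  · exact fun w hw => norm_tubeCoeff_le hσ hε hG hper hM k (hsub (Metric.sphere_subset_closedBall hw))

lemma hasDerivAt_iteratedDeriv_tubeCoeff (k : ℤ) (i : ℕ) {t : ℝ} (ht : t ∈ Icc (0 : ℝ) 1) :
    HasDerivAt (fun s : ℝ => iteratedDeriv i (tubeCoeff G k) s)
      (iteratedDeriv (i + 1) (tubeCoeff G k) t) t := by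
  have h := (((differentiableOn_tubeCoeff hσ hε hG k).analyticOnNhd (isOpen_intervalNhd ε)) t
    (ofReal_mem_intervalNhd hε ht)).iterated_deriv i
  rw [← iteratedDeriv_eq_iterate] at h
  rw [iteratedDeriv_succ]
  exact h.differentiableAt.hasDerivAt.comp_ofReal

end

lemma summable_pow_mul_exp_neg_abs (n : ℕ) {r : ℝ} (hr : 0 < r) :
    Summable fun k : ℤ => |(k : ℝ)| ^ n * Real.exp (-(r * |(k : ℝ)|)) := by
  have h := Real.summable_pow_mul_exp_neg_nat_mul n hr
  refine Summable.of_nat_of_neg ?_ ?_ <;> simpa using h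

/-- The bound for the weighted derivatives of a function holomorphic and bounded by `1` on
the tube. -/
def tubeWeight (ε : ℝ) (p q : ℕ) (k : ℤ) : ℝ :=
  |(k : ℝ)| ^ q * Real.exp (-(ε / 2 * |(k : ℝ)|)) * (p.factorial / (ε / 2) ^ p)

lemma summable_tubeWeight_sq {ε : ℝ} (hε : 0 < ε) (m : ℕ) :
    Summable fun i : ℤ × OrderIndex m => tubeWeight ε i.2.1.1 i.2.1.2 i.1 ^ 2 := by
  rw [summable_prod_of_nonneg fun _ => sq_nonneg _]
  refine ⟨fun _ => Summable.of_finite, ?_⟩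
  simp only [tsum_fintype]
  refine summable_sum fun o _ => ?_
  refine ((summable_pow_mul_exp_neg_abs (o.1.2 * 2) hε).mul_right
    ((o.1.1.factorial / (ε / 2) ^ o.1.1) ^ 2)).congr fun k => ?_
  rw [tubeWeight, mul_pow, mul_pow, ← pow_mul, ← Real.exp_nat_mul]
  congr 3
  push_cast
  ring

/-- The norm bound for elements of `Y` holomorphic near the strip. -/
def tubeConst (ε : ℝ) (m : ℕ) : ℝ :=
  √(∑' i : ℤ × OrderIndex m, tubeWeight ε i.2.1.1 i.2.1.2 i.1 ^ 2)

/-- A continuous function on the line times `[0,1]`, periodic in the first variable, extends to a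
continuous function on the circle times the line. -/
lemma exists_continuous_circle {H : ℝ × ℝ → ℂ} (hH : ContinuousOn H (univ ×ˢ Icc (0 : ℝ) 1))
    (hper : ∀ x, ∀ t ∈ Icc (0 : ℝ) 1, H (x + 2 * Real.pi, t) = H (x, t)) :
    ∃ g : Circ × ℝ → ℂ, Continuous g ∧ ∀ x : ℝ, ∀ t ∈ Icc (0 : ℝ) 1, g ((x : Circ), t) = H (x, t) := by
  let c : ℝ → ℝ := fun t => projIcc (0 : ℝ) 1 zero_le_one t
  have hc : Continuous c := continuous_subtype_val.comp continuous_projIcc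
  have hcm : ∀ t, c t ∈ Icc (0 : ℝ) 1 := fun t => (projIcc (0 : ℝ) 1 zero_le_one t).2
  have hp : ∀ t, Function.Periodic (fun x => H (x, c t)) (2 * Real.pi) :=
    fun t x => hper x _ (hcm t)
  refine ⟨fun y => (hp y.2).lift y.1, ?_, fun x t ht => ?_⟩
  · have hq : Topology.IsQuotientMap (Prod.map ((↑) : ℝ → Circ) (id : ℝ → ℝ)) :=
      (QuotientAddGroup.isOpenQuotientMap_mk.prodMap IsOpenQuotientMap.id).isQuotientMap
    rw [hq.continuous_iff]
    exact hH.comp_continuous (f := fun y : ℝ × ℝ => (y.1, c y.2)) (by fun_prop)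
      fun y => ⟨trivial, hcm y.2⟩
  · have : c t = t := congrArg Subtype.val (projIcc_of_mem zero_le_one ht)
    change H (x, c t) = H (x, t)
    rw [this]

/-- A periodic function, holomorphic and bounded by `M` on the tube, defines an element of `Y`
whose norm is at most a constant times `M`. -/
lemma exists_isContinuation_of_tube {σ ε : ℝ} (hσ : 0 < σ) (hε : 0 < ε) (m : ℕ)
    {G : ℂ × ℂ → ℂ} (hG : AnalyticOnNhd ℂ G (tube σ ε))
    (hper : ∀ z w, G (z + 2 * Real.pi, w) = G (z, w)) {M : ℝ} (hM0 : 0 ≤ M)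
    (hM : ∀ y ∈ tube σ ε, ‖G y‖ ≤ M) :
    ∃ c : Y σ m, IsContinuation σ (Y.toL2 c) (fun z t => G (z, (t : ℂ))) ∧
      ‖c‖ ≤ tubeConst ε m * M := by
  have hmem : ∀ z ∈ closedStrip σ, ∀ t ∈ Icc (0 : ℝ) 1, (z, (t : ℂ)) ∈ tube σ ε := by
    intro z hz t ht
    exact ⟨(show |z.im| ≤ σ from hz).trans_lt (lt_add_of_pos_right σ hε),
      ofReal_mem_intervalNhd hε ht⟩
  have hA : IsStripFunction σ (fun z t => G (z, (t : ℂ))) := by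
    refine ⟨fun z _ t _ => hper z t, ?_, ?_⟩
    · exact hG.continuousOn.comp (f := fun w : ℂ × ℝ => (w.1, (w.2 : ℂ))) (by fun_prop)
        fun w hw => hmem w.1 hw.1 w.2 hw.2
    · intro t ht z hz
      exact ((hG _ (hmem z (openStrip_subset_closedStrip σ hz) t ht)).differentiableAt.comp z
        (differentiableAt_id.prodMk (differentiableAt_const (t : ℂ)))).differentiableWithinAt
  obtain ⟨g, hg, hgA⟩ := exists_continuous_circle (H := fun y => G ((y.1 : ℂ), (y.2 : ℂ)))
    (hG.continuousOn.comp (f := fun y : ℝ × ℝ => ((y.1 : ℂ), (y.2 : ℂ))) (by fun_prop)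
        fun y hy => hmem _ (ofReal_mem_closedStrip hσ.le _) _ hy.2)
    (fun x t _ => by
      rw [← hper x t]
      push_cast
      rfl)
  have hder := fun k i t ht => hasDerivAt_iteratedDeriv_tubeCoeff hσ hε hG k i (t := t) ht
  have hcont : ∀ k i, ContinuousOn (fun t : ℝ => iteratedDeriv i (tubeCoeff G k) (t : ℂ))
      (Icc 0 1) := fun k i t ht => (hder k i t ht).continuousAt.continuousWithinAt
  let d : ℤ → ℕ → L2Interval := fun k i => (memLp_of_continuousOn (hcont k i)).toLp _
  have hdn : ∀ k i, ‖d k i‖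
      ≤ i.factorial * (M * Real.exp (-((σ + ε / 2) * |(k : ℝ)|))) / (ε / 2) ^ i := by
    intro k i
    refine L2_norm_le_of_ae (by positivity) ?_
    filter_upwards [(memLp_of_continuousOn (hcont k i)).coeFn_toLp,
      ae_restrict_mem measurableSet_Icc] with t h1 h2
    rw [h1]
    exact norm_iteratedDeriv_tubeCoeff_le hσ hε hG hper hM k i h2
  have hle : ∀ i : ℤ × OrderIndex m,
      ((|(i.1 : ℝ)| ^ i.2.1.2 * Real.exp (σ * |(i.1 : ℝ)|)) * ‖d i.1 i.2.1.1‖) ^ 2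
        ≤ tubeWeight ε i.2.1.1 i.2.1.2 i.1 ^ 2 * M ^ 2 := by
    intro i
    rw [← mul_pow]
    refine pow_le_pow_left₀ (by positivity) ?_ 2
    refine (mul_le_mul_of_nonneg_left (hdn i.1 i.2.1.1) (by positivity)).trans_eq ?_
    have e : Real.exp (-(ε / 2 * |(i.1 : ℝ)|))
        = Real.exp (σ * |(i.1 : ℝ)|) * Real.exp (-((σ + ε / 2) * |(i.1 : ℝ)|)) := by
      rw [← Real.exp_add]
      congr 1
      ring
    rw [tubeWeight, e]
    ring
  have hsum := (summable_tubeWeight_sq hε m).mul_right (M ^ 2)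
  obtain ⟨c, hc, hcd⟩ := exists_isContinuation_of_smooth hA hg hgA (m := m) (d := d)
    (fun k i _ => hcont k i) (fun k i _ t ht => hder k i t (Ioo_subset_Icc_self ht)) (by
      intro k t ht
      rw [partialCoeff, fourierCoeff_eq_intervalIntegral _ k 0, zero_add, iteratedDeriv_zero,
        tubeCoeff]
      congr 1
      refine intervalIntegral.integral_congr fun x _ => ?_
      simp only [fourier_eq_exp, hgA x t ht, smul_eq_mul]
      congr 2
      push_cast
      ring)
    (fun k i _ => (memLp_of_continuousOn (hcont k i)).coeFn_toLp)
    (Summable.of_nonneg_of_le (fun _ => sq_nonneg _) hle hsum)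
  refine ⟨c, hc, ?_⟩
  have hn := Y.hasSum_norm_sq c
  have h1 : ‖c‖ ^ 2 ≤ (∑' i : ℤ × OrderIndex m, tubeWeight ε i.2.1.1 i.2.1.2 i.1 ^ 2) * M ^ 2 := by
    rw [← tsum_mul_right]
    refine hasSum_le (fun i => ?_) hn hsum.hasSum
    rw [hcd, norm_smul]
    simpa using hle i
  refine le_of_sq_le_sq ?_ (mul_nonneg (Real.sqrt_nonneg _) hM0)
  rw [mul_pow, tubeConst, Real.sq_sqrt (tsum_nonneg fun _ => sq_nonneg _)]
  exact h1

/-! ### Composition with an analytic function -/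

section PowerSeries

variable {E : Type*} [NormedAddCommGroup E] [NormedSpace ℂ E]

/-- The power series `∑ (L h)^n g_n` in `h`. -/
def powSeries (L : E →L[ℂ] E →L[ℂ] E) (g : ℕ → E) : FormalMultilinearSeries ℂ E E := fun n =>
  (ContinuousLinearMap.apply ℂ E (g n)).compContinuousMultilinearMap
    ((ContinuousMultilinearMap.mkPiAlgebraFin ℂ n (E →L[ℂ] E)).compContinuousLinearMap fun _ => L)

lemma powSeries_apply (L : E →L[ℂ] E →L[ℂ] E) (g : ℕ → E) (n : ℕ) (h : E) :
    powSeries L g n (fun _ => h) = ((L h) ^ n) (g n) := by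
  simp [powSeries]

lemma norm_powSeries_le (L : E →L[ℂ] E →L[ℂ] E) (g : ℕ → E) (n : ℕ) :
    ‖powSeries L g n‖ ≤ ‖g n‖ * ‖L‖ ^ n := by
  refine ContinuousMultilinearMap.opNorm_le_bound (by positivity) fun v => ?_
  have h1 : powSeries L g n v = (List.ofFn fun i => L (v i)).prod (g n) := by
    simp [powSeries]
  have h2 : ∀ l : List E, ‖(l.map L).prod (g n)‖ ≤ ‖g n‖ * ‖L‖ ^ l.length * (l.map norm).prod := by
    intro l
    induction l with
    | nil => simp
    | cons x l ih =>
      simp only [List.map_cons, List.prod_cons, mul_apply_eq_comp, List.length_cons]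
      refine (ContinuousLinearMap.le_opNorm₂ _ _ _).trans ?_
      refine (mul_le_mul_of_nonneg_left ih (by positivity)).trans_eq ?_
      ring
  have h3 := h2 (List.ofFn v)
  rw [List.map_ofFn, List.map_ofFn, List.length_ofFn, List.prod_ofFn] at h3
  rw [h1]
  exact h3

lemma hasFPowerSeriesOnBall_powSeries [CompleteSpace E] {L : E →L[ℂ] E →L[ℂ] E} {g : ℕ → E}
    {r : NNReal} (hr : 0 < r) {C : ℝ} (hC : ∀ n, ‖g n‖ * (‖L‖ * r) ^ n ≤ C) {F : E → E} {x : E}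
    (hF : ∀ h, ‖h‖ < r → ∀ s, HasSum (fun n => ((L h) ^ n) (g n)) s → F (x + h) = s) :
    HasFPowerSeriesOnBall F (powSeries L g) x r := by
  have hrad : (r : ℝ≥0∞) ≤ (powSeries L g).radius := by
    refine FormalMultilinearSeries.le_radius_of_bound _ C fun n => ?_
    refine le_trans ?_ (hC n)
    rw [mul_pow, ← mul_assoc]
    exact mul_le_mul_of_nonneg_right (norm_powSeries_le L g n) (by positivity)
  refine ⟨hrad, by exact_mod_cast hr, fun {y} hy => ?_⟩
  have hs := (powSeries L g).hasSum (Metric.eball_subset_eball hrad hy)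
  have hy' : ‖y‖ < r := by simpa using hy
  simp only [powSeries_apply] at hs ⊢
  rw [hF y hy' _ hs]
  exact hs

end PowerSeries

/-- A period of the closed strip. -/
def stripBox (σ : ℝ) : Set ℂ := Icc 0 (2 * Real.pi) ×ℂ Icc (-σ) σ

lemma isCompact_stripBox (σ : ℝ) : IsCompact (stripBox σ) := isCompact_Icc.reProdIm isCompact_Icc

lemma stripBox_subset (σ : ℝ) : stripBox σ ⊆ closedStrip σ := fun _ hz => abs_le.2 hz.2

lemma exists_mem_Icc_add_mul_I {A : ℂ → ℂ} (z : ℂ)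
    (hA : ∀ x : ℝ, A (x + z.im * Complex.I + 2 * Real.pi) = A (x + z.im * Complex.I)) :
    ∃ x ∈ Icc 0 (2 * Real.pi), A z = A (x + z.im * Complex.I) := by
  have hp : Function.Periodic (fun x : ℝ => A (x + z.im * Complex.I)) (2 * Real.pi) := by
    intro x
    change A _ = A _
    rw [← hA x]
    congr 1
    push_cast
    ring
  obtain ⟨x, hx, he⟩ := hp.exists_mem_Ico₀ Real.two_pi_pos z.re
  refine ⟨x, Ico_subset_Icc_self hx, ?_⟩
  rw [← he, Complex.re_add_im]

lemma IsStripFunction.exists_stripBox {σ : ℝ} {A : ℂ → ℝ → ℂ} (hA : IsStripFunction σ A) {z : ℂ}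
    (hz : z ∈ closedStrip σ) {t : ℝ} (ht : t ∈ Icc (0 : ℝ) 1) : ∃ z' ∈ stripBox σ, A z t = A z' t := by
  obtain ⟨x, hx, he⟩ := exists_mem_Icc_add_mul_I (A := fun z => A z t) z fun x =>
    hA.periodic _ (by simpa [closedStrip] using hz) t ht
  refine ⟨x + z.im * Complex.I, ?_, he⟩
  rw [stripBox, Complex.mem_reProdIm]
  simpa using ⟨hx, abs_le.1 hz⟩

/-- Values on a thin tube are close to values on the compact core of the tube. -/
lemma exists_tube_mapsTo {b : ℂ × ℂ → ℂ} (hb : Continuous b)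
    (hper : ∀ z w, b (z + 2 * Real.pi, w) = b (z, w)) {σ : ℝ} (hσ : 0 ≤ σ) {V : Set ℂ} (hV : IsOpen V)
    (h : ∀ z ∈ stripBox σ, ∀ t ∈ Icc (0 : ℝ) 1, b (z, (t : ℂ)) ∈ V) :
    ∃ ε, 0 < ε ∧ MapsTo b (tube σ ε) V := by
  have hK : IsCompact (stripBox σ ×ˢ ((fun t : ℝ => (t : ℂ)) '' Icc (0 : ℝ) 1)) :=
    (isCompact_stripBox σ).prod (isCompact_Icc.image Complex.continuous_ofReal)
  obtain ⟨ε, hε, hsub⟩ := hK.exists_thickening_subset_open (hV.preimage hb) (by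
    rintro ⟨z, w⟩ ⟨hz, t, ht, rfl⟩
    exact h z hz t ht)
  refine ⟨ε, hε, ?_⟩
  rintro ⟨z, w⟩ ⟨hz, hw⟩
  obtain ⟨x, hx, he⟩ := exists_mem_Icc_add_mul_I (A := fun z => b (z, w)) z fun x => hper _ _
  obtain ⟨w', hw', hww⟩ := Metric.mem_thickening_iff.1 hw
  have hz' : |z.im| < σ + ε := hz
  obtain ⟨y, hy, hyz⟩ : ∃ y ∈ Icc (-σ) σ, |z.im - y| < ε := by
    refine ⟨max (-σ) (min z.im σ), ⟨le_max_left _ _, max_le (by linarith) (min_le_right _ _)⟩, ?_⟩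
    rw [abs_lt] at hz' ⊢
    rcases max_cases (-σ) (min z.im σ) with h1 | h1 <;>
      rcases min_cases z.im σ with h2 | h2 <;> constructor <;> linarith
  change b (z, w) ∈ V
  rw [he]
  refine hsub (Metric.mem_thickening_iff.2 ⟨(x + y * Complex.I, w'), ⟨?_, hw'⟩, ?_⟩)
  · rw [stripBox, Complex.mem_reProdIm]
    simpa using ⟨hx, hy⟩
  · rw [Prod.dist_eq]
    refine max_lt ?_ hww
    rw [dist_eq_norm, add_sub_add_left_eq_sub, ← sub_mul, ← Complex.ofReal_sub, norm_mul,
      Complex.norm_I, mul_one, Complex.norm_real]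
    exact hyz

namespace Y

variable {σ : ℝ} {m : ℕ}

lemma mem_imageIn_iff (hσ : 0 < σ) (hm : 1 < m) {U : Set ℂ} {a : Y σ m} :
    a ∈ imageIn σ m U ↔ ∀ z ∈ closedStrip σ, ∀ t ∈ Icc (0 : ℝ) 1, ev a z t ∈ U := by
  refine ⟨fun ⟨A, hA, h⟩ z hz t ht => ?_, fun h => ⟨_, isContinuation_ev hσ hm a, h⟩⟩
  rw [ev_eq hσ hm hA hz ht]
  exact h z hz t ht

/-- The image of an element of `Y`. -/
def image (a : Y σ m) : Set ℂ :=
  (fun w : ℂ × ℝ => ev a w.1 w.2) '' (stripBox σ ×ˢ Icc (0 : ℝ) 1)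

lemma isCompact_image (hσ : 0 < σ) (hm : 1 < m) (a : Y σ m) : IsCompact (image a) :=
  ((isCompact_stripBox σ).prod isCompact_Icc).image_of_continuousOn
    ((isContinuation_ev hσ hm a).continuousOn.mono (prod_mono_left (stripBox_subset σ)))

lemma ev_mem_image (hσ : 0 < σ) (hm : 1 < m) (a : Y σ m) {z : ℂ} (hz : z ∈ closedStrip σ) {t : ℝ}
    (ht : t ∈ Icc (0 : ℝ) 1) : ev a z t ∈ image a := by
  obtain ⟨z', hz', e⟩ := (isContinuation_ev hσ hm a).isStripFunction.exists_stripBox hz ht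
  exact ⟨(z', t), ⟨hz', ht⟩, e.symm⟩

lemma image_subset (hσ : 0 < σ) (hm : 1 < m) {U : Set ℂ} {a : Y σ m} (ha : a ∈ imageIn σ m U) :
    image a ⊆ U := by
  rintro _ ⟨⟨z, t⟩, ⟨hz, ht⟩, rfl⟩
  exact (mem_imageIn_iff hσ hm).1 ha z (stripBox_subset σ hz) t ht

lemma dist_ev_le (hσ : 0 < σ) (hm : 1 < m) (a b : Y σ m) {z : ℂ} (hz : z ∈ closedStrip σ) {t : ℝ}
    (ht : t ∈ Icc (0 : ℝ) 1) : dist (ev a z t) (ev b z t) ≤ supConst * ‖a - b‖ := by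
  rw [dist_eq_norm, ← evCLM_apply hσ hm hz ht a, ← evCLM_apply hσ hm hz ht b, ← map_sub]
  exact norm_ev_le hσ hm _ hz ht

lemma isOpen_imageIn (hσ : 0 < σ) (hm : 1 < m) {U : Set ℂ} (hU : IsOpen U) :
    IsOpen (imageIn σ m U) := by
  rw [Metric.isOpen_iff]
  intro a ha
  obtain ⟨δ, hδ, hsub⟩ := (isCompact_image hσ hm a).exists_thickening_subset_open hU
    (image_subset hσ hm ha)
  have hs := supConst_nonneg
  refine ⟨δ / (supConst + 1), by positivity, fun b hb => ?_⟩
  rw [mem_imageIn_iff hσ hm]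
  intro z hz t ht
  refine hsub (Metric.mem_thickening_iff.2 ⟨_, ev_mem_image hσ hm a hz ht, ?_⟩)
  refine (dist_ev_le hσ hm b a hz ht).trans_lt ?_
  rw [Metric.mem_ball, dist_eq_norm, lt_div_iff₀ (by positivity)] at hb
  nlinarith [norm_nonneg (b - a)]

lemma ev_mulY_pow (hσ : 0 < σ) (hm : 1 < m) (h g : Y σ m) (n : ℕ) {z : ℂ} (hz : z ∈ closedStrip σ)
    {t : ℝ} (ht : t ∈ Icc (0 : ℝ) 1) :
    ev ((mulY hσ hm h ^ n) g) z t = ev h z t ^ n * ev g z t := by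
  induction n with
  | zero => simp
  | succ n ih =>
    rw [pow_succ', mul_apply_eq_comp, ev_mulY hσ hm _ _ hz ht, ih]
    ring

open Classical in
/-- The element of `Y` with continuation `f(a(z,ψ))`, if there is one. -/
def comp (f : ℂ → ℂ) (a : Y σ m) : Y σ m :=
  if h : ∃ c : Y σ m, ∀ z ∈ closedStrip σ, ∀ t ∈ Icc (0 : ℝ) 1, ev c z t = f (ev a z t)
  then h.choose else 0

lemma comp_eq (hσ : 0 < σ) (hm : 1 < m) {f : ℂ → ℂ} {a c : Y σ m}
    (hc : ∀ z ∈ closedStrip σ, ∀ t ∈ Icc (0 : ℝ) 1, ev c z t = f (ev a z t)) : comp f a = c := by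
  have h : ∃ c : Y σ m, ∀ z ∈ closedStrip σ, ∀ t ∈ Icc (0 : ℝ) 1, ev c z t = f (ev a z t) :=
    ⟨c, hc⟩
  rw [comp, dif_pos h]
  refine ev_ext hσ hm fun z hz t ht => ?_
  rw [h.choose_spec z hz t ht, hc z hz t ht]

/-- Taylor coefficients of `f` along a trigonometric polynomial. -/
lemma exists_taylor (hσ : 0 < σ) (hm : 1 < m) {f : ℂ → ℂ} {b : TrigPoly} {ε δ M : ℝ} (hε : 0 < ε)
    (hδ : 0 < δ) (hM : 0 ≤ M)
    (hf : ∀ y ∈ tube σ ε, ∀ v ∈ Metric.closedBall (evalTrig y.1 y.2 b) δ,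
      AnalyticAt ℂ f v ∧ ‖f v‖ ≤ M) (n : ℕ) :
    ∃ g : Y σ m, (∀ z ∈ closedStrip σ, ∀ t ∈ Icc (0 : ℝ) 1,
      ev g z t = (n.factorial : ℂ)⁻¹ * iteratedDeriv n f (evalTrig z (t : ℂ) b)) ∧
      ‖g‖ ≤ tubeConst ε m * (M / δ ^ n) := by
  obtain ⟨g, hg, hn⟩ := exists_isContinuation_of_tube (M := M / δ ^ n)
    (G := fun y => (n.factorial : ℂ)⁻¹ * iteratedDeriv n f (evalTrig y.1 y.2 b)) hσ hε m
    (by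
      intro y hy
      have h1 := (hf y hy _ (Metric.mem_closedBall_self hδ.le)).1.iterated_deriv n
      rw [← iteratedDeriv_eq_iterate] at h1
      exact analyticAt_const.mul
        (h1.comp (f := fun w : ℂ × ℂ => evalTrig w.1 w.2 b) (analyticOnNhd_evalTrig b y trivial)))
    (fun z w => by simp only [evalTrig_add_two_pi]) (by positivity) (by
      intro y hy
      have hd : DifferentiableOn ℂ f (Metric.closedBall (evalTrig y.1 y.2 b) δ) :=
        fun v hv => (hf y hy v hv).1.differentiableAt.differentiableWithinAt
      have h1 := Complex.norm_iteratedDeriv_le_of_forall_mem_sphere_norm_le n hδ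
        (hd.diffContOnCl_ball subset_rfl)
        fun v hv => (hf y hy v (Metric.sphere_subset_closedBall hv)).2
      rw [norm_mul, norm_inv, Complex.norm_natCast]
      have hfac : (0 : ℝ) < n.factorial := by exact_mod_cast n.factorial_pos
      rw [inv_mul_le_iff₀ hfac]
      exact h1.trans_eq (by ring))
  exact ⟨g, fun z hz t ht => ev_eq hσ hm hg hz ht, hn⟩

/-- Near an element whose image is in the domain of `f`, the composition with `f` is defined and
analytic. -/
lemma analyticAt_comp (hσ : 0 < σ) (hm : 1 < m) {U : Set ℂ} (hU : IsOpen U) {f : ℂ → ℂ}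
    (hf : AnalyticOnNhd ℂ f U) {a : Y σ m} (ha : a ∈ imageIn σ m U) :
    AnalyticAt ℂ (comp f : Y σ m → Y σ m) a ∧
      ∀ z ∈ closedStrip σ, ∀ t ∈ Icc (0 : ℝ) 1, ev (comp f a) z t = f (ev a z t) := by
  have := completeSpace (m := m) hσ.le
  have hs := supConst_nonneg
  have hK := isCompact_image hσ hm a
  obtain ⟨δ', hδ', hsub⟩ := hK.exists_cthickening_subset_open hU (image_subset hσ hm ha)
  obtain ⟨δ, hδ, rfl⟩ : ∃ δ, 0 < δ ∧ δ' = δ + δ := ⟨δ' / 2, by positivity, by ring⟩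
  obtain ⟨M, hM⟩ := hK.cthickening.exists_bound_of_continuousOn (hf.continuousOn.mono hsub)
  have hM0 : 0 ≤ M := (norm_nonneg _).trans (hM _ (Metric.self_subset_cthickening _
    (ev_mem_image hσ hm a (z := 0) (by simpa [closedStrip] using hσ.le) (left_mem_Icc.2 zero_le_one))))
  set N : ℝ := ‖mulY (m := m) hσ hm‖ + supConst + 1 with hN
  have hN0 : 0 < N := by positivity
  obtain ⟨ρ, hρ⟩ : ∃ ρ : NNReal, (ρ : ℝ) = δ / N := ⟨⟨δ / N, by positivity⟩, rfl⟩
  have hρ0 : 0 < ρ := by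
    rw [← NNReal.coe_pos, hρ]
    positivity
  have hsupρ : ∀ r : ℝ, 0 ≤ r → r < ρ → supConst * r < δ := by
    intro r hr0 hr
    rw [hρ, lt_div_iff₀ hN0] at hr
    nlinarith [norm_nonneg (mulY (m := m) hσ hm)]
  have hmulρ : ‖mulY (m := m) hσ hm‖ * ρ ≤ δ := by
    rw [hρ, mul_div_assoc', div_le_iff₀ hN0, mul_comm]
    exact mul_le_mul_of_nonneg_left (by linarith) hδ.le
  obtain ⟨b, hb⟩ := exists_trigY_approx a (NNReal.coe_pos.2 hρ0)
  obtain ⟨ε, hε, hmaps⟩ := exists_tube_mapsTo (b := fun w => evalTrig w.1 w.2 b)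
    (differentiable_evalTrig b).continuous (fun z w => evalTrig_add_two_pi b z w) hσ.le
    (Metric.isOpen_thickening (δ := δ) (E := image a)) (by
      intro z hz t ht
      have hz' := stripBox_subset σ hz
      refine Metric.mem_thickening_iff.2 ⟨_, ev_mem_image hσ hm a hz' ht, ?_⟩
      rw [dist_comm, ← ev_trigY hσ hm b hz' ht]
      exact (dist_ev_le hσ hm a _ hz' ht).trans_lt (hsupρ _ (norm_nonneg _) hb))
  have hball : ∀ y ∈ tube σ ε, Metric.closedBall (evalTrig y.1 y.2 b) δ
      ⊆ Metric.cthickening (δ + δ) (image a) := by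
    intro y hy v hv
    obtain ⟨u, hu, huv⟩ := Metric.mem_thickening_iff.1 (hmaps hy)
    refine Metric.mem_cthickening_of_dist_le v u _ _ hu ?_
    exact (dist_triangle _ _ _).trans (add_le_add (Metric.mem_closedBall.1 hv) huv.le)
  choose g hgev hgn using exists_taylor (m := m) hσ hm (f := f) (b := b) hε hδ hM0
    fun y hy v hv => ⟨hf v (hsub (hball y hy hv)), hM v (hball y hy hv)⟩
  have hsol : ∀ h : Y σ m, ‖h‖ < ρ → ∀ s, HasSum (fun n => ((mulY hσ hm h) ^ n) (g n)) s →
      ∀ z ∈ closedStrip σ, ∀ t ∈ Icc (0 : ℝ) 1, ev s z t = f (ev (trigY σ m b + h) z t) := by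
    intro h hh s hsum z hz t ht
    have h1 := (evCLM hσ hm hz ht).hasSum hsum
    simp only [evCLM_apply, ev_mulY_pow hσ hm _ _ _ hz ht, hgev _ z hz t ht] at h1
    have hmem : (z, (t : ℂ)) ∈ tube σ ε :=
      ⟨(show |z.im| ≤ σ from hz).trans_lt (lt_add_of_pos_right σ hε),
        ofReal_mem_intervalNhd hε ht⟩
    have hd : DifferentiableOn ℂ f (Metric.ball (evalTrig z (t : ℂ) b) δ) := fun v hv =>
      (hf v (hsub (hball _ hmem (Metric.ball_subset_closedBall hv)))).differentiableAt
        |>.differentiableWithinAt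
    have he : ev (trigY σ m b + h) z t = evalTrig z (t : ℂ) b + ev h z t := by
      rw [← evCLM_apply hσ hm hz ht, map_add, evCLM_apply, evCLM_apply, ev_trigY hσ hm b hz ht]
    have hv : ev (trigY σ m b + h) z t ∈ Metric.ball (evalTrig z (t : ℂ) b) δ := by
      rw [he, mem_ball_iff_norm, add_sub_cancel_left]
      exact (norm_ev_le hσ hm h hz ht).trans_lt (hsupρ _ (norm_nonneg _) hh)
    have h2 := Complex.hasSum_taylorSeries_on_ball hd hv
    refine h1.unique (h2.congr_fun fun n => ?_)
    rw [he, add_sub_cancel_left, smul_eq_mul, smul_eq_mul]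
    ring
  have hps := hasFPowerSeriesOnBall_powSeries (L := mulY hσ hm) (g := g) (r := ρ) hρ0
    (C := tubeConst ε m * M) (F := comp f) (x := trigY σ m b) (by
      intro n
      have hT : 0 ≤ tubeConst ε m := Real.sqrt_nonneg _
      refine (mul_le_mul (hgn n) (pow_le_pow_left₀ (by positivity) hmulρ n) (by positivity)
        (by positivity)).trans_eq ?_
      field_simp)
    fun h hh s hsum => comp_eq hσ hm (hsol h hh s hsum)
  refine ⟨hps.analyticAt_of_mem (by
    rw [Metric.mem_eball, edist_dist, dist_eq_norm]
    exact (ENNReal.ofReal_lt_coe_iff (norm_nonneg _)).2 hb), ?_⟩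
  have hmem : a - trigY σ m b ∈ Metric.eball (0 : Y σ m) ρ := by
    simpa [enorm] using hb
  have hsum := hps.hasSum hmem
  simp only [powSeries_apply] at hsum
  have := hsol _ hb _ hsum
  rwa [add_sub_cancel] at this

end Y

end PartialAnalytic

end

theorem mainTheorem4 (σ : ℝ) (hσ : 0 < σ) (m : ℕ) (hm : 1 < m)
    (U : Set ℂ) (hU : IsOpen U) (f : ℂ → ℂ) (hf : AnalyticOnNhd ℂ f U) :
    (∀ a : PartialAnalytic.Y σ m, ∃ A : ℂ → ℝ → ℂ,
      PartialAnalytic.IsContinuation σ (PartialAnalytic.Y.toL2 a) A ∧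
      ∀ B : ℂ → ℝ → ℂ, PartialAnalytic.IsContinuation σ (PartialAnalytic.Y.toL2 a) B →
        ∀ z ∈ PartialAnalytic.closedStrip σ, ∀ t ∈ Set.Icc (0 : ℝ) 1, B z t = A z t) ∧
    IsOpen (PartialAnalytic.imageIn σ m U) ∧
    ∃ F : PartialAnalytic.Y σ m → PartialAnalytic.Y σ m,
      (∀ a ∈ PartialAnalytic.imageIn σ m U, ∀ A : ℂ → ℝ → ℂ,
        PartialAnalytic.IsContinuation σ (PartialAnalytic.Y.toL2 a) A →
        PartialAnalytic.IsContinuation σ (PartialAnalytic.Y.toL2 (F a))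
          (fun z t => f (A z t))) ∧
      AnalyticOnNhd ℂ F (PartialAnalytic.imageIn σ m U) := by
  refine ⟨fun a => ⟨_, PartialAnalytic.Y.isContinuation_ev hσ hm a, fun B hB z hz t ht =>
    (PartialAnalytic.Y.ev_eq hσ hm hB hz ht).symm⟩, PartialAnalytic.Y.isOpen_imageIn hσ hm hU,
    PartialAnalytic.Y.comp f, fun a ha A hA => ?_,
    fun a ha => (PartialAnalytic.Y.analyticAt_comp hσ hm hU hf ha).1⟩
  refine (PartialAnalytic.Y.isContinuation_ev hσ hm _).congr hσ.le fun z hz t ht => ?_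
  rw [(PartialAnalytic.Y.analyticAt_comp hσ hm hU hf ha).2 z hz t ht,
    PartialAnalytic.Y.ev_eq hσ hm hA hz ht]
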